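/- Let $\omega=(0,1)^2$, $L_1,L_2>0$, $Y=(0,L_1)\times(0,L_2)$, and let $G:\mathbb R^2\to\mathbb R$ be smooth and $Y$-periodic with $0<G_0\le G\le G_1$. Write $\mathbf x=(\hat x,x_3)$ with $\hat x\in\mathbb R^2$, and for $\varepsilon>0$ put $$\Omega_\varepsilon=\{(\hat x,x_3):\hat x\in\omega,\ 0<x_3<\varepsilon G(\hat x/\varepsilon)\},\qquad Y^*=\{(\hat y,y_3):\hat y\in Y,\ 0<y_3<G(\hat y)\},$$ and let $\partial Y^*_{inf}=\{\hat y\in Y,\ y_3=0\}$, $\partial Y^*_{sup}=\{\hat y\in Y,\ y_3=G(\hat y)\}$ be the bottom and the top of $Y^*$. Let $V_\varepsilon=\{\mathbf v\in H^1_0(\Omega_\varepsilon)^3:\operatorname{div}\mathbf v=0\}$, let $\mu,g>0$ be constants, and let $\mathbf f_\varepsilon\in L^2(\Omega_\varepsilon)^3$ satisfy $\varepsilon^{-1/2}\|\mathbf f_\varepsilon\|_{L^2(\Omega_\varepsilon)^3}\le C$ with $C$ independent of $\varepsilon$. Let $\mathbf u_\varepsilon\in V_\varepsilon$ be the solution of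 the Bingham variational inequality $$\mu\varepsilon^2\int_{\Omega_\varepsilon}\nabla\mathbf u_\varepsilon\cdot\nabla(\mathbf v-\mathbf u_\varepsilon)\,d\mathbf x+g\varepsilon\int_{\Omega_\varepsilon}|\nabla\mathbf v|\,d\mathbf x-g\varepsilon\int_{\Omega_\varepsilon}|\nabla\mathbf u_\varepsilon|\,d\mathbf x\ \ge\ \int_{\Omega_\varepsilon}\mathbf f_\varepsilon\cdot(\mathbf v-\mathbf u_\varepsilon)\,d\mathbf x\qquad\forall\,\mathbf v\in V_\varepsilon .$$ Let $N_\varepsilon,M_\varepsilon$ be the largest integers with $\varepsilon L_1(N_\varepsilon+1)\le1$ and $\varepsilon L_2(M_\varepsilon+1)\le1$, let $\omega^\varepsilon$ be the interior of the union of the closed rectangles $[i\varepsilon L_1,(i+1)\varepsilon L_1]\times[j\varepsilon L_2,(j+1)\varepsilon L_2]$, $0\le i\le N_\varepsilon$, $0\le j\le M_\varepsilon$, and define the unfolding operator, for $(\hat x,\mathbf y)\in\omega\times Y^*$, by $$\mathcal T_\varepsilon(\varphi)(\hat x,\mathbf y)=\begin{cases}\varphi\big(\varepsilon k_1L_1+\varepsilon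 y_1,\ \varepsilon k_2L_2+\varepsilon y_2,\ \varepsilon y_3\big), & \hat x\in\omega^\varepsilon,\quad k_j=\lfloor x_j/(\varepsilon L_j)\rfloor\ (j=1,2),\\ 0,&\hat x\in\omega\setminus\omega^\varepsilon,\end{cases}$$ componentwise on vector fields. Then every sequence of values $\varepsilon>0$ tending to $0$ has a subsequence, still denoted by $\varepsilon$, for which there is $\mathbf u=(\hat u,u_3)\in L^2(\omega;H^1(Y^*)^3)$ such that $$\mathcal T_\varepsilon(\mathbf u_\varepsilon)\rightharpoonup\mathbf u\ \text{ weakly in } L^2(\omega;H^1(Y^*)^3),\qquad \varepsilon\,\mathcal T_\varepsilon\Big(\frac{\partial\mathbf u_\varepsilon}{\partial x_i}\Big)\rightharpoonup\frac{\partial\mathbf u}{\partial y_i}\ \text{ weakly in } L^2(\omega\times Y^*)^3,\quad i=1,2,3,$$ $$\operatorname{div}_{\mathbf y}\mathbf u=0\ \text{ a.e. in }\omega\times Y^*,\qquad \mathbf u=0\ \text{ on }\omega\times(\partial Y^*_{inf}\cup\partial Y^*_{sup})\ \text{ in the sense of traces, for a.e. } \hat x\in\omega,$$ $$\int_{Y^*}u_3(\hat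 x,\mathbf y)\,d\mathbf y=0\ \text{ for a.e. }\hat x\in\omega,$$ $$\operatorname{div}_{\hat x}\Big(\int_{Y^*}\hat u\,d\mathbf y\Big)=0\ \text{ in }\omega,\qquad \Big(\int_{Y^*}\hat u\,d\mathbf y\Big)\cdot n=0\ \text{ on }\partial\omega,$$ where $n$ is the outward normal; the divergence is taken in the sense of distributions and the normal trace in the weak sense, i.e. $\int_\omega\big(\int_{Y^*}\hat u\,d\mathbf y\big)\cdot\nabla q\,d\hat x=0$ for all $q\in H^1(\omega)$. -/

import Mathlib

open MeasureTheory Filter Topology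
open scoped ContDiff

namespace ThinBingham

noncomputable section

/-- Euclidean space `ℝᵈ`. Coordinates `1, 2, 3` of the mathematics are the indices `0, 1, 2`. -/
abbrev E (d : ℕ) : Type := EuclideanSpace ℝ (Fin d)

/-- The horizontal part `(x₁, x₂)` of a point or vector of `ℝ³`. -/
def hat (x : E 3) : E 2 := !₂[x 0, x 1]

/-- Classical partial derivative `∂φ/∂xᵢ`. -/
def pderiv {d : ℕ} {F : Type*} [NormedAddCommGroup F] [InnerProductSpace ℝ F]
    (i : Fin d) (φ : E d → F) (x : E d) : F :=
  fderiv ℝ φ x (EuclideanSpace.single i (1 : ℝ))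

/-- Smooth functions whose compact support is contained in `U`. -/
def IsTest {d : ℕ} {F : Type*} [NormedAddCommGroup F] [InnerProductSpace ℝ F]
    (U : Set (E d)) (φ : E d → F) : Prop :=
  ContDiff ℝ ∞ φ ∧ HasCompactSupport φ ∧ tsupport φ ⊆ U

/-- `v ∈ L²(U; F)`. -/
def IsL2 {d : ℕ} {F : Type*} [NormedAddCommGroup F] [InnerProductSpace ℝ F]
    (U : Set (E d)) (v : E d → F) : Prop :=
  MemLp v 2 (volume.restrict U)

/-- `v ∈ H¹(U; F)`, and `Dv i` is its weak partial derivative in the direction `xᵢ`. -/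
def IsH1 {d : ℕ} {F : Type*} [NormedAddCommGroup F] [InnerProductSpace ℝ F]
    (U : Set (E d)) (v : E d → F) (Dv : Fin d → E d → F) : Prop :=
  IsL2 U v ∧ (∀ i, IsL2 U (Dv i)) ∧
    ∀ i, ∀ φ : E d → ℝ, IsTest U φ →
      ∫ x in U, pderiv i φ x • v x = - ∫ x in U, φ x • Dv i x

/-- The smooth functions `φ n` converge to `v`, whose weak partial derivatives are `Dv i`,
in the norm of `H¹(U; F)`. -/
def TendstoH1 {d : ℕ} {F : Type*} [NormedAddCommGroup F] [InnerProductSpace ℝ F]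
    (U : Set (E d)) (φ : ℕ → E d → F) (v : E d → F) (Dv : Fin d → E d → F) : Prop :=
  Tendsto (fun n => eLpNorm (fun x => φ n x - v x) 2 (volume.restrict U)) atTop (𝓝 0) ∧
    ∀ i, Tendsto (fun n => eLpNorm (fun x => pderiv i (φ n) x - Dv i x) 2 (volume.restrict U))
      atTop (𝓝 0)

/-- `v ∈ H¹₀(U; F)`, the closure of the test functions in `H¹(U; F)`, with weak partial
derivatives `Dv i`. -/
def IsH10 {d : ℕ} {F : Type*} [NormedAddCommGroup F] [InnerProductSpace ℝ F]
    (U : Set (E d)) (v : E d → F) (Dv : Fin d → E d → F) : Prop :=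
  IsH1 U v Dv ∧ ∃ φ : ℕ → E d → F, (∀ n, IsTest U (φ n)) ∧ TendstoH1 U φ v Dv

/-- The function `v ∈ H¹(U; F)`, with weak partial derivatives `Dv i`, has the trace `t` on the
part `Γ` of the boundary of the bounded Lipschitz domain `U ⊆ ℝ³`: the trace operator is the
continuous extension to `H¹` of the restriction to `Γ` of the functions that are smooth up to the
boundary, with values in `L²(Γ)` for the surface measure (two-dimensional Hausdorff measure). -/
def HasTrace {F : Type*} [NormedAddCommGroup F] [InnerProductSpace ℝ F]
    (U Γ : Set (E 3)) (v : E 3 → F) (Dv : Fin 3 → E 3 → F) (t : E 3 → F) : Prop :=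
  IsH1 U v Dv ∧ ∃ φ : ℕ → E 3 → F, (∀ n, ContDiff ℝ ∞ (φ n)) ∧ TendstoH1 U φ v Dv ∧
    Tendsto (fun n => eLpNorm (fun x => φ n x - t x) 2
      ((Measure.hausdorffMeasure 2 : Measure (E 3)).restrict Γ)) atTop (𝓝 0)

/-- The divergence of a vector field whose partial derivatives are `Dv i`. -/
def divg {d : ℕ} (Dv : Fin d → E d → E d) (x : E d) : ℝ := ∑ i, (Dv i x) i

/-- The Frobenius norm `|∇v|` of the gradient. -/
def gradNorm (Dv : Fin 3 → E 3 → E 3) (x : E 3) : ℝ := √(∑ i, ‖Dv i x‖ ^ 2)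

/-- The Frobenius product `∇v · ∇w`. -/
def gradDot (Dv Dw : Fin 3 → E 3 → E 3) (x : E 3) : ℝ := ∑ i, inner ℝ (Dv i x) (Dw i x)

/-! ### Geometry -/

/-- `ω = (0,1)²`. -/
def omega : Set (E 2) := {x | ∀ i, x i ∈ Set.Ioo (0 : ℝ) 1}

/-- The periodicity cell `Y = (0, L₁) × (0, L₂)`. -/
def cellY (L : Fin 2 → ℝ) : Set (E 2) := {y | ∀ i, y i ∈ Set.Ioo 0 (L i)}

/-- `G` is `Y`-periodic. -/
def YPeriodic (L : Fin 2 → ℝ) (G : E 2 → ℝ) : Prop :=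
  ∀ (i : Fin 2) (y : E 2), G (y + EuclideanSpace.single i (L i)) = G y

/-- The thin domain `Ω_ε`. -/
def thinDomain (G : E 2 → ℝ) (ε : ℝ) : Set (E 3) :=
  {x | hat x ∈ omega ∧ 0 < x 2 ∧ x 2 < ε * G (ε⁻¹ • hat x)}

/-- The representative cell `Y*`. -/
def cellYstar (L : Fin 2 → ℝ) (G : E 2 → ℝ) : Set (E 3) :=
  {y | hat y ∈ cellY L ∧ 0 < y 2 ∧ y 2 < G (hat y)}

/-- The bottom boundary of `Y*`. -/
def bottomYstar (L : Fin 2 → ℝ) : Set (E 3) := {y | hat y ∈ cellY L ∧ y 2 = 0}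

/-- The upper boundary of `Y*`. -/
def topYstar (L : Fin 2 → ℝ) (G : E 2 → ℝ) : Set (E 3) :=
  {y | hat y ∈ cellY L ∧ y 2 = G (hat y)}

/-! ### The Bingham problem in the thin domain -/

/-- `v ∈ V_ε`: divergence-free fields in `H¹₀(Ω_ε)³`; `Dv i` is `∂v/∂xᵢ`. -/
def IsAdmissible (G : E 2 → ℝ) (ε : ℝ) (v : E 3 → E 3) (Dv : Fin 3 → E 3 → E 3) : Prop :=
  IsH10 (thinDomain G ε) v Dv ∧ ∀ᵐ x ∂(volume.restrict (thinDomain G ε)), divg Dv x = 0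

/-- `u`, with partial derivatives `Du i`, solves the variational inequality of the Bingham flow
in `Ω_ε` with viscosity `μ ε²`, yield stress `g ε` and body force `f`. -/
def IsBinghamSolution (G : E 2 → ℝ) (μ g ε : ℝ) (f u : E 3 → E 3)
    (Du : Fin 3 → E 3 → E 3) : Prop :=
  IsAdmissible G ε u Du ∧
    ∀ (v : E 3 → E 3) (Dv : Fin 3 → E 3 → E 3), IsAdmissible G ε v Dv →
      μ * ε ^ 2 * (∫ x in thinDomain G ε, gradDot Du (fun i z => Dv i z - Du i z) x)
          + g * ε * (∫ x in thinDomain G ε, gradNorm Dv x)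
          - g * ε * (∫ x in thinDomain G ε, gradNorm Du x)
        ≥ ∫ x in thinDomain G ε, inner ℝ (f x) (v x - u x)

/-- The rescaled norm `|||f|||_{L²(Ω_ε)} = ε^{-1/2} ‖f‖_{L²(Ω_ε)}`. -/
def rescaledL2Norm (G : E 2 → ℝ) (ε : ℝ) (f : E 3 → E 3) : ℝ :=
  ε ^ (-(1 / 2) : ℝ) * (eLpNorm f 2 (volume.restrict (thinDomain G ε))).toReal

/-! ### The unfolding operator -/

/-- The largest integer `N` with `ε ℓ (N + 1) ≤ 1` (for `ε, ℓ > 0`). -/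
def lastCell (ℓ ε : ℝ) : ℤ := ⌊1 / (ε * ℓ)⌋ - 1

/-- The open cell `(i ε L₁, (i+1) ε L₁) × (j ε L₂, (j+1) ε L₂)`, where `k = (i, j)`. -/
def epsCell (L : Fin 2 → ℝ) (ε : ℝ) (k : Fin 2 → ℤ) : Set (E 2) :=
  {x | ∀ i, x i ∈ Set.Ioo (k i * ε * L i) ((k i + 1) * ε * L i)}

/-- `ω^ε`: the interior of the union of the closed cells contained in the closure of `ω`. -/
def omegaEps (L : Fin 2 → ℝ) (ε : ℝ) : Set (E 2) :=
  interior (⋃ k ∈ {k : Fin 2 → ℤ | ∀ i, 0 ≤ k i ∧ k i ≤ lastCell (L i) ε},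
    closure (epsCell L ε k))

/-- The integer part `[x]_L` of a point of the plane. -/
def intPart (L : Fin 2 → ℝ) (x : E 2) (i : Fin 2) : ℤ := ⌊x i / L i⌋

open Classical in
/-- The unfolding operator
`T_ε(φ)(x̂, y) = φ(ε [x̂/ε]_L L + ε ŷ, ε y₃)` for `x̂ ∈ ω^ε`, and `0` for the other `x̂`. -/
def unfoldOp {F : Type*} [NormedAddCommGroup F] (L : Fin 2 → ℝ) (ε : ℝ) (φ : E 3 → F)
    (x : E 2) (y : E 3) : F :=
  if x ∈ omegaEps L ε then
    φ !₂[ε * (intPart L (ε⁻¹ • x) 0 * L 0) + ε * y 0,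
         ε * (intPart L (ε⁻¹ • x) 1 * L 1) + ε * y 1,
         ε * y 2]
  else 0

/-! ### The spaces `L²(A × U)³` and `L²(A; H¹(U)³)` and their weak convergence -/

/-- `u ∈ L²(A × U)³`. -/
def IsL2Prod (A : Set (E 2)) (U : Set (E 3)) (u : E 2 → E 3 → E 3) : Prop :=
  MemLp (Function.uncurry u) 2 (volume.restrict (A ×ˢ U))

/-- `u ∈ L²(A; H¹(U)³)`, and `Du i` is its weak partial derivative `∂u/∂yᵢ`. A Bochner square
integrable map into `H¹(U)³` is given by a jointly measurable function `u(x̂, y)` such that `u` and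
its weak `y`-gradient are square integrable on `A × U`. -/
def IsL2H1 (A : Set (E 2)) (U : Set (E 3)) (u : E 2 → E 3 → E 3)
    (Du : Fin 3 → E 2 → E 3 → E 3) : Prop :=
  IsL2Prod A U u ∧ (∀ i, IsL2Prod A U (Du i)) ∧
    ∀ᵐ x ∂(volume.restrict A), IsH1 U (u x) (fun i => Du i x)

/-- Inner product of `L²(A × U)³`. -/
def innerL2 (A : Set (E 2)) (U : Set (E 3)) (u w : E 2 → E 3 → E 3) : ℝ :=
  ∫ p in A ×ˢ U, inner ℝ (u p.1 p.2) (w p.1 p.2)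

/-- Weak convergence in `L²(A × U)³`. -/
def WeakTendstoL2 (A : Set (E 2)) (U : Set (E 3)) (un : ℕ → E 2 → E 3 → E 3)
    (u : E 2 → E 3 → E 3) : Prop :=
  (∀ n, IsL2Prod A U (un n)) ∧ IsL2Prod A U u ∧
    ∀ w, IsL2Prod A U w → Tendsto (fun n => innerL2 A U (un n) w) atTop (𝓝 (innerL2 A U u w))

/-- Weak convergence in the Hilbert space `L²(A; H¹(U)³)`, tested by the inner product with an
arbitrary element. -/
def WeakTendstoL2H1 (A : Set (E 2)) (U : Set (E 3))
    (un : ℕ → E 2 → E 3 → E 3) (Dun : ℕ → Fin 3 → E 2 → E 3 → E 3)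
    (u : E 2 → E 3 → E 3) (Du : Fin 3 → E 2 → E 3 → E 3) : Prop :=
  (∀ n, IsL2H1 A U (un n) (Dun n)) ∧ IsL2H1 A U u Du ∧
    ∀ w Dw, IsL2H1 A U w Dw →
      Tendsto (fun n => innerL2 A U (un n) w + ∑ i, innerL2 A U (Dun n i) (Dw i)) atTop
        (𝓝 (innerL2 A U u w + ∑ i, innerL2 A U (Du i) (Dw i)))

/-! ### Divergence and normal trace of planar `L²` fields -/

/-- `div V = δ` in `U` in the sense of distributions. -/
def HasWeakDiv (U : Set (E 2)) (V : E 2 → E 2) (δ : E 2 → ℝ) : Prop :=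
  ∀ φ : E 2 → ℝ, IsTest U φ →
    ∫ x in U, ∑ i, V x i * pderiv i φ x = - ∫ x in U, δ x * φ x

/-- `V · n = 0` on `∂U` for a field `V ∈ L²(U)²` with weak divergence `δ ∈ L²(U)`: the functional
`q ↦ ∫_U (V · ∇q + δ q)` on `H¹(U)`, which defines the normal trace of `V`, vanishes. -/
def HasZeroNormalTrace (U : Set (E 2)) (V : E 2 → E 2) (δ : E 2 → ℝ) : Prop :=
  IsL2 U V ∧ IsL2 U δ ∧ HasWeakDiv U V δ ∧
    ∀ (q : E 2 → ℝ) (Dq : Fin 2 → E 2 → ℝ), IsH1 U q Dq →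
      ∫ x in U, ((∑ i, V x i * Dq i x) + δ x * q x) = 0

/-- The averaged horizontal flux `x̂ ↦ ∫_{Y*} û(x̂, y) dy`. -/
def meanFlux (Ystar : Set (E 3)) (u : E 2 → E 3 → E 3) (x : E 2) : E 2 :=
  !₂[∫ y in Ystar, u x y 0, ∫ y in Ystar, u x y 1]

end

end ThinBingham

open ThinBingham

/-! Testing the variational inequality with the zero field makes the plastic term drop out with a
favourable sign. The Poincaré inequality across the thin direction, with constant of order ε, then
gives ‖u_ε‖ = O(ε^{1/2}) and ε‖∇u_ε‖ = O(ε^{1/2}) (`exists_energy_bound`). Unfolding carries the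
part of Ω_ε above the full cells to ω × Y*, multiplying measure by |Y|/ε
(`measurePreserving_unfoldPoint`), so the unfolded fields and their rescaled gradients are bounded
in L²(ω × Y*).

Weak compactness is applied to the whole jet (u, ∂₁u, ∂₂u, ∂₃u) at once. The unfolded jets lie in
the closure of the linear space of jets that are smooth in y and vanish on the top and bottom of Y*.
The closure of a subspace is weakly closed, so the limit is again a strong limit of such jets, and
almost every slice of it inherits both the weak derivatives and the zero trace
(`exists_weak_limit`). The cell divergence passes to the limit by linearity
(`ae_divg_eq_zero_of_weak`).

The macroscopic conditions come from orthogonality: a solenoidal field in H¹₀ is orthogonal to every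
gradient, without boundary terms (`integral_sum_mul_grad_eq_zero`). The potential q(x̂), with q in
H¹(ω), yields at once the zero divergence and the zero normal flux of the mean of û. The potential
x₃ q(x̂) yields the vanishing mean of u₃, since x₃ = O(ε) on Ω_ε. The link between Ω_ε and ω × Y* is
`tendsto_average`: ε⁻¹ ∫ v_ε h(x̂) over Ω_ε converges to |Y|⁻¹ ∫ u h over ω × Y* for every h in
L²(ω). It is proved for continuous h, where unfolding barely moves the argument of h, and extended
by density. -/

namespace ThinBingham

open scoped ENNReal

/-! ### Cauchy–Schwarz and convergence of bilinear pairings in `L²` -/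

section Pairing

variable {α A B W : Type*} {m : MeasurableSpace α} {ν : Measure α}
  [NormedAddCommGroup A] [NormedSpace ℝ A] [NormedAddCommGroup B] [NormedSpace ℝ B]
  [NormedAddCommGroup W] [NormedSpace ℝ W]

/-- A general bilinear map covers the inner product, multiplication of vectors by scalars, and the
product of one coordinate with a scalar, all of which occur below. -/
theorem integrable_pairing (b : A →L[ℝ] B →L[ℝ] W) {f : α → A} {g : α → B}
    (hf : MemLp f 2 ν) (hg : MemLp g 2 ν) : Integrable (fun x => b (f x) (g x)) ν :=
  memLp_one_iff_integrable.1 (b.memLp_of_bilin 1 hf hg)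

theorem norm_integral_pairing_le (b : A →L[ℝ] B →L[ℝ] W) {f : α → A} {g : α → B}
    (hf : MemLp f 2 ν) (hg : MemLp g 2 ν) :
    ‖∫ x, b (f x) (g x) ∂ν‖ ≤ ‖b‖ * (eLpNorm f 2 ν).toReal * (eLpNorm g 2 ν).toReal := by
  have h1 : eLpNorm (fun x => b (f x) (g x)) 1 ν ≤ ‖b‖₊ * eLpNorm f 2 ν * eLpNorm g 2 ν :=
    eLpNorm_le_eLpNorm_mul_eLpNorm_of_nnnorm hf.1 hg.1 (fun u v => b u v) ‖b‖₊
      (Eventually.of_forall fun x => b.le_opNorm₂ _ _)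
  have h2 := (enorm_integral_le_lintegral_enorm (μ := ν) (fun x => b (f x) (g x))).trans
    (eLpNorm_one_eq_lintegral_enorm.symm.le.trans h1)
  have h3 := ENNReal.toReal_mono (by finiteness [hf.2.ne, hg.2.ne]) h2
  simpa [ENNReal.toReal_mul] using h3

theorem integrable_inner_of_memLp {F : Type*} [NormedAddCommGroup F] [InnerProductSpace ℝ F]
    {f g : α → F} (hf : MemLp f 2 ν) (hg : MemLp g 2 ν) :
    Integrable (fun x => inner ℝ (f x) (g x)) ν :=
  integrable_pairing (innerSL ℝ) hf hg

theorem abs_integral_inner_le {F : Type*} [NormedAddCommGroup F] [InnerProductSpace ℝ F]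
    {f g : α → F} (hf : MemLp f 2 ν) (hg : MemLp g 2 ν) :
    |∫ x, inner ℝ (f x) (g x) ∂ν| ≤ (eLpNorm f 2 ν).toReal * (eLpNorm g 2 ν).toReal := by
  refine (norm_integral_pairing_le (innerSL ℝ) hf hg).trans ?_
  rw [mul_assoc]
  exact mul_le_of_le_one_left (by positivity) (norm_innerSL_le ℝ)

theorem integral_norm_sq_eq {F : Type*} [NormedAddCommGroup F]
    {f : α → F} (hf : MemLp f 2 ν) : ∫ x, ‖f x‖ ^ 2 ∂ν = (eLpNorm f 2 ν).toReal ^ 2 := by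
  rw [hf.eLpNorm_eq_integral_rpow_norm (by norm_num) (by norm_num),
    ENNReal.toReal_ofReal (by positivity)]
  have h0 : 0 ≤ ∫ x, ‖f x‖ ^ (2 : ℝ) ∂ν := by positivity
  rw [show ENNReal.toReal 2 = (2 : ℝ) by simp, ← Real.rpow_natCast, ← Real.rpow_mul h0]
  simp

theorem tendsto_integral_pairing (b : A →L[ℝ] B →L[ℝ] W) {φ : ℕ → α → A} {f : α → A} {g : α → B}
    (hφ : ∀ n, MemLp (φ n) 2 ν) (hf : MemLp f 2 ν) (hg : MemLp g 2 ν)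
    (h : Tendsto (fun n => eLpNorm (fun x => φ n x - f x) 2 ν) atTop (𝓝 0)) :
    Tendsto (fun n => ∫ x, b (φ n x) (g x) ∂ν) atTop (𝓝 (∫ x, b (f x) (g x) ∂ν)) := by
  rw [tendsto_iff_norm_sub_tendsto_zero]
  have h' : Tendsto (fun n => ‖b‖ * (eLpNorm (fun x => φ n x - f x) 2 ν).toReal *
      (eLpNorm g 2 ν).toReal) atTop (𝓝 0) := by
    have := (ENNReal.tendsto_toReal (by simp)).comp h
    simpa using (this.const_mul ‖b‖).mul_const (eLpNorm g 2 ν).toReal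
  refine squeeze_zero (fun _ => norm_nonneg _) (fun n => ?_) h'
  have := norm_integral_pairing_le b ((hφ n).sub hf) hg
  rw [← integral_sub (integrable_pairing b (hφ n) hg) (integrable_pairing b hf hg)]
  simp only [Pi.sub_apply, map_sub, sub_apply] at this
  exact this

/-- Smooth approximants in `TendstoH1` are not required to be square integrable; finite distance to
an L² function supplies this for large indices. -/
theorem memLp_of_tendsto {F : Type*} [NormedAddCommGroup F] {φ : ℕ → α → F} {f : α → F}
    (hφ : ∀ n, AEStronglyMeasurable (φ n) ν) (hf : MemLp f 2 ν)
    (h : Tendsto (fun n => eLpNorm (fun x => φ n x - f x) 2 ν) atTop (𝓝 0)) :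
    ∀ᶠ n in atTop, MemLp (φ n) 2 ν := by
  filter_upwards [h.eventually (gt_mem_nhds (show (0 : ℝ≥0∞) < 1 by simp))] with n hn
  have : MemLp (fun x => φ n x - f x) 2 ν := ⟨(hφ n).sub hf.1, hn.trans (by simp)⟩
  refine (this.add hf).congr_norm (hφ n) (Eventually.of_forall fun x => ?_)
  simp

theorem tendsto_eLpNorm_of_tendsto_sub {F : Type*} [NormedAddCommGroup F] {φ : ℕ → α → F} {f : α → F} (hφ : ∀ n, MemLp (φ n) 2 ν) (hf : MemLp f 2 ν)
    (h : Tendsto (fun n => eLpNorm (fun x => φ n x - f x) 2 ν) atTop (𝓝 0)) :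
    Tendsto (fun n => eLpNorm (φ n) 2 ν) atTop (𝓝 (eLpNorm f 2 ν)) := by
  have up : Tendsto (fun n => eLpNorm f 2 ν + eLpNorm (fun x => φ n x - f x) 2 ν) atTop
      (𝓝 (eLpNorm f 2 ν)) := by simpa using tendsto_const_nhds.add h
  have lo : Tendsto (fun n => eLpNorm f 2 ν - eLpNorm (fun x => φ n x - f x) 2 ν) atTop
      (𝓝 (eLpNorm f 2 ν)) := by
    simpa using ENNReal.Tendsto.sub tendsto_const_nhds h (Or.inl hf.2.ne)
  refine tendsto_of_tendsto_of_tendsto_of_le_of_le lo up (fun n => ?_) (fun n => ?_)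
  · rw [tsub_le_iff_right]
    have := eLpNorm_sub_le (hφ n).1 ((hφ n).sub hf).1 (p := 2) (by norm_num)
    rwa [sub_sub_cancel] at this
  · have := eLpNorm_add_le hf.1 ((hφ n).sub hf).1 (p := 2) (by norm_num)
    rwa [add_sub_cancel] at this

end Pairing

/-! ### Test functions and partial derivatives -/

section Calculus

variable {d : ℕ} {F : Type*} [NormedAddCommGroup F] [InnerProductSpace ℝ F]

theorem continuous_pderiv {φ : E d → F} (hφ : ContDiff ℝ ∞ φ) (i : Fin d) :
    Continuous (pderiv i φ) :=
  (hφ.continuous_fderiv (by simp)).clm_apply continuous_const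

theorem contDiff_pderiv {φ : E d → F} (hφ : ContDiff ℝ ∞ φ) (i : Fin d) :
    ContDiff ℝ ∞ (pderiv i φ) :=
  (hφ.fderiv_right (m := ∞) (by simp)).clm_apply contDiff_const

theorem hasCompactSupport_pderiv {φ : E d → F} (hφ : HasCompactSupport φ) (i : Fin d) :
    HasCompactSupport (pderiv i φ) :=
  hφ.fderiv_apply ℝ _

theorem tsupport_pderiv_subset (φ : E d → F) (i : Fin d) :
    tsupport (pderiv i φ) ⊆ tsupport φ := by
  exact tsupport_fderiv_apply_subset ℝ _

theorem IsTest.pderiv {U : Set (E d)} {φ : E d → F} (hφ : IsTest U φ) (i : Fin d) :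
    IsTest U (pderiv i φ) :=
  ⟨contDiff_pderiv hφ.1 i, hasCompactSupport_pderiv hφ.2.1 i,
    (tsupport_pderiv_subset φ i).trans hφ.2.2⟩

theorem IsTest.eq_zero {U : Set (E d)} {φ : E d → F} (hφ : IsTest U φ) {x : E d} (hx : x ∉ U) :
    φ x = 0 :=
  image_eq_zero_of_notMem_tsupport fun h => hx (hφ.2.2 h)

theorem IsTest.pderiv_eq_zero {U : Set (E d)} {φ : E d → F} (hφ : IsTest U φ) (i : Fin d)
    {x : E d} (hx : x ∉ U) : ThinBingham.pderiv i φ x = 0 :=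
  (hφ.pderiv i).eq_zero hx

theorem IsTest.memLp {U : Set (E d)} {φ : E d → F} (hφ : IsTest U φ) (ν : Measure (E d))
    [IsFiniteMeasureOnCompacts ν] (p : ℝ≥0∞) : MemLp φ p ν :=
  hφ.1.continuous.memLp_of_hasCompactSupport hφ.2.1

theorem integral_pderiv_smul {ψ : E d → ℝ} {φ : E d → F} (hψ : ContDiff ℝ ∞ ψ)
    (hψc : HasCompactSupport ψ) (hφ : ContDiff ℝ ∞ φ) (i : Fin d) :
    ∫ x, pderiv i ψ x • φ x = - ∫ x, ψ x • pderiv i φ x := by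
  have := integral_smul_fderiv_eq_neg_fderiv_smul_of_integrable (μ := (volume : Measure (E d)))
    (f := ψ) (g := φ) (v := EuclideanSpace.single i (1 : ℝ))
    (((continuous_pderiv hψ i).smul hφ.continuous).integrable_of_hasCompactSupport
      (hasCompactSupport_pderiv hψc i).smul_right)
    ((hψ.continuous.smul (continuous_pderiv hφ i)).integrable_of_hasCompactSupport
      hψc.smul_right)
    ((hψ.continuous.smul hφ.continuous).integrable_of_hasCompactSupport hψc.smul_right)
    (fun x _ => (hψ.differentiable (by simp)).differentiableAt)
    (fun x _ => (hφ.differentiable (by simp)).differentiableAt)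
  simp only [pderiv]
  rw [this, neg_neg]

/-- Both sides of the integration by parts identity are L²-continuous, so the identity for smooth
functions passes to the limit. No regularity of U is used. -/
theorem isH1_of_tendstoH1 {U : Set (E d)} {φ : ℕ → E d → F} {v : E d → F}
    {Dv : Fin d → E d → F} (hφ : ∀ n, ContDiff ℝ ∞ (φ n)) (hv : IsL2 U v)
    (hDv : ∀ i, IsL2 U (Dv i)) (h : TendstoH1 U φ v Dv) : IsH1 U v Dv := by
  refine ⟨hv, hDv, fun i ψ hψ => ?_⟩
  have m1 := memLp_of_tendsto (fun n => (hφ n).continuous.aestronglyMeasurable) hv h.1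
  have m2 := memLp_of_tendsto (fun n => (continuous_pderiv (hφ n) i).aestronglyMeasurable)
    (hDv i) (h.2 i)
  obtain ⟨N, hN⟩ := eventually_atTop.1 (m1.and m2)
  have t1 := tendsto_integral_pairing (ContinuousLinearMap.lsmul ℝ ℝ : ℝ →L[ℝ] F →L[ℝ] F).flip
    (fun n => (hN (n + N) (by lia)).1) hv ((hψ.pderiv i).memLp (volume.restrict U) 2)
    (h.1.comp (tendsto_add_atTop_nat N))
  have t2 := tendsto_integral_pairing (ContinuousLinearMap.lsmul ℝ ℝ : ℝ →L[ℝ] F →L[ℝ] F).flip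
    (fun n => (hN (n + N) (by lia)).2) (hDv i) (hψ.memLp (volume.restrict U) 2)
    ((h.2 i).comp (tendsto_add_atTop_nat N))
  simp only [ContinuousLinearMap.flip_apply, ContinuousLinearMap.lsmul_apply] at t1 t2
  refine tendsto_nhds_unique t1 (t2.neg.congr fun n => ?_)
  rw [setIntegral_eq_integral_of_forall_compl_eq_zero
      (fun x hx => by rw [hψ.eq_zero hx, zero_smul]),
    setIntegral_eq_integral_of_forall_compl_eq_zero
      (fun x hx => by rw [hψ.pderiv_eq_zero i hx, zero_smul]),
    integral_pderiv_smul hψ.1 hψ.2.1 (hφ _)]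

theorem IsTest.isH1 {U : Set (E d)} {φ : E d → F} (hφ : IsTest U φ) :
    IsH1 U φ (fun i => ThinBingham.pderiv i φ) :=
  isH1_of_tendstoH1 (φ := fun _ => φ) (fun _ => hφ.1) (hφ.memLp _ 2)
    (fun i => (hφ.pderiv i).memLp _ 2) ⟨by simp, by simp⟩

/-- The Poincaré inequality in a slab of thickness `a`. -/
theorem IsTest.eLpNorm_le_of_slab {U : Set (E d)} {φ : E d → F} (hφ : IsTest U φ) (i : Fin d)
    {a : ℝ} (ha : 0 ≤ a) (hU : ∀ x ∈ U, |x i| ≤ a) :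
    eLpNorm φ 2 (volume.restrict U) ≤
      ENNReal.ofReal (2 * a) * eLpNorm (ThinBingham.pderiv i φ) 2 (volume.restrict U) := by
  -- Multiplier argument: ∂ᵢ(xᵢφ) = φ + xᵢ∂ᵢφ. Pairing with φ and integrating by parts gives ‖φ‖² =
  -- -∫ φ·xᵢ∂ᵢφ - ∫ ∂ᵢφ·xᵢφ, and each integral is at most a‖φ‖‖∂ᵢφ‖; hence the constant 2a.
  have hc : ContDiff ℝ ∞ (fun x : E d => x i) := by fun_prop
  have hg : ContDiff ℝ ∞ (fun x : E d => x i • φ x) := hc.smul hφ.1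
  have hgt : IsTest U (fun x : E d => x i • φ x) :=
    ⟨hg, hφ.2.1.smul_left, (tsupport_smul_subset_right _ _).trans hφ.2.2⟩
  have hd : ∀ x, ThinBingham.pderiv i (fun x : E d => x i • φ x) x
      = φ x + x i • ThinBingham.pderiv i φ x := by
    intro x
    have h1 : HasFDerivAt (fun x : E d => x i) (EuclideanSpace.proj i : E d →L[ℝ] ℝ) x :=
      (EuclideanSpace.proj i : E d →L[ℝ] ℝ).hasFDerivAt
    have h2 := (hφ.1.differentiable (by simp)).differentiableAt (x := x) |>.hasFDerivAt
    have h3 : HasFDerivAt (fun x : E d => x i • φ x) _ x := h1.smul h2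
    simp only [ThinBingham.pderiv]
    rw [h3.fderiv]
    simp [add_comm]
  have m0 := hφ.memLp (volume.restrict U) 2
  have m1 := (hφ.pderiv i).memLp (volume.restrict U) 2
  have m2 := hgt.memLp (volume.restrict U) 2
  have m3 : MemLp (fun x => x i • ThinBingham.pderiv i φ x) 2 (volume.restrict U) := by
    have := ((hgt.pderiv i).memLp (volume.restrict U) 2).sub m0
    refine this.congr_norm (((hc.continuous.smul (continuous_pderiv hφ.1 i))).aestronglyMeasurable)
      (Eventually.of_forall fun x => ?_)
    simp [hd]
  have ibp := integral_bilinear_fderiv_right_eq_neg_left_of_integrable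
    (μ := (volume : Measure (E d))) (f := φ) (g := fun x : E d => x i • φ x)
    (v := EuclideanSpace.single i (1 : ℝ)) (B := innerSL ℝ)
    (integrable_pairing _ ((hφ.pderiv i).memLp volume 2) (hgt.memLp volume 2))
    (integrable_pairing _ (hφ.memLp volume 2) ((hgt.pderiv i).memLp volume 2))
    (integrable_pairing _ (hφ.memLp volume 2) (hgt.memLp volume 2))
    (fun x _ => (hφ.1.differentiable (by simp)).differentiableAt)
    (fun x _ => (hg.differentiable (by simp)).differentiableAt)
  change ∫ x, inner ℝ (φ x) (ThinBingham.pderiv i (fun x : E d => x i • φ x) x)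
    = - ∫ x, inner ℝ (ThinBingham.pderiv i φ x) (x i • φ x) at ibp
  rw [← setIntegral_eq_integral_of_forall_compl_eq_zero (s := U)
      (f := fun x => inner ℝ (φ x) (ThinBingham.pderiv i (fun x : E d => x i • φ x) x))
      (fun x hx => by rw [hφ.eq_zero hx, inner_zero_left]),
    ← setIntegral_eq_integral_of_forall_compl_eq_zero (s := U)
      (f := fun x => inner ℝ (ThinBingham.pderiv i φ x) (x i • φ x))
      (fun x hx => by rw [hφ.eq_zero hx, smul_zero, inner_zero_right])] at ibp
  simp only [hd, inner_add_right, real_inner_self_eq_norm_sq] at ibp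
  rw [integral_add (by simpa using integrable_inner_of_memLp m0 m0)
    (integrable_inner_of_memLp m0 m3), integral_norm_sq_eq m0] at ibp
  have e2 := abs_integral_inner_le m0 m3
  have e1 := abs_integral_inner_le m1 m2
  -- Restricting the bound to points where φ or its derivative is nonzero avoids assuming that U is
  -- measurable.
  have hUae : ∀ᵐ x ∂(volume.restrict U), φ x ≠ 0 ∨ ThinBingham.pderiv i φ x ≠ 0 → |x i| ≤ a := by
    refine Eventually.of_forall fun x hx => hU x ?_
    by_contra hxU
    simp [hφ.eq_zero hxU, hφ.pderiv_eq_zero i hxU] at hx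
  have n2 : (eLpNorm (fun x => x i • φ x) 2 (volume.restrict U)).toReal ≤
      a * (eLpNorm φ 2 (volume.restrict U)).toReal := by
    have := eLpNorm_le_mul_eLpNorm_of_ae_le_mul (f := fun x => x i • φ x) (g := φ) (c := a)
      (μ := volume.restrict U) (by
        filter_upwards [hUae] with x hx
        by_cases h0 : φ x = 0
        · simp [h0]
        · rw [norm_smul]; gcongr; exact hx (Or.inl h0)) 2
    simpa [ENNReal.toReal_mul, ha] using ENNReal.toReal_mono (by finiteness [m0.2.ne]) this
  have n3 : (eLpNorm (fun x => x i • ThinBingham.pderiv i φ x) 2 (volume.restrict U)).toReal ≤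
      a * (eLpNorm (ThinBingham.pderiv i φ) 2 (volume.restrict U)).toReal := by
    have := eLpNorm_le_mul_eLpNorm_of_ae_le_mul (f := fun x => x i • ThinBingham.pderiv i φ x)
      (g := ThinBingham.pderiv i φ) (c := a) (μ := volume.restrict U) (by
        filter_upwards [hUae] with x hx
        by_cases h0 : ThinBingham.pderiv i φ x = 0
        · simp [h0]
        · rw [norm_smul]; gcongr; exact hx (Or.inr h0)) 2
    simpa [ENNReal.toReal_mul, ha] using ENNReal.toReal_mono (by finiteness [m1.2.ne]) this
  set A := (eLpNorm φ 2 (volume.restrict U)).toReal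
  set D := (eLpNorm (ThinBingham.pderiv i φ) 2 (volume.restrict U)).toReal
  have hA : 0 ≤ A := ENNReal.toReal_nonneg
  have hD : 0 ≤ D := ENNReal.toReal_nonneg
  have key : A * A ≤ A * (2 * a * D) := by
    have k1 := (neg_abs_le _).trans' (neg_le_neg (e2.trans (mul_le_mul_of_nonneg_left n3 hA)))
    have k2 := (neg_abs_le _).trans' (neg_le_neg (e1.trans (mul_le_mul_of_nonneg_left n2 hD)))
    nlinarith
  have fin : A ≤ 2 * a * D := by
    rcases hA.eq_or_lt with h | h
    · rw [← h]; positivity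
    · exact le_of_mul_le_mul_left key h
  rw [← ENNReal.ofReal_toReal m0.2.ne, ← ENNReal.ofReal_toReal m1.2.ne,
    ← ENNReal.ofReal_mul (by positivity)]
  exact ENNReal.ofReal_le_ofReal fin

theorem IsH10.eLpNorm_le_of_slab {U : Set (E d)} {v : E d → F} {Dv : Fin d → E d → F}
    (hv : IsH10 U v Dv) (i : Fin d) {a : ℝ} (ha : 0 ≤ a) (hU : ∀ x ∈ U, |x i| ≤ a) :
    eLpNorm v 2 (volume.restrict U) ≤
      ENNReal.ofReal (2 * a) * eLpNorm (Dv i) 2 (volume.restrict U) := by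
  obtain ⟨h1, φ, hφ, hlim⟩ := hv
  have t1 := tendsto_eLpNorm_of_tendsto_sub (fun n => (hφ n).memLp _ 2) h1.1 hlim.1
  have t2 := tendsto_eLpNorm_of_tendsto_sub (fun n => ((hφ n).pderiv i).memLp _ 2) (h1.2.1 i)
    (hlim.2 i)
  exact le_of_tendsto_of_tendsto' t1 (ENNReal.Tendsto.const_mul t2 (Or.inr ENNReal.ofReal_ne_top))
    fun n => (hφ n).eLpNorm_le_of_slab i ha hU

end Calculus

/-! ### The energy estimate -/

theorem abs_le_of_mem_thinDomain {G : E 2 → ℝ} {G₁ ε : ℝ} (hε : 0 < ε) (hG : ∀ y, G y ≤ G₁) :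
    ∀ x ∈ thinDomain G ε, |x 2| ≤ ε * G₁ := by
  rintro x ⟨-, h0, h1⟩
  rw [abs_of_pos h0]
  exact h1.le.trans (mul_le_mul_of_nonneg_left (hG _) hε.le)

theorem isAdmissible_zero (G : E 2 → ℝ) (ε : ℝ) : IsAdmissible G ε 0 0 := by
  have ht : IsTest (thinDomain G ε) (0 : E 3 → E 3) :=
    ⟨contDiff_const, HasCompactSupport.zero, by simp [tsupport]⟩
  have hd : ∀ i, ThinBingham.pderiv i (0 : E 3 → E 3) = 0 := by
    intro i; ext x : 1; simp [ThinBingham.pderiv]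
  refine ⟨⟨?_, fun _ => 0, fun _ => ht, ?_, ?_⟩, ?_⟩
  · have := ht.isH1
    simp only [hd] at this
    exact this
  · simp
  · intro i; simp [hd]
  · simp [divg]

/-- Take v = 0 as competitor: the yield term of u is nonnegative and can be discarded, and
Cauchy–Schwarz bounds the work of the force. -/
theorem IsBinghamSolution.energy_le {G : E 2 → ℝ} {μ g ε : ℝ} {f u : E 3 → E 3}
    {Du : Fin 3 → E 3 → E 3} (hg : 0 ≤ g) (hε : 0 ≤ ε)
    (hf : IsL2 (thinDomain G ε) f) (hu : IsBinghamSolution G μ g ε f u Du) :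
    μ * ε ^ 2 * ∑ i, (eLpNorm (Du i) 2 (volume.restrict (thinDomain G ε))).toReal ^ 2 ≤
      (eLpNorm f 2 (volume.restrict (thinDomain G ε))).toReal *
        (eLpNorm u 2 (volume.restrict (thinDomain G ε))).toReal := by
  have h := hu.2 0 0 (isAdmissible_zero G ε)
  have hH1 := hu.1.1.1
  have e1 : ∫ x in thinDomain G ε, gradDot Du (fun i z => (0 : Fin 3 → E 3 → E 3) i z - Du i z) x
      = - ∑ i, (eLpNorm (Du i) 2 (volume.restrict (thinDomain G ε))).toReal ^ 2 := by
    simp only [gradDot, Pi.zero_apply, zero_sub, inner_neg_right, real_inner_self_eq_norm_sq,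
      Finset.sum_neg_distrib, integral_neg]
    rw [integral_finsetSum _ fun i _ => by
      simpa using integrable_inner_of_memLp (hH1.2.1 i) (hH1.2.1 i)]
    simp only [integral_norm_sq_eq (hH1.2.1 _)]
  have e2 : ∫ x in thinDomain G ε, gradNorm (0 : Fin 3 → E 3 → E 3) x = 0 := by
    simp [gradNorm]
  have e3 : 0 ≤ ∫ x in thinDomain G ε, gradNorm Du x :=
    integral_nonneg fun x => Real.sqrt_nonneg _
  have e4 : ∫ x in thinDomain G ε, inner ℝ (f x) ((0 : E 3 → E 3) x - u x)
      = - ∫ x in thinDomain G ε, inner ℝ (f x) (u x) := by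
    simp [inner_neg_right, integral_neg]
  rw [e1, e2, e4] at h
  have e5 := (le_abs_self _).trans (abs_integral_inner_le hf hH1.1)
  have e6 : 0 ≤ g * ε * ∫ x in thinDomain G ε, gradNorm Du x := by positivity
  linarith

/-- The a priori bounds `‖u‖ ≤ M ε^{1/2}`, `‖∂ᵢu‖ ≤ M ε^{-1/2}` in `L²(Ω_ε)`, squared. -/
theorem exists_energy_bound {G : E 2 → ℝ} {G₁ μ g C : ℝ} (hG₁ : 0 ≤ G₁) (hG : ∀ y, G y ≤ G₁)
    (hμ : 0 < μ) (hg : 0 ≤ g) (hC : 0 ≤ C) :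
    ∃ M : ℝ, 0 ≤ M ∧ ∀ (ε : ℝ) (f u : E 3 → E 3) (Du : Fin 3 → E 3 → E 3), 0 < ε →
      IsL2 (thinDomain G ε) f → rescaledL2Norm G ε f ≤ C → IsBinghamSolution G μ g ε f u Du →
      (eLpNorm u 2 (volume.restrict (thinDomain G ε))).toReal ^ 2 ≤ M * ε ∧
      ∀ i, ε ^ 2 * (eLpNorm (Du i) 2 (volume.restrict (thinDomain G ε))).toReal ^ 2 ≤ M * ε := by
  refine ⟨(2 * G₁ * C / μ) ^ 2 + (2 * G₁) ^ 2 * (2 * G₁ * C / μ) ^ 2, by positivity, ?_⟩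
  intro ε f u Du hε hf hfC hu
  have hen := hu.energy_le hg hε.le hf
  have hpo := hu.1.1.eLpNorm_le_of_slab 2 (by positivity : 0 ≤ ε * G₁)
    (abs_le_of_mem_thinDomain hε hG)
  have hpo' := ENNReal.toReal_mono (by finiteness [(hu.1.1.1.2.1 2).2.ne]) hpo
  rw [ENNReal.toReal_mul, ENNReal.toReal_ofReal (by positivity)] at hpo'
  set N := volume.restrict (thinDomain G ε)
  set A := (eLpNorm u 2 N).toReal
  set B := (eLpNorm f 2 N).toReal
  have hA : 0 ≤ A := ENNReal.toReal_nonneg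
  have hB : 0 ≤ B := ENNReal.toReal_nonneg
  have hD : ∀ i, 0 ≤ (eLpNorm (Du i) 2 N).toReal := fun i => ENNReal.toReal_nonneg
  set D : Fin 3 → ℝ := fun i => (eLpNorm (Du i) 2 N).toReal with hDdef
  have hBC : B ≤ C * ε ^ (1 / 2 : ℝ) := by
    have h1 : ε ^ (1 / 2 : ℝ) * (ε ^ (-(1 / 2) : ℝ) * B) ≤ ε ^ (1 / 2 : ℝ) * C :=
      mul_le_mul_of_nonneg_left hfC (by positivity)
    rw [← mul_assoc, ← Real.rpow_add hε] at h1
    simpa [mul_comm] using h1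
  set r := ε ^ (1 / 2 : ℝ)
  have hr : 0 < r := by positivity
  have hr2 : r ^ 2 = ε := by
    rw [← Real.rpow_natCast, ← Real.rpow_mul hε.le]; norm_num
  have hS : ∀ i, D i ^ 2 ≤ ∑ i, D i ^ 2 := fun i =>
    Finset.single_le_sum (f := fun i => D i ^ 2) (fun i _ => sq_nonneg _) (Finset.mem_univ i)
  set S := ∑ i, D i ^ 2
  set K := 2 * G₁ * C / μ with hK
  have hK0 : 0 ≤ K := by positivity
  -- Energy estimate, force bound B ≤ C r and Poincaré A ≤ 2εG₁ D 2 combined. Since (D 2)² ≤ S, one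
  -- factor D 2 can then be cancelled, which bounds S itself by (K r/ε)².
  have h1 : μ * ε ^ 2 * S ≤ μ * ε ^ 2 * (K * r / ε * D 2) := by
    refine hen.trans ?_
    calc B * A ≤ (C * r) * (2 * (ε * G₁) * D 2) := mul_le_mul hBC hpo' hA (by positivity)
      _ = μ * ε ^ 2 * (K * r / ε * D 2) := by rw [hK]; field_simp
  have h2 : S ≤ K * r / ε * D 2 := le_of_mul_le_mul_left h1 (by positivity)
  have h3 : D 2 ≤ K * r / ε := by
    rcases (hD 2).eq_or_lt with h | h
    · rw [← show (0 : ℝ) = D 2 from h]; positivity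
    · refine le_of_mul_le_mul_right ?_ h
      have := (hS 2).trans h2
      rwa [sq] at this
  have h4 : S ≤ (K * r / ε) ^ 2 :=
    h2.trans (by rw [sq]; exact mul_le_mul_of_nonneg_left h3 (by positivity))
  have h5 : ε ^ 2 * S ≤ K ^ 2 * ε := by
    calc ε ^ 2 * S ≤ ε ^ 2 * (K * r / ε) ^ 2 := mul_le_mul_of_nonneg_left h4 (by positivity)
      _ = K ^ 2 * ε := by rw [← hr2]; field_simp
  constructor
  · have : A ^ 2 ≤ (2 * (ε * G₁) * D 2) ^ 2 := pow_le_pow_left₀ hA hpo' 2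
    have h6 : (2 * (ε * G₁) * D 2) ^ 2 = (2 * G₁) ^ 2 * (ε ^ 2 * D 2 ^ 2) := by ring
    have h7 : ε ^ 2 * D 2 ^ 2 ≤ K ^ 2 * ε :=
      (mul_le_mul_of_nonneg_left (hS 2) (by positivity)).trans h5
    have h8 := mul_le_mul_of_nonneg_left h7 (by positivity : 0 ≤ (2 * G₁) ^ 2)
    have h9 : 0 ≤ K ^ 2 * ε := by positivity
    linarith
  · intro i
    have h7 : ε ^ 2 * D i ^ 2 ≤ K ^ 2 * ε :=
      (mul_le_mul_of_nonneg_left (hS i) (by positivity)).trans h5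
    have h9 : 0 ≤ (2 * G₁) ^ 2 * K ^ 2 * ε := by positivity
    change ε ^ 2 * D i ^ 2 ≤ _
    linarith

/-! ### Boxes and the splitting `ℝ³ = ℝ² × ℝ` -/

theorem volume_setOf_forall_mem {d : ℕ} (s : Fin d → Set ℝ) :
    volume {x : E d | ∀ i, x i ∈ s i} = ∏ i, volume (s i) := by
  have h := (PiLp.volume_preserving_ofLp (Fin d)).measure_preimage_equiv
    (f := (MeasurableEquiv.toLp 2 (Fin d → ℝ)).symm) (Set.univ.pi s)
  rw [volume_pi_pi] at h
  rw [← h]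
  congr 1
  ext x
  simp

theorem measurableSet_setOf_forall_mem {d : ℕ} {s : Fin d → Set ℝ} (hs : ∀ i, MeasurableSet (s i)) :
    MeasurableSet {x : E d | ∀ i, x i ∈ s i} := by
  have : {x : E d | ∀ i, x i ∈ s i} = ⋂ i, (fun x : E d => x i) ⁻¹' s i := by ext; simp
  rw [this]
  exact MeasurableSet.iInter fun i => (by fun_prop : Measurable fun x : E d => x i) (hs i)

theorem isOpen_setOf_forall_mem {d : ℕ} {s : Fin d → Set ℝ} (hs : ∀ i, IsOpen (s i)) :
    IsOpen {x : E d | ∀ i, x i ∈ s i} := by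
  have : {x : E d | ∀ i, x i ∈ s i} = ⋂ i, (fun x : E d => x i) ⁻¹' s i := by ext; simp
  rw [this]
  exact isOpen_iInter_of_finite fun i => (hs i).preimage (by fun_prop)

theorem volume_coord_eq {d : ℕ} (i : Fin d) (c : ℝ) : volume {x : E d | x i = c} = 0 := by
  have : {x : E d | x i = c} = {x : E d | ∀ j, x j ∈ (if j = i then {c} else Set.univ : Set ℝ)} := by
    ext x
    constructor
    · intro h j
      by_cases hj : j = i
      · subst hj; simpa using h
      · simp [hj]
    · intro h
      simpa using h i
  rw [this, volume_setOf_forall_mem]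
  exact Finset.prod_eq_zero (Finset.mem_univ i) (by simp)

@[simp] theorem hat_zero_apply (x : E 3) : hat x 0 = x 0 := rfl

@[simp] theorem hat_one_apply (x : E 3) : hat x 1 = x 1 := rfl

theorem contDiff_hat : ContDiff ℝ ∞ hat := by
  rw [contDiff_euclidean]
  intro i
  fin_cases i <;> simp <;> fun_prop

theorem continuous_hat : Continuous hat := contDiff_hat.continuous

/-- The coordinates `x ↦ (x̂, x₃)`. -/
noncomputable def split : E 3 ≃ₜ E 2 × ℝ where
  toFun x := (hat x, x 2)
  invFun p := !₂[p.1 0, p.1 1, p.2]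
  left_inv x := by ext i; fin_cases i <;> simp
  right_inv p := by
    refine Prod.ext ?_ (by simp)
    ext i; fin_cases i <;> simp [hat]
  continuous_toFun := continuous_hat.prodMk (by fun_prop)
  continuous_invFun := by
    refine (PiLp.continuous_toLp 2 _).comp (continuous_pi fun i => ?_)
    fin_cases i <;> simp <;> fun_prop

theorem measurePreserving_split : MeasurePreserving split := by
  have h1 := PiLp.volume_preserving_ofLp (Fin 3)
  have h2 := volume_preserving_piFinSuccAbove (fun _ : Fin 3 => ℝ) 2
  have h3 : MeasurePreserving (Prod.swap : ℝ × (Fin 2 → ℝ) → (Fin 2 → ℝ) × ℝ) :=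
    Measure.measurePreserving_swap
  have h4 : MeasurePreserving (Prod.map (@WithLp.toLp 2 (Fin 2 → ℝ)) (id : ℝ → ℝ)) :=
    (PiLp.volume_preserving_toLp (Fin 2)).prod (MeasurePreserving.id _)
  have h := h4.comp (h3.comp (h2.comp h1))
  convert! h using 1
  ext x
  · rename_i i
    fin_cases i <;> rfl
  · rfl

/-- Each vertical fibre of Ω sits in (0, a), so by Fubini projection to the plane has density at
most a. This is the source of the factor √a, hence ε^{1/2}, in norms of functions of x̂ alone. -/
theorem map_hat_restrict_le {Ω : Set (E 3)} {A : Set (E 2)} {a : ℝ}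
    (h : ∀ x ∈ Ω, hat x ∈ A ∧ x 2 ∈ Set.Ioo 0 a) :
    Measure.map hat (volume.restrict Ω) ≤ ENNReal.ofReal a • volume.restrict A := by
  refine Measure.le_iff.2 fun B hB => ?_
  have hm : Measurable hat := continuous_hat.measurable
  rw [Measure.map_apply hm hB, Measure.restrict_apply (hm hB), Measure.smul_apply,
    Measure.restrict_apply hB, smul_eq_mul]
  calc volume (hat ⁻¹' B ∩ Ω) ≤ volume (split ⁻¹' ((B ∩ A) ×ˢ Set.Ioo 0 a)) := by
        refine measure_mono fun x hx => ?_
        exact ⟨⟨hx.1, (h x hx.2).1⟩, (h x hx.2).2⟩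
    _ = volume ((B ∩ A) ×ˢ Set.Ioo 0 a) :=
        measurePreserving_split.measure_preimage_equiv (f := split.toMeasurableEquiv) _
    _ = ENNReal.ofReal a * volume (B ∩ A) := by
        rw [Measure.volume_eq_prod, Measure.prod_prod, Real.volume_Ioo, sub_zero, mul_comm]

/-! ### Square integrable functions of the horizontal variables -/

section HatComp

variable {F : Type*} [NormedAddCommGroup F] {Ω : Set (E 3)} {A : Set (E 2)} {a : ℝ}

theorem memLp_comp_hat (h : ∀ x ∈ Ω, hat x ∈ A ∧ x 2 ∈ Set.Ioo 0 a) {q : E 2 → F}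
    (hq : MemLp q 2 (volume.restrict A)) : MemLp (fun x => q (hat x)) 2 (volume.restrict Ω) :=
  ((hq.smul_measure ENNReal.ofReal_ne_top).mono_measure
    (map_hat_restrict_le h)).comp_of_map continuous_hat.aemeasurable

theorem eLpNorm_comp_hat_le (h : ∀ x ∈ Ω, hat x ∈ A ∧ x 2 ∈ Set.Ioo 0 a) {q : E 2 → F}
    (hq : MemLp q 2 (volume.restrict A)) :
    (eLpNorm (fun x => q (hat x)) 2 (volume.restrict Ω)).toReal ≤
      √a * (eLpNorm q 2 (volume.restrict A)).toReal := by
  have hq' : MemLp q 2 (Measure.map hat (volume.restrict Ω)) :=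
    (hq.smul_measure ENNReal.ofReal_ne_top).mono_measure (map_hat_restrict_le h)
  have e1 : eLpNorm (fun x => q (hat x)) 2 (volume.restrict Ω)
      = eLpNorm q 2 (Measure.map hat (volume.restrict Ω)) :=
    (eLpNorm_map_measure hq'.1 continuous_hat.aemeasurable).symm
  have e2 := eLpNorm_mono_measure (p := 2) q (map_hat_restrict_le h)
  rw [eLpNorm_smul_measure_of_ne_top (by norm_num), ← e1] at e2
  have e3 := ENNReal.toReal_mono (by
    have := hq.2.ne
    simp only [smul_eq_mul]
    exact ENNReal.mul_ne_top (ENNReal.rpow_ne_top_of_nonneg (by simp) ENNReal.ofReal_ne_top)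
      this) e2
  refine e3.trans (le_of_eq ?_)
  rw [smul_eq_mul, ENNReal.toReal_mul, ← ENNReal.toReal_rpow]
  rcases le_total 0 a with ha | ha
  · rw [ENNReal.toReal_ofReal ha, Real.sqrt_eq_rpow]; norm_num
  · rw [ENNReal.ofReal_of_nonpos ha, Real.sqrt_eq_zero_of_nonpos ha]; norm_num

end HatComp

theorem measurableSet_omega : MeasurableSet omega :=
  measurableSet_setOf_forall_mem fun _ => measurableSet_Ioo

theorem isOpen_omega : IsOpen omega := isOpen_setOf_forall_mem fun _ => isOpen_Ioo

theorem volume_omega : volume omega = 1 := by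
  have := volume_setOf_forall_mem (d := 2) (fun _ => Set.Ioo (0 : ℝ) 1)
  simpa [omega] using this

theorem isOpen_thinDomain {G : E 2 → ℝ} (hG : Continuous G) (ε : ℝ) : IsOpen (thinDomain G ε) := by
  have hh := continuous_hat
  have h2 : Continuous fun x : E 3 => x 2 := by fun_prop
  have h3 : Continuous fun x : E 3 => ε * G (ε⁻¹ • hat x) := by fun_prop
  exact (isOpen_omega.preimage hh).inter ((isOpen_lt continuous_const h2).inter (isOpen_lt h2 h3))

theorem isOpen_cellYstar {G : E 2 → ℝ} (hG : Continuous G) (L : Fin 2 → ℝ) :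
    IsOpen (cellYstar L G) := by
  have hh := continuous_hat
  have h2 : Continuous fun x : E 3 => x 2 := by fun_prop
  have h1 : IsOpen (cellY L) := isOpen_setOf_forall_mem fun _ => isOpen_Ioo
  exact (h1.preimage hh).inter ((isOpen_lt continuous_const h2).inter (isOpen_lt h2 (hG.comp hh)))

theorem volume_le_of_hat {Ω : Set (E 3)} {A : Set (E 2)} {a : ℝ}
    (h : ∀ x ∈ Ω, hat x ∈ A ∧ x 2 ∈ Set.Ioo 0 a) :
    volume Ω ≤ ENNReal.ofReal a * volume A := by
  have h1 := map_hat_restrict_le h Set.univ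
  rw [Measure.map_apply continuous_hat.measurable MeasurableSet.univ] at h1
  simpa using h1

/-! ### The geometry of the unfolding operator -/

section Unfolding

variable {L : Fin 2 → ℝ} {G : E 2 → ℝ} {ε : ℝ}

/-- Indices of the cells contained in `ω`. -/
def cellIndices (L : Fin 2 → ℝ) (ε : ℝ) : Set (Fin 2 → ℤ) :=
  {k | ∀ i, 0 ≤ k i ∧ k i ≤ lastCell (L i) ε}

/-- The union of the open cells contained in `ω`. -/
def openCells (L : Fin 2 → ℝ) (ε : ℝ) : Set (E 2) :=
  ⋃ k : cellIndices L ε, epsCell L ε k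

/-- The part of `Ω_ε` that lies over the open cells. -/
def innerDomain (L : Fin 2 → ℝ) (G : E 2 → ℝ) (ε : ℝ) : Set (E 3) :=
  {x | x ∈ thinDomain G ε ∧ hat x ∈ openCells L ε}

/-- The affine map from `Y*` onto the `k`-th cell of `Ω_ε`. -/
noncomputable def cellMap (L : Fin 2 → ℝ) (ε : ℝ) (k : Fin 2 → ℤ) (y : E 3) : E 3 :=
  ε • (y + !₂[k 0 * L 0, k 1 * L 1, 0])

theorem cellMap_eq (k : Fin 2 → ℤ) (y : E 3) :
    cellMap L ε k y = !₂[ε * (k 0 * L 0) + ε * y 0, ε * (k 1 * L 1) + ε * y 1, ε * y 2] := by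
  ext i
  fin_cases i <;> simp [cellMap] <;> ring

/-- The index of the cell of size `ε` that contains `x`. -/
noncomputable def cellIndex (L : Fin 2 → ℝ) (ε : ℝ) (x : E 2) : Fin 2 → ℤ :=
  intPart L (ε⁻¹ • x)

open Classical in
theorem unfoldOp_eq {F : Type*} [NormedAddCommGroup F] (φ : E 3 → F) (x : E 2) (y : E 3) :
    unfoldOp L ε φ x y = if x ∈ omegaEps L ε then φ (cellMap L ε (cellIndex L ε x) y) else 0 := by
  simp only [unfoldOp, cellMap_eq, cellIndex]

theorem cellIndex_eq_of_mem (hL : ∀ i, 0 < L i) (hε : 0 < ε) {k : Fin 2 → ℤ} {x : E 2}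
    (hx : x ∈ epsCell L ε k) : cellIndex L ε x = k := by
  ext i
  have := hx i
  have hp : 0 < ε * L i := mul_pos hε (hL i)
  simp only [cellIndex, intPart, PiLp.smul_apply, smul_eq_mul]
  have e : ε⁻¹ * x i / L i = x i / (ε * L i) := by field_simp
  rw [e, Int.floor_eq_iff, le_div_iff₀ hp, div_lt_iff₀ hp]
  exact ⟨by linarith [this.1], by linarith [this.2]⟩

theorem isOpen_epsCell (k : Fin 2 → ℤ) : IsOpen (epsCell L ε k) :=
  isOpen_setOf_forall_mem fun _ => isOpen_Ioo

theorem isOpen_openCells : IsOpen (openCells L ε) := isOpen_iUnion fun _ => isOpen_epsCell _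

theorem closure_epsCell (hL : ∀ i, 0 < L i) (hε : 0 < ε) (k : Fin 2 → ℤ) :
    closure (epsCell L ε k) = {x | ∀ i, x i ∈ Set.Icc (k i * ε * L i) ((k i + 1) * ε * L i)} := by
  have h := (PiLp.homeomorph 2 (fun _ : Fin 2 => ℝ)).preimage_closure
    (Set.univ.pi fun i => Set.Ioo (k i * ε * L i) ((k i + 1) * ε * L i))
  rw [closure_pi_set] at h
  have e : ∀ i, closure (Set.Ioo (k i * ε * L i) ((k i + 1) * ε * L i))
      = Set.Icc (k i * ε * L i) ((k i + 1) * ε * L i) := fun i => closure_Ioo (by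
    have : 0 < ε * L i := mul_pos hε (hL i)
    intro h; nlinarith)
  simp only [e] at h
  have e1 : epsCell L ε k = (PiLp.homeomorph 2 (fun _ : Fin 2 => ℝ)) ⁻¹'
      (Set.univ.pi fun i => Set.Ioo (k i * ε * L i) ((k i + 1) * ε * L i)) := by
    ext x; simp [epsCell, PiLp.homeomorph]
  rw [e1, ← h]
  exact Set.ext fun x => ⟨fun hx i => hx i (Set.mem_univ i), fun hx i _ => hx i⟩

theorem lastCell_add_one_mul_le (hL : ∀ i, 0 < L i) (hε : 0 < ε) (i : Fin 2) :
    ((lastCell (L i) ε : ℝ) + 1) * (ε * L i) ≤ 1 := by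
  have hp : 0 < ε * L i := mul_pos hε (hL i)
  have := Int.floor_le (1 / (ε * L i))
  rw [le_div_iff₀ hp] at this
  simpa [lastCell] using this

theorem one_sub_lt_lastCell (hL : ∀ i, 0 < L i) (hε : 0 < ε) (i : Fin 2) :
    1 - ε * L i < ((lastCell (L i) ε : ℝ) + 1) * (ε * L i) := by
  have hp : 0 < ε * L i := mul_pos hε (hL i)
  have := Int.lt_floor_add_one (1 / (ε * L i))
  rw [div_lt_iff₀ hp] at this
  simp only [lastCell, Int.cast_sub, Int.cast_one, sub_add_cancel]
  linarith

theorem cellIndex_mem (hL : ∀ i, 0 < L i) (hε : 0 < ε) {x : E 2}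
    (hx : ∀ i, x i ∈ Set.Ioo 0 (((lastCell (L i) ε : ℝ) + 1) * (ε * L i))) :
    cellIndex L ε x ∈ cellIndices L ε ∧
    ∀ i, x i ∈ Set.Ico (cellIndex L ε x i * ε * L i) ((cellIndex L ε x i + 1) * ε * L i) := by
  rw [cellIndices, Set.mem_ofPred_eq, ← forall_and]
  intro i
  have hp : 0 < ε * L i := mul_pos hε (hL i)
  have e : ε⁻¹ * x i / L i = x i / (ε * L i) := by field_simp
  simp only [cellIndex, intPart, PiLp.smul_apply, smul_eq_mul, e]
  have h1 := Int.floor_le (x i / (ε * L i))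
  have h2 := Int.lt_floor_add_one (x i / (ε * L i))
  rw [le_div_iff₀ hp] at h1
  rw [div_lt_iff₀ hp] at h2
  refine ⟨⟨Int.floor_nonneg.2 (div_nonneg (hx i).1.le hp.le), ?_⟩, by linarith, by linarith⟩
  rw [← Int.lt_add_one_iff, Int.floor_lt, div_lt_iff₀ hp]
  push_cast
  exact (hx i).2

/-- The closed cells tile a closed rectangle with a corner at the origin, so the interior keeps the
inner grid lines. If ε is too large for any cell to fit, `lastCell` is -1 in some direction and both
sides are empty. -/
theorem omegaEps_eq (hL : ∀ i, 0 < L i) (hε : 0 < ε) :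
    omegaEps L ε = {x | ∀ i, x i ∈ Set.Ioo 0 (((lastCell (L i) ε : ℝ) + 1) * (ε * L i))} := by
  apply Set.Subset.antisymm
  · have hsub : (⋃ k ∈ {k : Fin 2 → ℤ | ∀ i, 0 ≤ k i ∧ k i ≤ lastCell (L i) ε},
        closure (epsCell L ε k)) ⊆ (PiLp.homeomorph 2 (fun _ : Fin 2 => ℝ)) ⁻¹'
          (Set.univ.pi fun i => Set.Icc 0 (((lastCell (L i) ε : ℝ) + 1) * (ε * L i))) := by
      refine Set.iUnion₂_subset fun k hk x hx => ?_
      rw [closure_epsCell hL hε] at hx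
      intro i _
      have hp : 0 < ε * L i := mul_pos hε (hL i)
      have h0 : (0 : ℝ) ≤ k i := by exact_mod_cast (hk i).1
      have h1 : (k i : ℝ) ≤ lastCell (L i) ε := by exact_mod_cast (hk i).2
      have := hx i
      refine ⟨le_trans ?_ this.1, this.2.trans ?_⟩
      · rw [mul_assoc]; positivity
      · rw [mul_assoc]; gcongr
    refine (interior_mono hsub).trans ?_
    rw [← Homeomorph.preimage_interior, interior_pi_set Set.finite_univ]
    intro x hx i
    exact interior_Icc.subset (hx i (Set.mem_univ i))
  · refine interior_maximal (fun x hx => ?_) (isOpen_setOf_forall_mem fun _ => isOpen_Ioo)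
    obtain ⟨h1, h2⟩ := cellIndex_mem hL hε hx
    refine Set.mem_iUnion₂.2 ⟨_, h1, ?_⟩
    rw [closure_epsCell hL hε]
    exact fun i => Set.Ico_subset_Icc_self (h2 i)

theorem epsCell_subset_omegaEps {k : Fin 2 → ℤ}
    (hk : k ∈ cellIndices L ε) : epsCell L ε k ⊆ omegaEps L ε :=
  interior_maximal (subset_closure.trans
    (Set.subset_biUnion_of_mem (u := fun k => closure (epsCell L ε k)) hk)) (isOpen_epsCell k)

theorem openCells_subset_omegaEps : openCells L ε ⊆ omegaEps L ε :=
  Set.iUnion_subset fun k => epsCell_subset_omegaEps k.2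

theorem omegaEps_subset_omega (hL : ∀ i, 0 < L i) (hε : 0 < ε) : omegaEps L ε ⊆ omega := by
  rw [omegaEps_eq hL hε]
  exact fun x hx i => ⟨(hx i).1, (hx i).2.trans_le (lastCell_add_one_mul_le hL hε i)⟩

/-- Only grid lines are lost. This allows ω^ε to be replaced by a disjoint countable union of open
cells, on each of which the cell index is constant. -/
theorem volume_omegaEps_diff_openCells (hL : ∀ i, 0 < L i) (hε : 0 < ε) :
    volume (omegaEps L ε \ openCells L ε) = 0 := by
  refine measure_mono_null (t := ⋃ (i : Fin 2) (m : ℤ), {x : E 2 | x i = m * ε * L i}) ?_ ?_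
  · rintro x ⟨hx, hx'⟩
    rw [omegaEps_eq hL hε] at hx
    obtain ⟨h1, h2⟩ := cellIndex_mem hL hε hx
    by_contra hcon
    refine hx' (Set.mem_iUnion.2 ⟨⟨_, h1⟩, fun i => ⟨(h2 i).1.lt_of_ne' fun h => hcon ?_, (h2 i).2⟩⟩)
    exact Set.mem_iUnion₂.2 ⟨i, _, h⟩
  · exact measure_iUnion_null fun i => measure_iUnion_null fun m => volume_coord_eq i _

/-- The covered rectangle has sides between 1 - εLᵢ and 1. -/
theorem tendsto_volume_omega_diff (hL : ∀ i, 0 < L i) {ε : ℕ → ℝ} (hε : ∀ n, 0 < ε n)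
    (hlim : Tendsto ε atTop (𝓝 0)) :
    Tendsto (fun n => volume (omega \ openCells L (ε n))) atTop (𝓝 0) := by
  set a : ℕ → Fin 2 → ℝ := fun n i => ((lastCell (L i) (ε n) : ℝ) + 1) * (ε n * L i) with ha
  have h1 : ∀ n, volume (omega \ openCells L (ε n)) =
      1 - ∏ i, ENNReal.ofReal (a n i) := by
    intro n
    have e1 : volume (omega \ openCells L (ε n)) = volume (omega \ omegaEps L (ε n)) := by
      refine le_antisymm ?_ (measure_mono
        (Set.sdiff_subset_sdiff_right (openCells_subset_omegaEps)))
      refine (measure_mono (t := (omega \ omegaEps L (ε n)) ∪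
        (omegaEps L (ε n) \ openCells L (ε n))) ?_).trans ((measure_union_le _ _).trans ?_)
      · intro x hx
        by_cases h : x ∈ omegaEps L (ε n)
        · exact Or.inr ⟨h, hx.2⟩
        · exact Or.inl ⟨hx.1, h⟩
      · rw [volume_omegaEps_diff_openCells hL (hε n), add_zero]
    have e2 : volume (omegaEps L (ε n)) = ∏ i, ENNReal.ofReal (a n i) := by
      rw [omegaEps_eq hL (hε n)]
      refine (volume_setOf_forall_mem _).trans ?_
      simp [ha]
    rw [e1, measure_sdiff (omegaEps_subset_omega hL (hε n))
      isOpen_interior.measurableSet.nullMeasurableSet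
      (measure_ne_top_of_subset (omegaEps_subset_omega hL (hε n)) (by simp [volume_omega])),
      volume_omega, e2]
  simp only [h1]
  have h2 : ∀ i, Tendsto (fun n => a n i) atTop (𝓝 1) := by
    intro i
    refine tendsto_of_tendsto_of_tendsto_of_le_of_le
      (g := fun n => 1 - ε n * L i) (h := fun _ => 1) ?_ tendsto_const_nhds
      (fun n => (one_sub_lt_lastCell hL (hε n) i).le)
      (fun n => lastCell_add_one_mul_le hL (hε n) i)
    simpa using (hlim.mul_const (L i)).const_sub 1
  have h3 : Tendsto (fun n => ∏ i, ENNReal.ofReal (a n i)) atTop (𝓝 1) := by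
    have h4 : ∀ i, Tendsto (fun n => ENNReal.ofReal (a n i)) atTop (𝓝 1) := fun i => by
      simpa using ENNReal.tendsto_ofReal (h2 i)
    simp only [Fin.prod_univ_two]
    simpa using ENNReal.Tendsto.mul (h4 0) (by simp) (h4 1) (by simp)
  simpa using ENNReal.Tendsto.sub tendsto_const_nhds h3 (Or.inl ENNReal.one_ne_top)

theorem YPeriodic.add_int_mul (hper : YPeriodic L G) (i : Fin 2) (m : ℤ) (y : E 2) :
    G (y + EuclideanSpace.single i (m * L i)) = G y := by
  have hp : Function.Periodic G (EuclideanSpace.single i (L i)) := hper i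
  have := (hp.zsmul m) y
  rw [← this]
  congr 2
  ext j
  by_cases h : j = i
  · subst h; simp
  · simp [h]

theorem YPeriodic.add_shift (hper : YPeriodic L G) (k : Fin 2 → ℤ) (y : E 2) :
    G (y + !₂[k 0 * L 0, k 1 * L 1]) = G y := by
  have h := hper.add_int_mul 1 (k 1) (y + EuclideanSpace.single 0 (k 0 * L 0))
  rw [hper.add_int_mul 0] at h
  rw [← h]
  congr 1
  ext j
  fin_cases j <;> simp

theorem hat_cellMap (k : Fin 2 → ℤ) (y : E 3) :
    hat (cellMap L ε k y) = ε • (hat y + !₂[k 0 * L 0, k 1 * L 1]) := by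
  ext j
  fin_cases j <;> simp [cellMap]

theorem cellMap_two (k : Fin 2 → ℤ) (y : E 3) : cellMap L ε k y 2 = ε * y 2 := by
  simp [cellMap]

theorem G_hat_cellMap (hper : YPeriodic L G) (hε : 0 < ε) (k : Fin 2 → ℤ) (y : E 3) :
    G (ε⁻¹ • hat (cellMap L ε k y)) = G (hat y) := by
  rw [hat_cellMap, smul_smul, inv_mul_cancel₀ hε.ne', one_smul, hper.add_shift]

theorem hat_cellMap_mem_epsCell (hε : 0 < ε) (k : Fin 2 → ℤ) (y : E 3) :
    hat (cellMap L ε k y) ∈ epsCell L ε k ↔ hat y ∈ cellY L := by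
  rw [hat_cellMap]
  simp only [epsCell, cellY, Set.mem_ofPred_eq, Fin.forall_fin_two]
  have e : ∀ a b l : ℝ, ε * (a + b * l) ∈ Set.Ioo (b * ε * l) ((b + 1) * ε * l) ↔
      a ∈ Set.Ioo 0 l := by
    intro a b l
    rw [Set.mem_Ioo, Set.mem_Ioo]
    constructor
    · rintro ⟨h1, h2⟩
      constructor
      · by_contra hh; nlinarith
      · by_contra hh; nlinarith
    · rintro ⟨h1, h2⟩
      constructor <;> nlinarith
  exact and_congr (e (y 0) (k 0) (L 0)) (e (y 1) (k 1) (L 1))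

/-- Periodicity makes the roof over every cell a scaled copy of the roof of Y*; the index condition
places the cell inside ω. -/
theorem cellMap_mem_iff (hL : ∀ i, 0 < L i) (hper : YPeriodic L G) (hε : 0 < ε)
    {k : Fin 2 → ℤ} (hk : k ∈ cellIndices L ε) (y : E 3) :
    cellMap L ε k y ∈ {x | x ∈ thinDomain G ε ∧ hat x ∈ epsCell L ε k} ↔ y ∈ cellYstar L G := by
  simp only [Set.mem_ofPred_eq, thinDomain, cellYstar, cellMap_two, G_hat_cellMap hper hε,
    hat_cellMap_mem_epsCell hε, mul_pos_iff_of_pos_left hε, mul_lt_mul_iff_right₀ hε]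
  constructor
  · rintro ⟨⟨-, h1⟩, h2⟩
    exact ⟨h2, h1⟩
  · rintro ⟨h2, h1⟩
    refine ⟨⟨?_, h1⟩, h2⟩
    exact omegaEps_subset_omega hL hε (epsCell_subset_omegaEps hk
      ((hat_cellMap_mem_epsCell hε k y).2 h2))

theorem volume_preimage_cellMap (hε : 0 < ε) (k : Fin 2 → ℤ) (B : Set (E 3)) :
    volume (cellMap L ε k ⁻¹' B) = ENNReal.ofReal (ε ^ 3)⁻¹ * volume B := by
  have : cellMap L ε k ⁻¹' B = (fun y => y + !₂[k 0 * L 0, k 1 * L 1, 0]) ⁻¹'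
    ((fun x : E 3 => ε • x) ⁻¹' B) := rfl
  rw [this, measure_preimage_add_right, Measure.addHaar_preimage_smul _ hε.ne']
  simp [abs_of_pos hε]

theorem volume_epsCell (hL : ∀ i, 0 < L i) (hε : 0 < ε) (k : Fin 2 → ℤ) :
    volume (epsCell L ε k) = ENNReal.ofReal (ε ^ 2 * (L 0 * L 1)) := by
  refine (volume_setOf_forall_mem _).trans ?_
  have e : ∀ i, (k i + 1) * ε * L i - k i * ε * L i = ε * L i := fun i => by ring
  simp only [Fin.prod_univ_two, Real.volume_Ioo, e]
  rw [← ENNReal.ofReal_mul (mul_pos hε (hL 0)).le]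
  congr 1; ring

/-- The point of `Ω_ε` at which the unfolding operator evaluates. -/
noncomputable def unfoldPoint (L : Fin 2 → ℝ) (ε : ℝ) (p : E 2 × E 3) : E 3 :=
  cellMap L ε (cellIndex L ε p.1) p.2

theorem measurable_unfoldPoint : Measurable (unfoldPoint L ε) := by
  have h : ∀ i, Measurable fun p : E 2 × E 3 => (cellIndex L ε p.1 i : ℝ) := by
    intro i
    simp only [cellIndex, intPart, PiLp.smul_apply]
    have h1 : Measurable fun p : E 2 × E 3 => ε⁻¹ • p.1 i / L i := by fun_prop
    exact measurable_from_top.comp h1.floor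
  have h0 := h 0
  have h1 := h 1
  have e : unfoldPoint L ε = fun p => !₂[ε * (cellIndex L ε p.1 0 * L 0) + ε * p.2 0,
      ε * (cellIndex L ε p.1 1 * L 1) + ε * p.2 1, ε * p.2 2] := funext fun p => cellMap_eq _ _
  rw [e]
  refine (WithLp.measurable_toLp 2 _).comp (measurable_pi_lambda _ fun i => ?_)
  fin_cases i <;> simp <;> fun_prop

/-- The unfolding multiplies the measure by `|Y| / ε`. -/
theorem measurePreserving_unfoldPoint (hL : ∀ i, 0 < L i) (hGc : Continuous G)
    (hper : YPeriodic L G) (hε : 0 < ε) :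
    MeasurePreserving (unfoldPoint L ε)
      (volume.restrict (openCells L ε ×ˢ cellYstar L G))
      (ENNReal.ofReal (L 0 * L 1 / ε) • volume.restrict (innerDomain L G ε)) := by
  refine ⟨measurable_unfoldPoint, Measure.ext fun B hB => ?_⟩
  rw [Measure.map_apply measurable_unfoldPoint hB,
    Measure.restrict_apply (measurable_unfoldPoint hB), Measure.smul_apply,
    Measure.restrict_apply hB, smul_eq_mul]
  set Ωk : cellIndices L ε → Set (E 3) :=
    fun k => {x | x ∈ thinDomain G ε ∧ hat x ∈ epsCell L ε k} with hΩk
  have hΩo : ∀ k, MeasurableSet (Ωk k) := fun k =>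
    (isOpen_thinDomain hGc ε).measurableSet.inter
      ((isOpen_epsCell k).measurableSet.preimage continuous_hat.measurable)
  have hdisj : Pairwise fun k l : cellIndices L ε =>
      Disjoint (epsCell L ε k) (epsCell L ε l) := by
    intro k l hkl
    refine Set.disjoint_left.2 fun x hk hl => hkl (Subtype.ext ?_)
    rw [← cellIndex_eq_of_mem hL hε hk, cellIndex_eq_of_mem hL hε hl]
  have hcm : ∀ k : cellIndices L ε, Measurable (cellMap L ε k) := fun k => by
    unfold cellMap; fun_prop
  -- Over the k-th cell the unfolding point does not depend on the position of x̂ in the cell, so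
  -- the preimage splits into products. Their measures carry the factor ε²L₁L₂ · ε⁻³ = L₁L₂/ε.
  have e1 : unfoldPoint L ε ⁻¹' B ∩ openCells L ε ×ˢ cellYstar L G
      = ⋃ k : cellIndices L ε, epsCell L ε k ×ˢ (cellMap L ε k ⁻¹' (B ∩ Ωk k)) := by
    ext ⟨x, y⟩
    simp only [Set.mem_inter_iff, Set.mem_preimage, Set.mem_prod, openCells, Set.mem_iUnion]
    constructor
    · rintro ⟨h1, ⟨k, hk⟩, h2⟩
      refine ⟨k, hk, ?_, (cellMap_mem_iff hL hper hε k.2 y).2 h2⟩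
      rw [unfoldPoint, cellIndex_eq_of_mem hL hε hk] at h1
      exact h1
    · rintro ⟨k, hk, h1, h2⟩
      refine ⟨?_, ⟨k, hk⟩, (cellMap_mem_iff hL hper hε k.2 y).1 h2⟩
      rw [unfoldPoint, cellIndex_eq_of_mem hL hε hk]
      exact h1
  have e2 : B ∩ innerDomain L G ε = ⋃ k : cellIndices L ε, B ∩ Ωk k := by
    ext x
    simp only [innerDomain, openCells, hΩk, Set.mem_inter_iff, Set.mem_ofPred_eq, Set.mem_iUnion]
    tauto
  rw [e1, e2, measure_iUnion, measure_iUnion, ← ENNReal.tsum_mul_left]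
  · refine tsum_congr fun k => ?_
    rw [Measure.volume_eq_prod, Measure.prod_prod, volume_epsCell hL hε,
      volume_preimage_cellMap hε, ← mul_assoc, ← ENNReal.ofReal_mul]
    · congr 2; field_simp
    · have := hL 0; have := hL 1; positivity
  · intro k l hkl
    refine Set.disjoint_left.2 fun x hk hl => ?_
    exact Set.disjoint_left.1 (hdisj hkl) hk.2.2 hl.2.2
  · exact fun k => hB.inter (hΩo k)
  · intro k l hkl
    refine Set.disjoint_left.2 fun x hk hl => ?_
    exact Set.disjoint_left.1 (hdisj hkl) hk.1 hl.1
  · exact fun k => (isOpen_epsCell _).measurableSet.prod (hcm k (hB.inter (hΩo k)))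

end Unfolding

/-! ### Integral estimates for the unfolding operator -/

section UnfoldOp

variable {L : Fin 2 → ℝ} {G : E 2 → ℝ} {ε : ℝ} {F : Type*} [NormedAddCommGroup F]

theorem unfoldOp_ae_eq (hL : ∀ i, 0 < L i) (hε : 0 < ε) (φ : E 3 → F) (S : Set (E 2 × E 3)) :
    Function.uncurry (unfoldOp L ε φ) =ᵐ[volume.restrict S]
      (openCells L ε ×ˢ Set.univ).indicator (φ ∘ unfoldPoint L ε) := by
  have h0 : volume ((omegaEps L ε \ openCells L ε) ×ˢ (Set.univ : Set (E 3))) = 0 := by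
    rw [Measure.volume_eq_prod, Measure.prod_prod, volume_omegaEps_diff_openCells hL hε, zero_mul]
  refine ae_restrict_of_ae ?_
  filter_upwards [compl_mem_ae_iff.2 h0] with ⟨x, y⟩ hp
  rw [Function.uncurry_apply_pair, unfoldOp_eq]
  by_cases hx : x ∈ openCells L ε
  · rw [if_pos (openCells_subset_omegaEps hx), Set.indicator_of_mem (by simpa using hx)]
    rfl
  · rw [if_neg, Set.indicator_of_notMem (by simpa using hx)]
    intro hx'
    exact hp ⟨⟨hx', hx⟩, trivial⟩

theorem innerDomain_subset : innerDomain L G ε ⊆ thinDomain G ε := fun _ hx => hx.1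

theorem restrict_prod_restrict_openCells (hL : ∀ i, 0 < L i) (hε : 0 < ε) (Z : Set (E 3)) :
    ((volume : Measure (E 2 × E 3)).restrict (omega ×ˢ Z)).restrict (openCells L ε ×ˢ Set.univ)
      = volume.restrict (openCells L ε ×ˢ Z) := by
  rw [Measure.restrict_restrict (isOpen_openCells.measurableSet.prod MeasurableSet.univ),
    Set.prod_inter_prod, Set.univ_inter, Set.inter_eq_left.2
      (openCells_subset_omegaEps.trans (omegaEps_subset_omega hL hε))]

theorem aestronglyMeasurable_unfoldOp (hL : ∀ i, 0 < L i) (hGc : Continuous G)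
    (hper : YPeriodic L G) (hε : 0 < ε) {φ : E 3 → F}
    (hφ : AEStronglyMeasurable φ (volume.restrict (thinDomain G ε))) :
    AEStronglyMeasurable (Function.uncurry (unfoldOp L ε φ))
      (volume.restrict (omega ×ˢ cellYstar L G)) := by
  refine AEStronglyMeasurable.congr ?_ (unfoldOp_ae_eq hL hε φ _).symm
  rw [aestronglyMeasurable_indicator_iff (isOpen_openCells.measurableSet.prod MeasurableSet.univ),
    restrict_prod_restrict_openCells hL hε]
  refine AEStronglyMeasurable.comp_measurePreserving ?_
    (measurePreserving_unfoldPoint hL hGc hper hε)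
  exact (hφ.mono_measure (Measure.restrict_mono innerDomain_subset le_rfl)).smul_measure _

/-- Equality with the norm over the cells comes from the change of variables; the inequality only
discards the uncovered boundary layer. -/
theorem eLpNorm_unfoldOp_le (hL : ∀ i, 0 < L i) (hGc : Continuous G)
    (hper : YPeriodic L G) (hε : 0 < ε) {φ : E 3 → F}
    (hφ : AEStronglyMeasurable φ (volume.restrict (thinDomain G ε))) :
    eLpNorm (Function.uncurry (unfoldOp L ε φ)) 2 (volume.restrict (omega ×ˢ cellYstar L G)) ≤
      ENNReal.ofReal √(L 0 * L 1 / ε) * eLpNorm φ 2 (volume.restrict (thinDomain G ε)) := by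
  rw [eLpNorm_congr_ae (unfoldOp_ae_eq hL hε φ _), eLpNorm_indicator_eq_eLpNorm_restrict
    (isOpen_openCells.measurableSet.prod MeasurableSet.univ),
    restrict_prod_restrict_openCells hL hε, eLpNorm_comp_measurePreserving
    ((hφ.mono_measure (Measure.restrict_mono innerDomain_subset le_rfl)).smul_measure _)
    (measurePreserving_unfoldPoint hL hGc hper hε),
    eLpNorm_smul_measure_of_ne_top (by norm_num), smul_eq_mul]
  refine mul_le_mul' (le_of_eq ?_)
    (eLpNorm_mono_measure _ (Measure.restrict_mono innerDomain_subset le_rfl))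
  have := hL 0
  have := hL 1
  rw [Real.sqrt_eq_rpow, ENNReal.ofReal_rpow_of_nonneg (by positivity) (by positivity)]
  norm_num

theorem memLp_unfoldOp (hL : ∀ i, 0 < L i) (hGc : Continuous G)
    (hper : YPeriodic L G) (hε : 0 < ε) {φ : E 3 → F}
    (hφ : MemLp φ 2 (volume.restrict (thinDomain G ε))) :
    MemLp (Function.uncurry (unfoldOp L ε φ)) 2 (volume.restrict (omega ×ˢ cellYstar L G)) :=
  ⟨aestronglyMeasurable_unfoldOp hL hGc hper hε hφ.1,
    (eLpNorm_unfoldOp_le hL hGc hper hε hφ.1).trans_lt (by finiteness [hφ.2.ne])⟩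

theorem toReal_eLpNorm_unfoldOp_le (hL : ∀ i, 0 < L i) (hGc : Continuous G)
    (hper : YPeriodic L G) (hε : 0 < ε) {φ : E 3 → F}
    (hφ : MemLp φ 2 (volume.restrict (thinDomain G ε))) :
    (eLpNorm (Function.uncurry (unfoldOp L ε φ)) 2
      (volume.restrict (omega ×ˢ cellYstar L G))).toReal ≤
      √(L 0 * L 1 / ε) * (eLpNorm φ 2 (volume.restrict (thinDomain G ε))).toReal := by
  have := ENNReal.toReal_mono (by finiteness [hφ.2.ne])
    (eLpNorm_unfoldOp_le hL hGc hper hε hφ.1)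
  simpa [ENNReal.toReal_mul] using this

theorem integral_unfoldOp [NormedSpace ℝ F] (hL : ∀ i, 0 < L i) (hGc : Continuous G)
    (hper : YPeriodic L G) (hε : 0 < ε) {φ : E 3 → F}
    (hφ : AEStronglyMeasurable φ (volume.restrict (thinDomain G ε))) :
    ∫ p in omega ×ˢ cellYstar L G, unfoldOp L ε φ p.1 p.2 =
      (L 0 * L 1 / ε) • ∫ x in innerDomain L G ε, φ x := by
  have hφ' := (hφ.mono_measure (Measure.restrict_mono (innerDomain_subset (L := L)) le_rfl)
    ).smul_measure (ENNReal.ofReal (L 0 * L 1 / ε))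
  have hmp := measurePreserving_unfoldPoint hL hGc hper hε
  have h1 := integral_congr_ae (unfoldOp_ae_eq hL hε φ (omega ×ˢ cellYstar L G))
  refine Eq.trans h1 ?_
  rw [integral_indicator (isOpen_openCells.measurableSet.prod MeasurableSet.univ),
    restrict_prod_restrict_openCells hL hε]
  rw [← hmp.map_eq] at hφ'
  have h2 := integral_map hmp.measurable.aemeasurable hφ'
  rw [hmp.map_eq, integral_smul_measure, ENNReal.toReal_ofReal] at h2
  · exact h2.symm
  · have := hL 0
    have := hL 1
    positivity

theorem unfoldOp_sub (φ ψ : E 3 → F) (x : E 2) (y : E 3) :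
    unfoldOp L ε (fun z => φ z - ψ z) x y = unfoldOp L ε φ x y - unfoldOp L ε ψ x y := by
  simp only [unfoldOp]
  split_ifs <;> simp

/-- The assumption `P 0` accounts for the region where the unfolding is set to zero. -/
theorem unfoldOp_congr_ae (hL : ∀ i, 0 < L i) (hGc : Continuous G)
    (hper : YPeriodic L G) (hε : 0 < ε) {P : F → Prop} (hP : P 0) {φ : E 3 → F}
    (hφ : ∀ᵐ x ∂(volume.restrict (thinDomain G ε)), P (φ x)) :
    ∀ᵐ p ∂((volume : Measure (E 2 × E 3)).restrict (omega ×ˢ cellYstar L G)),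
      P (unfoldOp L ε φ p.1 p.2) := by
  have hmp := measurePreserving_unfoldPoint hL hGc hper hε
  have h1 : ∀ᵐ x ∂(ENNReal.ofReal (L 0 * L 1 / ε) • volume.restrict (innerDomain L G ε)),
      P (φ x) :=
    Measure.ae_smul_measure (ae_mono (Measure.restrict_mono innerDomain_subset le_rfl) hφ) _
  have h2 := hmp.quasiMeasurePreserving.ae h1
  rw [← restrict_prod_restrict_openCells hL hε, ae_restrict_iff'
    (isOpen_openCells.measurableSet.prod MeasurableSet.univ)] at h2
  filter_upwards [h2, unfoldOp_ae_eq hL hε φ (omega ×ˢ cellYstar L G)] with p hp he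
  change P (Function.uncurry (unfoldOp L ε φ) p)
  rw [he]
  by_cases hx : p ∈ openCells L ε ×ˢ (Set.univ : Set (E 3))
  · rw [Set.indicator_of_mem hx]
    exact hp hx
  · rwa [Set.indicator_of_notMem hx]

end UnfoldOp

/-! ### Unfolding of smooth functions -/

section UnfoldTest

variable {L : Fin 2 → ℝ} {G : E 2 → ℝ} {ε : ℝ} {F : Type*} [NormedAddCommGroup F]
  [InnerProductSpace ℝ F]

theorem contDiff_cellMap (k : Fin 2 → ℤ) : ContDiff ℝ ∞ (cellMap L ε k) := by
  unfold cellMap; fun_prop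

theorem contDiff_unfoldOp {φ : E 3 → F} (hφ : ContDiff ℝ ∞ φ) (x : E 2) :
    ContDiff ℝ ∞ (unfoldOp L ε φ x) := by
  by_cases hx : x ∈ omegaEps L ε
  · have : unfoldOp L ε φ x = φ ∘ cellMap L ε (cellIndex L ε x) := by
      ext y; rw [unfoldOp_eq, if_pos hx]; rfl
    rw [this]
    exact hφ.comp (contDiff_cellMap _)
  · have : unfoldOp L ε φ x = fun _ => 0 := by
      ext y; rw [unfoldOp_eq, if_neg hx]
    rw [this]
    exact contDiff_const

theorem pderiv_unfoldOp {φ : E 3 → F} (hφ : ContDiff ℝ ∞ φ) (x : E 2) (i : Fin 3) (y : E 3) :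
    pderiv i (unfoldOp L ε φ x) y = ε • unfoldOp L ε (pderiv i φ) x y := by
  by_cases hx : x ∈ omegaEps L ε
  · have : unfoldOp L ε φ x = fun y => φ (cellMap L ε (cellIndex L ε x) y) := by
      ext y; rw [unfoldOp_eq, if_pos hx]
    rw [this, unfoldOp_eq, if_pos hx]
    have h1 : HasFDerivAt (cellMap L ε (cellIndex L ε x))
        (ε • ContinuousLinearMap.id ℝ (E 3)) y :=
      ((hasFDerivAt_id y).add_const _).const_smul ε
    have h2 := (hφ.differentiable (by simp)).differentiableAt
      (x := cellMap L ε (cellIndex L ε x) y) |>.hasFDerivAt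
    have h3 : HasFDerivAt (fun y => φ (cellMap L ε (cellIndex L ε x) y)) _ y := h2.comp y h1
    simp only [pderiv]
    rw [h3.fderiv]
    simp
  · have : unfoldOp L ε φ x = fun _ => 0 := by
      ext y; rw [unfoldOp_eq, if_neg hx]
    rw [this, unfoldOp_eq, if_neg hx]
    simp [pderiv]

/-- The cell map sends the bottom and top of Y* outside the open set Ω_ε, where the test function
vanishes. The lateral faces may land inside Ω_ε, so no condition is claimed there. -/
theorem IsTest.unfoldOp_eq_zero (hper : YPeriodic L G) (hε : 0 < ε)
    {φ : E 3 → F} (hφ : IsTest (thinDomain G ε) φ) (x : E 2) {y : E 3}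
    (hy : y ∈ bottomYstar L ∪ topYstar L G) : unfoldOp L ε φ x y = 0 := by
  rw [unfoldOp_eq]
  split_ifs
  · refine hφ.eq_zero ?_
    rintro ⟨-, h1, h2⟩
    rw [G_hat_cellMap hper hε] at h2
    rw [cellMap_two] at h1 h2
    rcases hy with hy | hy
    · rw [hy.2] at h1; simp at h1
    · rw [hy.2] at h2; exact lt_irrefl _ h2
  · rfl

end UnfoldTest

/-! ### Weak sequential compactness in Hilbert spaces -/

section Hilbert

variable {H : Type*} [NormedAddCommGroup H] [InnerProductSpace ℝ H] [CompleteSpace H]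

/-- Sequential Banach–Alaoglu in the dual of a separable space, transported by the Riesz
isomorphism. -/
theorem exists_subseq_tendsto_inner [TopologicalSpace.SeparableSpace H] {x : ℕ → H} {M : ℝ}
    (hx : ∀ n, ‖x n‖ ≤ M) :
    ∃ (a : H) (σ : ℕ → ℕ), StrictMono σ ∧
      ∀ w, Tendsto (fun n => inner ℝ (x (σ n)) w) atTop (𝓝 (inner ℝ a w)) := by
  have h := WeakDual.isSeqCompact_closedBall ℝ H 0 M
  obtain ⟨a, -, σ, hσ, hlim⟩ := h (x := fun n => StrongDual.toWeakDual
    (InnerProductSpace.toDual ℝ H (x n))) (fun n => by simpa using hx n)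
  refine ⟨(InnerProductSpace.toDual ℝ H).symm (WeakDual.toStrongDual a), σ, hσ, fun w => ?_⟩
  have h1 := ((WeakDual.eval_continuous w).tendsto a).comp hlim
  have h2 : inner ℝ ((InnerProductSpace.toDual ℝ H).symm (WeakDual.toStrongDual a)) w = a w := by
    simp
  rw [h2]
  exact h1

/-- The closure of K is its double orthogonal complement, and orthogonality to a fixed vector
survives weak limits. -/
theorem mem_topologicalClosure_of_tendsto_inner (K : Submodule ℝ H) {x : ℕ → H} {a : H}
    (hx : ∀ n, x n ∈ K.topologicalClosure)
    (h : ∀ w, Tendsto (fun n => inner ℝ (x n) w) atTop (𝓝 (inner ℝ a w))) :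
    a ∈ K.topologicalClosure := by
  rw [← Submodule.orthogonal_orthogonal_eq_closure] at hx ⊢
  rw [Submodule.mem_orthogonal']
  intro w hw
  refine tendsto_nhds_unique (h w) (tendsto_const_nhds.congr fun n => ?_)
  exact ((Submodule.mem_orthogonal' _ _).1 (hx n) w hw).symm

end Hilbert

/-! ### Slices of `L²` convergent sequences -/

section Slices

variable {X Y F : Type*} [MeasurableSpace X] [MeasurableSpace Y] [NormedAddCommGroup F]
  {ρ : Measure X} {τ : Measure Y} [SFinite τ]

theorem eLpNorm_two_sq {X F : Type*} [MeasurableSpace X] [NormedAddCommGroup F]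
    (ρ : Measure X) (f : X → F) : eLpNorm f 2 ρ ^ 2 = ∫⁻ x, ‖f x‖ₑ ^ 2 ∂ρ := by
  simpa using eLpNorm_nnreal_pow_eq_lintegral (μ := ρ) (f := f) (p := 2) (by norm_num)

theorem lintegral_eLpNorm_slice_sq {h : X × Y → F} (hh : AEStronglyMeasurable h (ρ.prod τ)) :
    ∫⁻ x, eLpNorm (fun y => h (x, y)) 2 τ ^ 2 ∂ρ = eLpNorm h 2 (ρ.prod τ) ^ 2 := by
  rw [eLpNorm_two_sq, lintegral_prod _ (hh.enorm.pow_const 2)]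
  exact lintegral_congr fun x => eLpNorm_two_sq _ _

theorem aemeasurable_eLpNorm_slice_sq {h : X × Y → F} (hh : AEStronglyMeasurable h (ρ.prod τ)) :
    AEMeasurable (fun x => eLpNorm (fun y => h (x, y)) 2 τ ^ 2) ρ := by
  simp only [eLpNorm_two_sq]
  exact (hh.enorm.pow_const 2).lintegral_prod_right'

theorem ae_memLp_slice {h : X × Y → F} (hh : MemLp h 2 (ρ.prod τ)) :
    ∀ᵐ x ∂ρ, MemLp (fun y => h (x, y)) 2 τ := by
  have h1 := ae_lt_top' (aemeasurable_eLpNorm_slice_sq hh.1)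
    (by rw [lintegral_eLpNorm_slice_sq hh.1]; finiteness [hh.2.ne])
  filter_upwards [h1, hh.1.prodMk_left] with x hx hx'
  refine ⟨hx', ?_⟩
  by_contra hcon
  rw [not_lt, top_le_iff] at hcon
  simp [hcon] at hx

/-- Choose a subsequence whose squared norms are at most 2⁻ⁿ. By Tonelli the sum of the squared
slice norms is integrable, hence finite almost everywhere, and its terms tend to zero. -/
theorem exists_subseq_ae_tendsto_slice {h : ℕ → X × Y → F}
    (hh : ∀ n, AEStronglyMeasurable (h n) (ρ.prod τ))
    (hlim : Tendsto (fun n => eLpNorm (h n) 2 (ρ.prod τ)) atTop (𝓝 0)) :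
    ∃ σ : ℕ → ℕ, StrictMono σ ∧
      ∀ᵐ x ∂ρ, Tendsto (fun n => eLpNorm (fun y => h (σ n) (x, y)) 2 τ) atTop (𝓝 0) := by
  have hlim2 : Tendsto (fun n => eLpNorm (h n) 2 (ρ.prod τ) ^ 2) atTop (𝓝 0) := by
    simpa using ENNReal.Tendsto.pow (n := 2) hlim
  obtain ⟨σ, hσ, hb⟩ := extraction_forall_of_eventually'
    (P := fun n k => eLpNorm (h k) 2 (ρ.prod τ) ^ 2 ≤ (2⁻¹ : ℝ≥0∞) ^ n) (fun n => by
      have : (0 : ℝ≥0∞) < 2⁻¹ ^ n := ENNReal.pow_pos (by simp) n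
      exact eventually_atTop.1 (hlim2.eventually (ge_mem_nhds this)))
  refine ⟨σ, hσ, ?_⟩
  have hs : ∫⁻ x, ∑' n, eLpNorm (fun y => h (σ n) (x, y)) 2 τ ^ 2 ∂ρ ≠ ⊤ := by
    rw [lintegral_tsum fun n => aemeasurable_eLpNorm_slice_sq (hh _)]
    simp only [lintegral_eLpNorm_slice_sq (hh _)]
    refine ((ENNReal.tsum_le_tsum hb).trans_lt ?_).ne
    rw [ENNReal.tsum_geometric]
    simp
  have hae := ae_lt_top' (AEMeasurable.tsum fun n =>
    aemeasurable_eLpNorm_slice_sq (hh (σ n))) hs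
  filter_upwards [hae] with x hx
  have h0 := ENNReal.tendsto_atTop_zero_of_tsum_ne_top hx.ne
  have h1 := (ENNReal.continuous_rpow_const (y := (1 / 2 : ℝ))).tendsto 0 |>.comp h0
  rw [ENNReal.zero_rpow_of_pos (by norm_num)] at h1
  refine h1.congr fun n => ?_
  simp only [Function.comp_apply]
  rw [← ENNReal.rpow_natCast, ← ENNReal.rpow_mul]
  norm_num

end Slices

/-! ### Jets of functions of two variables -/

/-- The space of first order jets of maps from `ℝ³` to `ℝ³`. -/
abbrev JetSpace : Type := PiLp 2 (fun _ : Fin 4 => E 3)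

/-- The first order jet `(u, ∂₁u, ∂₂u, ∂₃u)`. -/
noncomputable def jet {α : Type*} (u : α → E 3) (Du : Fin 3 → α → E 3) (p : α) : JetSpace :=
  WithLp.toLp 2 (Fin.cons (u p) fun i => Du i p)

section Jet

variable {α : Type*} {m : MeasurableSpace α} {ν : Measure α}

@[simp] theorem jet_zero (u : α → E 3) (Du : Fin 3 → α → E 3) (p : α) : jet u Du p 0 = u p := rfl

@[simp] theorem jet_succ (u : α → E 3) (Du : Fin 3 → α → E 3) (p : α) (i : Fin 3) :
    jet u Du p i.succ = Du i p := rfl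

theorem memLp_jet_iff {u : α → E 3} {Du : Fin 3 → α → E 3} :
    MemLp (jet u Du) 2 ν ↔ MemLp u 2 ν ∧ ∀ i, MemLp (Du i) 2 ν := by
  rw [memLp_piLp_iff]
  constructor
  · exact fun h => ⟨h 0, fun i => h i.succ⟩
  · rintro ⟨h0, h1⟩ i
    refine Fin.cases ?_ (fun i => ?_) i
    · exact h0
    · exact h1 i

theorem norm_jetSpace_le (v : JetSpace) : ‖v‖ ≤ ∑ j, ‖v j‖ := by
  have : v = ∑ j, PiLp.single 2 j (v j) := by
    ext j : 1
    rw [WithLp.ofLp_sum, Finset.sum_apply, Finset.sum_eq_single j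
      (fun k _ hk => PiLp.single_eq_of_ne' 2 hk _) (by simp), PiLp.single_eq_same]
  conv_lhs => rw [this]
  refine (norm_sum_le _ _).trans (le_of_eq ?_)
  simp

theorem eLpNorm_jetSpace_le {f : α → JetSpace} (hf : AEStronglyMeasurable f ν) :
    eLpNorm f 2 ν ≤ ∑ j, eLpNorm (fun p => f p j) 2 ν := by
  have hj : ∀ j, AEStronglyMeasurable (fun p => f p j) ν := fun j =>
    (PiLp.continuous_apply 2 _ j).comp_aestronglyMeasurable hf
  calc eLpNorm f 2 ν ≤ eLpNorm (∑ j, fun p => ‖f p j‖) 2 ν := by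
        refine eLpNorm_mono_real fun p => ?_
        rw [Finset.sum_apply]
        exact norm_jetSpace_le _
    _ ≤ ∑ j, eLpNorm (fun p => ‖f p j‖) 2 ν := eLpNorm_sum_le (fun j _ => (hj j).norm) (by norm_num)
    _ = _ := by simp only [eLpNorm_norm]

end Jet

/-- Almost every slice of `f` is the jet of a smooth function that vanishes on `Γ`. -/
def IsSliceJet (A : Set (E 2)) (Z Γ : Set (E 3)) (f : E 2 × E 3 → JetSpace) : Prop :=
  ∀ᵐ x ∂(volume.restrict A), ∃ φ : E 3 → E 3, ContDiff ℝ ∞ φ ∧ (∀ y ∈ Γ, φ y = 0) ∧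
    ∀ᵐ y ∂(volume.restrict Z), f (x, y) = jet φ (fun i => pderiv i φ) y

/-! ### Zero traces of slices of strong limits -/

section SliceJet

variable {A : Set (E 2)} {Z Γ : Set (E 3)}

theorem restrict_prod_eq (A : Set (E 2)) (Z : Set (E 3)) :
    (volume : Measure (E 2 × E 3)).restrict (A ×ˢ Z) =
      (volume.restrict A).prod (volume.restrict Z) := by
  rw [Measure.prod_restrict, Measure.volume_eq_prod]

theorem ae_ae_of_ae_restrict_prod {P : E 2 × E 3 → Prop}
    (h : ∀ᵐ p ∂((volume : Measure (E 2 × E 3)).restrict (A ×ˢ Z)), P p) :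
    ∀ᵐ x ∂(volume.restrict A), ∀ᵐ y ∂(volume.restrict Z), P (x, y) := by
  rw [restrict_prod_eq] at h
  exact Measure.ae_ae_of_ae_prod h

/-- Along a subsequence almost every slice converges in H¹, and the slices are smooth functions
vanishing on Γ: exactly the approximants that `HasTrace` asks for. The boundary norms are
identically zero, so no trace inequality enters. -/
theorem ae_hasTrace_of_tendsto (hΓ : MeasurableSet Γ) {f : E 2 × E 3 → JetSpace}
    (hf : MemLp f 2 (volume.restrict (A ×ˢ Z))) {s : ℕ → E 2 × E 3 → JetSpace}
    (hs : ∀ n, IsSliceJet A Z Γ (s n))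
    (hsm : ∀ n, AEStronglyMeasurable (s n) (volume.restrict (A ×ˢ Z)))
    (hlim : Tendsto (fun n => eLpNorm (s n - f) 2 (volume.restrict (A ×ˢ Z))) atTop (𝓝 0)) :
    ∀ᵐ x ∂(volume.restrict A),
      HasTrace Z Γ (fun y => f (x, y) 0) (fun i y => f (x, y) i.succ) (fun _ => 0) := by
  rw [restrict_prod_eq] at hf hlim hsm
  obtain ⟨σ, -, hσ⟩ := exists_subseq_ae_tendsto_slice (fun n => (hsm n).sub hf.1) hlim
  filter_upwards [hσ, ae_memLp_slice hf, ae_all_iff.2 hs] with x hx hxm hxs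
  choose φ hφ hφ0 hφeq using fun n => hxs (σ n)
  rw [memLp_piLp_iff] at hxm
  have hle : ∀ n (j : Fin 4), eLpNorm (fun y => jet (φ n) (fun i => pderiv i (φ n)) y j -
      f (x, y) j) 2 (volume.restrict Z) ≤
      eLpNorm (fun y => (s (σ n) - f) (x, y)) 2 (volume.restrict Z) := by
    intro n j
    refine eLpNorm_mono_ae ?_
    filter_upwards [hφeq n] with y hy
    rw [Pi.sub_apply, hy]
    exact PiLp.norm_apply_le (jet (φ n) (fun i => pderiv i (φ n)) y - f (x, y)) j
  have ht : ∀ j : Fin 4, Tendsto (fun n => eLpNorm (fun y =>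
      jet (φ n) (fun i => pderiv i (φ n)) y j - f (x, y) j) 2 (volume.restrict Z)) atTop (𝓝 0) :=
    fun j => tendsto_of_tendsto_of_tendsto_of_le_of_le tendsto_const_nhds hx
      (fun _ => zero_le) (fun n => hle n j)
  have hH : TendstoH1 Z φ (fun y => f (x, y) 0) (fun i y => f (x, y) i.succ) :=
    ⟨ht 0, fun i => ht i.succ⟩
  refine ⟨isH1_of_tendstoH1 hφ (hxm 0) (fun i => hxm i.succ) hH, φ, hφ, hH, ?_⟩
  refine tendsto_const_nhds.congr fun n => ?_
  rw [eLpNorm_congr_ae (g := fun _ => (0 : E 3)), eLpNorm_zero']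
  filter_upwards [ae_restrict_mem hΓ] with y hy
  simp [hφ0 n y hy]

theorem pderiv_add {φ ψ : E 3 → E 3} (hφ : ContDiff ℝ ∞ φ) (hψ : ContDiff ℝ ∞ ψ) (i : Fin 3)
    (y : E 3) : pderiv i (φ + ψ) y = pderiv i φ y + pderiv i ψ y := by
  simp only [pderiv]
  rw [fderiv_add ((hφ.differentiable (by simp)).differentiableAt)
    ((hψ.differentiable (by simp)).differentiableAt)]
  rfl

theorem pderiv_const_smul {φ : E 3 → E 3} (hφ : ContDiff ℝ ∞ φ) (c : ℝ) (i : Fin 3)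
    (y : E 3) : pderiv i (c • φ) y = c • pderiv i φ y := by
  simp only [pderiv]
  rw [fderiv_const_smul ((hφ.differentiable (by simp)).differentiableAt)]
  rfl

/-- The `L²` classes whose slices are jets of smooth functions vanishing on `Γ`. -/
def sliceJets (A : Set (E 2)) (Z Γ : Set (E 3)) :
    Submodule ℝ (Lp JetSpace 2 ((volume : Measure (E 2 × E 3)).restrict (A ×ˢ Z))) where
  carrier := {f | IsSliceJet A Z Γ f}
  zero_mem' := by
    have h := Lp.coeFn_zero JetSpace 2 ((volume : Measure (E 2 × E 3)).restrict (A ×ˢ Z))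
    filter_upwards [ae_ae_of_ae_restrict_prod h] with x hx
    refine ⟨0, contDiff_const, fun _ _ => rfl, ?_⟩
    filter_upwards [hx] with y hy
    rw [hy]
    ext j : 1
    refine Fin.cases rfl (fun i => ?_) j
    simp [pderiv]
  add_mem' := by
    intro f g (hf : IsSliceJet A Z Γ f) (hg : IsSliceJet A Z Γ g)
    change IsSliceJet A Z Γ _
    have h := Lp.coeFn_add f g
    filter_upwards [ae_ae_of_ae_restrict_prod h, hf, hg] with x hx ⟨φ, h1, h2, h3⟩ ⟨ψ, k1, k2, k3⟩
    refine ⟨φ + ψ, h1.add k1, fun y hy => by simp [h2 y hy, k2 y hy], ?_⟩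
    filter_upwards [hx, h3, k3] with y hy hy3 hk3
    rw [hy, Pi.add_apply, hy3, hk3]
    ext j : 1
    refine Fin.cases rfl (fun i => ?_) j
    simp [pderiv_add h1 k1]
  smul_mem' := by
    intro c f (hf : IsSliceJet A Z Γ f)
    change IsSliceJet A Z Γ _
    have h := Lp.coeFn_smul c f
    filter_upwards [ae_ae_of_ae_restrict_prod h, hf] with x hx ⟨φ, h1, h2, h3⟩
    refine ⟨c • φ, h1.const_smul c, fun y hy => by simp [h2 y hy], ?_⟩
    filter_upwards [hx, h3] with y hy hy3
    rw [hy, Pi.smul_apply, hy3]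
    ext j : 1
    refine Fin.cases rfl (fun i => ?_) j
    simp [pderiv_const_smul h1]

end SliceJet

/-! ### Weak compactness in L²(A; H¹) with a zero trace -/

section WeakLimit

variable {A : Set (E 2)} {Z Γ : Set (E 3)}

/-- The map `u ∈ L²(A; H¹(Z)³)` is a limit of functions `s m` that are smooth in the second
variable and vanish on `Γ`. -/
def IsSmoothLimit (A : Set (E 2)) (Z Γ : Set (E 3)) (u : E 2 → E 3 → E 3)
    (Du : Fin 3 → E 2 → E 3 → E 3) : Prop :=
  IsL2Prod A Z u ∧ (∀ i, IsL2Prod A Z (Du i)) ∧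
  ∃ s : ℕ → E 2 → E 3 → E 3, (∀ m x, ContDiff ℝ ∞ (s m x)) ∧ (∀ m x, ∀ y ∈ Γ, s m x y = 0) ∧
    (∀ m, IsL2Prod A Z (s m)) ∧ (∀ m i, IsL2Prod A Z (fun x => pderiv i (s m x))) ∧
    Tendsto (fun m => eLpNorm (fun p : E 2 × E 3 => s m p.1 p.2 - u p.1 p.2) 2
      (volume.restrict (A ×ˢ Z))) atTop (𝓝 0) ∧
    ∀ i, Tendsto (fun m => eLpNorm (fun p : E 2 × E 3 => pderiv i (s m p.1) p.2 - Du i p.1 p.2) 2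
      (volume.restrict (A ×ˢ Z))) atTop (𝓝 0)

theorem IsSmoothLimit.exists_sliceJet {u : E 2 → E 3 → E 3} {Du : Fin 3 → E 2 → E 3 → E 3}
    (h : IsSmoothLimit A Z Γ u Du) :
    MemLp (jet (Function.uncurry u) fun i => Function.uncurry (Du i)) 2
      (volume.restrict (A ×ˢ Z)) ∧
    ∃ s : ℕ → E 2 × E 3 → JetSpace, (∀ m, IsSliceJet A Z Γ (s m)) ∧
      (∀ m, MemLp (s m) 2 (volume.restrict (A ×ˢ Z))) ∧
      Tendsto (fun m => eLpNorm
        (s m - jet (Function.uncurry u) fun i => Function.uncurry (Du i)) 2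
        (volume.restrict (A ×ˢ Z))) atTop (𝓝 0) := by
  obtain ⟨h0, h1, s, hs, hs0, hsm, hsd, ht, htd⟩ := h
  have hm := memLp_jet_iff.2 ⟨h0, h1⟩
  set s' : ℕ → E 2 × E 3 → JetSpace := fun m => jet (Function.uncurry (s m))
    (fun i => Function.uncurry fun x => pderiv i (s m x)) with hs'
  have hsm' : ∀ m, MemLp (s' m) 2 (volume.restrict (A ×ˢ Z)) := fun m =>
    memLp_jet_iff.2 ⟨hsm m, hsd m⟩
  refine ⟨hm, s', fun m => ?_, hsm', ?_⟩
  · exact Eventually.of_forall fun x => ⟨s m x, hs m x, hs0 m x, Eventually.of_forall fun y => rfl⟩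
  · have hsum : Tendsto (fun m => ∑ j : Fin 4, eLpNorm (fun p =>
        (s' m - jet (Function.uncurry u) fun i => Function.uncurry (Du i)) p j) 2
        (volume.restrict (A ×ˢ Z))) atTop (𝓝 (∑ j : Fin 4, 0)) := by
      refine tendsto_finsetSum _ fun j _ => ?_
      refine Fin.cases ?_ (fun i => ?_) j
      · exact ht
      · exact htd i
    rw [Finset.sum_const_zero] at hsum
    exact tendsto_of_tendsto_of_tendsto_of_le_of_le tendsto_const_nhds hsum
      (fun _ => zero_le) (fun m => eLpNorm_jetSpace_le ((hsm' m).sub hm).1)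

theorem IsSmoothLimit.ae_hasTrace (hΓ : MeasurableSet Γ) {u : E 2 → E 3 → E 3}
    {Du : Fin 3 → E 2 → E 3 → E 3} (h : IsSmoothLimit A Z Γ u Du) :
    ∀ᵐ x ∂(volume.restrict A), HasTrace Z Γ (u x) (fun i => Du i x) (fun _ => 0) := by
  obtain ⟨hm, s, hs, hsm, hlim⟩ := h.exists_sliceJet
  exact ae_hasTrace_of_tendsto hΓ hm hs (fun n => (hsm n).1) hlim

theorem IsSmoothLimit.isL2H1 (hΓ : MeasurableSet Γ) {u : E 2 → E 3 → E 3}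
    {Du : Fin 3 → E 2 → E 3 → E 3} (h : IsSmoothLimit A Z Γ u Du) : IsL2H1 A Z u Du :=
  ⟨h.1, h.2.1, (h.ae_hasTrace hΓ).mono fun _ hx => hx.1⟩

theorem inner_single_right (v : JetSpace) (j : Fin 4) (w : E 3) :
    inner ℝ v (PiLp.single 2 j w : JetSpace) = inner ℝ (v j) w := by
  rw [PiLp.inner_apply, Finset.sum_eq_single j
    (fun k _ hk => by rw [PiLp.single_eq_of_ne 2 hk, inner_zero_right]) (by simp),
    PiLp.single_eq_same]

theorem memLp_single {w : E 2 → E 3 → E 3} (hw : IsL2Prod A Z w) (j : Fin 4) :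
    MemLp (fun p : E 2 × E 3 => (PiLp.single 2 j (w p.1 p.2) : JetSpace)) 2
      (volume.restrict (A ×ˢ Z)) := by
  rw [memLp_piLp_iff]
  intro k
  by_cases hk : k = j
  · subst hk
    simp only [PiLp.single_eq_same]
    exact hw
  · simp [hk]

/-- A weak limit alone says nothing about traces of slices. Being in the closure of the subspace
`sliceJets` is preserved by weak limits, however, and it provides a strongly convergent sequence to
which the slice argument applies. -/
theorem exists_weak_limit (hΓ : MeasurableSet Γ) {U : ℕ → E 2 → E 3 → E 3}
    {DU : ℕ → Fin 3 → E 2 → E 3 → E 3} (hU : ∀ n, IsSmoothLimit A Z Γ (U n) (DU n)) {M : ℝ}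
    (hM : ∀ n, (eLpNorm (Function.uncurry (U n)) 2 (volume.restrict (A ×ˢ Z))).toReal ≤ M)
    (hDM : ∀ n i,
      (eLpNorm (Function.uncurry (DU n i)) 2 (volume.restrict (A ×ˢ Z))).toReal ≤ M) :
    ∃ σ : ℕ → ℕ, StrictMono σ ∧ ∃ (u : E 2 → E 3 → E 3) (Du : Fin 3 → E 2 → E 3 → E 3),
      IsL2H1 A Z u Du ∧
      (∀ᵐ x ∂(volume.restrict A), HasTrace Z Γ (u x) (fun i => Du i x) (fun _ => 0)) ∧
      WeakTendstoL2 A Z (fun n => U (σ n)) u ∧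
      ∀ i, WeakTendstoL2 A Z (fun n => DU (σ n) i) (Du i) := by
  have : Fact ((2 : ℝ≥0∞) ≠ ⊤) := ⟨by simp⟩
  have : MeasureTheory.IsSeparable ((volume : Measure (E 2 × E 3)).restrict (A ×ˢ Z)) :=
    isSeparable_of_sigmaFinite _
  choose hm s hs hsm hlim using fun n => (hU n).exists_sliceJet
  set J : ℕ → E 2 × E 3 → JetSpace :=
    fun n => jet (Function.uncurry (U n)) fun i => Function.uncurry (DU n i) with hJ
  -- One M for the function and one for each of the three derivatives.
  have hb : ∀ n, ‖(hm n).toLp‖ ≤ 4 * M := by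
    intro n
    rw [Lp.norm_toLp]
    have h1 := ENNReal.toReal_mono (ENNReal.sum_ne_top.2 fun j _ =>
      ((memLp_piLp_iff.1 (hm n)) j).2.ne) (eLpNorm_jetSpace_le (hm n).1)
    rw [ENNReal.toReal_sum fun j _ => ((memLp_piLp_iff.1 (hm n)) j).2.ne, Fin.sum_univ_succ] at h1
    refine h1.trans ?_
    have h2 := hM n
    have h3 : ∑ i : Fin 3, (eLpNorm (fun p => J n p i.succ) 2
        (volume.restrict (A ×ˢ Z))).toReal ≤ ∑ i : Fin 3, M :=
      Finset.sum_le_sum fun i _ => hDM n i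
    have h4 : (eLpNorm (fun p => J n p 0) 2 (volume.restrict (A ×ˢ Z))).toReal ≤ M := h2
    simp only [Finset.sum_const, Finset.card_univ, Fintype.card_fin, nsmul_eq_mul] at h3
    push_cast at h3
    linarith
  obtain ⟨a, σ, hσ, hw⟩ := exists_subseq_tendsto_inner hb
  have hcl : ∀ n, (hm n).toLp ∈ (sliceJets A Z Γ).topologicalClosure := by
    intro n
    refine mem_closure_of_tendsto (f := fun m => (hsm n m).toLp) (b := atTop) ?_
      (Eventually.of_forall fun m => ?_)
    · rw [Lp.tendsto_Lp_iff_tendsto_eLpNorm']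
      refine (hlim n).congr fun m => eLpNorm_congr_ae ?_
      exact ((hsm n m).coeFn_toLp.sub (hm n).coeFn_toLp).symm
    · change IsSliceJet A Z Γ _
      filter_upwards [ae_ae_of_ae_restrict_prod (hsm n m).coeFn_toLp, hs n m] with x hx hx'
      obtain ⟨φ, h1, h2, h3⟩ := hx'
      refine ⟨φ, h1, h2, ?_⟩
      filter_upwards [hx, h3] with y hy hy'
      rw [hy, hy']
  have ha := mem_topologicalClosure_of_tendsto_inner _ (fun n => hcl (σ n)) hw
  obtain ⟨t, ht, htl⟩ := mem_closure_iff_seq_limit.1 ha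
  rw [Lp.tendsto_Lp_iff_tendsto_eLpNorm'] at htl
  have htr := ae_hasTrace_of_tendsto hΓ (Lp.memLp a) ht (fun n => Lp.aestronglyMeasurable _) htl
  have ham := memLp_piLp_iff.1 (Lp.memLp a)
  -- Testing with jets supported in the single slot j separates the weak convergence of the function
  -- from that of each derivative.
  have key : ∀ (j : Fin 4) (w : E 2 → E 3 → E 3), IsL2Prod A Z w →
      Tendsto (fun n => ∫ p in A ×ˢ Z, inner ℝ (J (σ n) p j) (w p.1 p.2)) atTop
        (𝓝 (∫ p in A ×ˢ Z, inner ℝ (a p j) (w p.1 p.2))) := by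
    intro j w hwL
    have h1 := hw (memLp_single hwL j).toLp
    simp only [L2.inner_def] at h1
    have e1 : ∫ p in A ×ˢ Z, inner ℝ (a p) ((memLp_single hwL j).toLp _ p)
        = ∫ p in A ×ˢ Z, inner ℝ (a p j) (w p.1 p.2) := by
      refine integral_congr_ae ?_
      filter_upwards [(memLp_single hwL j).coeFn_toLp] with p hp
      rw [hp, inner_single_right]
    rw [e1] at h1
    refine h1.congr fun n => integral_congr_ae ?_
    filter_upwards [(memLp_single hwL j).coeFn_toLp, (hm (σ n)).coeFn_toLp] with p hp hp'
    rw [hp, hp', inner_single_right]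
  refine ⟨σ, hσ, fun x y => a (x, y) 0, fun i x y => a (x, y) i.succ,
    ⟨ham 0, fun i => ham i.succ, htr.mono fun _ hx => hx.1⟩, htr,
    ⟨fun n => (hU (σ n)).1, ham 0, fun w hwL => key 0 w hwL⟩,
    fun i => ⟨fun n => (hU (σ n)).2.1 i, ham i.succ, fun w hwL => key i.succ w hwL⟩⟩

end WeakLimit

/-! ### Unfolded H¹₀ fields as smooth limits -/

section UnfoldLimit

variable {L : Fin 2 → ℝ} {G : E 2 → ℝ} {ε : ℝ}

theorem measurableSet_bottom_union_top (hG : Continuous G) :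
    MeasurableSet (bottomYstar L ∪ topYstar L G) := by
  have h1 : IsOpen (cellY L) := isOpen_setOf_forall_mem fun _ => isOpen_Ioo
  have h2 : Continuous fun x : E 3 => x 2 := by fun_prop
  exact ((h1.preimage continuous_hat).measurableSet.inter
    (isClosed_eq h2 continuous_const).measurableSet).union
    ((h1.preimage continuous_hat).measurableSet.inter
    (isClosed_eq h2 (hG.comp continuous_hat)).measurableSet)

/-- Unfold the test functions that approximate v: for fixed ε the operator is linear and L²-bounded,
and it commutes with differentiation up to the factor ε. -/
theorem IsH10.isSmoothLimit_unfoldOp (hL : ∀ i, 0 < L i) (hGc : Continuous G)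
    (hper : YPeriodic L G) (hε : 0 < ε) {v : E 3 → E 3} {Dv : Fin 3 → E 3 → E 3}
    (hv : IsH10 (thinDomain G ε) v Dv) :
    IsSmoothLimit omega (cellYstar L G) (bottomYstar L ∪ topYstar L G)
      (unfoldOp L ε v) (fun i x y => ε • unfoldOp L ε (Dv i) x y) := by
  obtain ⟨⟨h0, h1, -⟩, φ, hφ, hlim, hlimd⟩ := hv
  have hm : ∀ {w : E 3 → E 3}, IsL2 (thinDomain G ε) w →
      IsL2Prod omega (cellYstar L G) (unfoldOp L ε w) := fun hw => memLp_unfoldOp hL hGc hper hε hw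
  have hms : ∀ {w : E 3 → E 3}, IsL2 (thinDomain G ε) w →
      IsL2Prod omega (cellYstar L G) (fun x y => ε • unfoldOp L ε w x y) :=
    fun hw => (hm hw).const_smul ε
  have hconv : ∀ {ψ : ℕ → E 3 → E 3} {w : E 3 → E 3},
      (∀ m, IsL2 (thinDomain G ε) (ψ m)) → IsL2 (thinDomain G ε) w →
      Tendsto (fun n => eLpNorm (fun x => ψ n x - w x) 2 (volume.restrict (thinDomain G ε)))
        atTop (𝓝 0) →
      Tendsto (fun n => eLpNorm (fun p : E 2 × E 3 =>
        unfoldOp L ε (ψ n) p.1 p.2 - unfoldOp L ε w p.1 p.2) 2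
        (volume.restrict (omega ×ˢ cellYstar L G))) atTop (𝓝 0) := by
    intro ψ w hψ hw ht
    have ht' := ENNReal.Tendsto.const_mul (a := ENNReal.ofReal √(L 0 * L 1 / ε)) ht
      (Or.inr ENNReal.ofReal_ne_top)
    rw [mul_zero] at ht'
    refine tendsto_of_tendsto_of_tendsto_of_le_of_le tendsto_const_nhds ht'
      (fun _ => zero_le) (fun n => ?_)
    refine le_trans (le_of_eq ?_)
      (eLpNorm_unfoldOp_le hL hGc hper hε (φ := fun x => ψ n x - w x) ((hψ n).sub hw).1)
    congr 1
    ext1 p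
    exact (unfoldOp_sub _ _ _ _).symm
  refine ⟨hm h0, fun i => hms (h1 i), fun m => unfoldOp L ε (φ m),
    fun m x => contDiff_unfoldOp (hφ m).1 x, fun m x y hy => (hφ m).unfoldOp_eq_zero hper hε x hy,
    fun m => hm ((hφ m).memLp _ 2), fun m i => ?_,
    hconv (fun m => (hφ m).memLp _ 2) h0 hlim, fun i => ?_⟩
  · have := hms (((hφ m).pderiv i).memLp _ 2)
    simpa only [IsL2Prod, pderiv_unfoldOp (hφ m).1, Function.uncurry_def] using this
  · simp only [pderiv_unfoldOp (hφ _).1, ← smul_sub]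
    have ht := hconv (fun m => ((hφ m).pderiv i).memLp _ 2) (h1 i) (hlimd i)
    have ht' := ENNReal.Tendsto.const_mul (a := ‖ε‖ₑ) ht (Or.inr (by simp))
    rw [mul_zero] at ht'
    refine ht'.congr fun n => ?_
    exact (eLpNorm_const_smul ε _ 2 _).symm

end UnfoldLimit

/-! ### Vertical integration of test functions -/

section Vertical

/-- The point of `ℝ³` with horizontal part `x` and height `t`. -/
noncomputable def join (x : E 2) (t : ℝ) : E 3 := !₂[x 0, x 1, t]

@[simp] theorem hat_join (x : E 2) (t : ℝ) : hat (join x t) = x := by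
  ext i; fin_cases i <;> simp [hat, join]

/-- The linear inclusion of the horizontal plane. -/
noncomputable def horizontal : E 2 →L[ℝ] E 3 :=
  LinearMap.toContinuousLinearMap
    { toFun := fun x => join x 0
      map_add' := fun x y => by ext i; fin_cases i <;> simp [join]
      map_smul' := fun c x => by ext i; fin_cases i <;> simp [join] }

theorem join_eq (x : E 2) (t : ℝ) :
    join x t = horizontal x + t • EuclideanSpace.single 2 (1 : ℝ) := by
  ext i; fin_cases i <;> simp [join, horizontal]

theorem horizontal_single (i : Fin 2) :
    horizontal (EuclideanSpace.single i (1 : ℝ)) = EuclideanSpace.single i.castSucc (1 : ℝ) := by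
  ext j; fin_cases i <;> fin_cases j <;> simp [join, horizontal]

theorem contDiff_join : ContDiff ℝ ∞ (fun p : E 2 × ℝ => join p.1 p.2) := by
  simp only [join_eq]
  fun_prop

theorem continuous_join_right (x : E 2) : Continuous (join x) := by
  have := contDiff_join.continuous
  fun_prop

/-- The vertical integral `x̂ ↦ ∫ ψ(x̂, t) dt`. -/
noncomputable def vint (ψ : E 3 → ℝ) (x : E 2) : ℝ := ∫ t, ψ (join x t)

variable {ψ : E 3 → ℝ}

theorem exists_compact_height (hψ : HasCompactSupport ψ) :
    ∃ K : Set ℝ, IsCompact K ∧ ∀ x t, t ∉ K → join x t ∉ tsupport ψ := by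
  refine ⟨(fun x : E 3 => x 2) '' tsupport ψ, hψ.isCompact.image (by fun_prop), ?_⟩
  intro x t ht h
  exact ht ⟨_, h, by simp [join]⟩

/-- The vertical integral is a convolution with the constant 1, evaluated at 0 and depending on the
parameter x̂; the supports in height lie in one compact set for all x̂. -/
theorem contDiff_vint (hψ : ContDiff ℝ ∞ ψ) (hc : HasCompactSupport ψ) :
    ContDiff ℝ ∞ (vint ψ) := by
  obtain ⟨K, hK, hKψ⟩ := exists_compact_height hc
  have h := contDiffOn_convolution_right_with_param (𝕜 := ℝ) (μ := (volume : Measure ℝ))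
    (f := fun _ : ℝ => (1 : ℝ)) (n := ⊤) (ContinuousLinearMap.mul ℝ ℝ)
    (g := fun (x : E 2) (t : ℝ) => ψ (join x (-t))) (s := Set.univ) (k := -K) isOpen_univ hK.neg
    (fun x t _ ht => image_eq_zero_of_notMem_tsupport (hKψ x (-t) (by simpa using ht)))
    (locallyIntegrable_const 1)
    (by
      have e : (↿fun (x : E 2) (t : ℝ) => ψ (join x (-t))) =
        (ψ ∘ (fun p : E 2 × ℝ => join p.1 p.2)) ∘ fun p : E 2 × ℝ => (p.1, -p.2) := rfl
      rw [e]
      exact ((hψ.comp contDiff_join).comp (by fun_prop)).contDiffOn)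
  rw [Set.univ_prod_univ, contDiffOn_univ] at h
  have h2 := h.comp (contDiff_id.prodMk (contDiff_const (c := (0 : ℝ))) :
    ContDiff ℝ ∞ fun x : E 2 => (x, (0 : ℝ)))
  have e : vint ψ = (fun q : E 2 × ℝ => convolution (fun _ : ℝ => (1 : ℝ))
      (fun t => ψ (join q.1 (-t))) (ContinuousLinearMap.mul ℝ ℝ) volume q.2) ∘
      fun x => (id x, (0 : ℝ)) := by
    ext x
    simp [vint, MeasureTheory.convolution]
  rw [e]
  exact h2

theorem integrable_join (hψ : Continuous ψ) (hc : HasCompactSupport ψ) (x : E 2) :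
    Integrable fun t => ψ (join x t) := by
  obtain ⟨K, hK, hKψ⟩ := exists_compact_height hc
  exact (hψ.comp (continuous_join_right x)).integrable_of_hasCompactSupport
    (HasCompactSupport.intro hK fun t ht =>
      image_eq_zero_of_notMem_tsupport (f := ψ) (hKψ x t ht))

theorem pderiv_vint (hψ : ContDiff ℝ ∞ ψ) (hc : HasCompactSupport ψ) (i : Fin 2) (x : E 2) :
    pderiv i (vint ψ) x = vint (pderiv i.castSucc ψ) x := by
  obtain ⟨K, hK, hKψ⟩ := exists_compact_height hc
  have hcf : Continuous (fderiv ℝ ψ) := hψ.continuous_fderiv (by simp)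
  obtain ⟨C, hC⟩ := (hc.fderiv (𝕜 := ℝ)).exists_bound_of_continuous hcf
  have hF'c : Continuous fun t => (fderiv ℝ ψ (join x t)).comp horizontal :=
    (hcf.comp (continuous_join_right x)).clm_comp continuous_const
  have hF'0 : ∀ x t, t ∉ K → fderiv ℝ ψ (join x t) = 0 := fun x t ht =>
    image_eq_zero_of_notMem_tsupport fun h => hKψ x t ht (tsupport_fderiv_subset ℝ h)
  have h := hasFDerivAt_integral_of_dominated_of_fderiv_le (𝕜 := ℝ)
    (μ := (volume : Measure ℝ)) (F := fun (x : E 2) t => ψ (join x t))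
    (F' := fun x t => (fderiv ℝ ψ (join x t)).comp horizontal) (x₀ := x)
    (bound := K.indicator fun _ => C * ‖horizontal‖) (s := Set.univ) univ_mem
    (Eventually.of_forall fun x => (integrable_join hψ.continuous hc x).1)
    (integrable_join hψ.continuous hc x) hF'c.aestronglyMeasurable
    (Eventually.of_forall fun t x _ => by
      by_cases ht : t ∈ K
      · rw [Set.indicator_of_mem ht]
        exact (ContinuousLinearMap.opNorm_comp_le _ _).trans
          (mul_le_mul_of_nonneg_right (hC _) (norm_nonneg _))
      · rw [Set.indicator_of_notMem ht, hF'0 x t ht]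
        simp)
    ((integrable_indicator_iff hK.measurableSet).2
      (integrableOn_const hK.measure_lt_top.ne))
    (Eventually.of_forall fun t x _ => by
      have h1 : HasFDerivAt (fun x => join x t) horizontal x := by
        simp only [join_eq]
        exact horizontal.hasFDerivAt.add_const _
      exact ((hψ.differentiable (by simp)).differentiableAt.hasFDerivAt).comp x h1)
  have h' : HasFDerivAt (vint ψ) _ x := h
  have hint : Integrable fun t => (fderiv ℝ ψ (join x t)).comp horizontal :=
    hF'c.integrable_of_hasCompactSupport
      (HasCompactSupport.intro hK fun t ht => by rw [hF'0 x t ht]; simp)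
  simp only [pderiv]
  rw [h'.fderiv, ContinuousLinearMap.integral_apply hint]
  simp only [ContinuousLinearMap.comp_apply, horizontal_single, vint, pderiv]

theorem vint_pderiv_two (hψ : ContDiff ℝ ∞ ψ) (hc : HasCompactSupport ψ) (x : E 2) :
    vint (pderiv 2 ψ) x = 0 := by
  have hd : ∀ t, HasDerivAt (fun t => ψ (join x t)) (pderiv 2 ψ (join x t)) t := by
    intro t
    have h1 : HasDerivAt (join x) (EuclideanSpace.single 2 (1 : ℝ)) t := by
      have : join x = fun t => horizontal x + t • EuclideanSpace.single 2 (1 : ℝ) :=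
        funext fun t => join_eq x t
      rw [this]
      simpa using ((hasDerivAt_id t).smul_const (EuclideanSpace.single 2 (1 : ℝ))).const_add
        (horizontal x)
    exact ((hψ.differentiable (by simp)).differentiableAt.hasFDerivAt).comp_hasDerivAt t h1
  exact integral_eq_zero_of_hasDerivAt_of_integrable hd
    (integrable_join (continuous_pderiv hψ 2) (hasCompactSupport_pderiv hc 2) x)
    (integrable_join hψ.continuous hc x)

variable {U : Set (E 3)} {A : Set (E 2)}

theorem IsTest.vint (hψ : IsTest U ψ) (hU : ∀ x ∈ U, hat x ∈ A) : IsTest A (vint ψ) := by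
  have h0 : ∀ x, x ∉ hat '' tsupport ψ → ThinBingham.vint ψ x = 0 := by
    intro x hx
    have : ∀ t, ψ (join x t) = 0 := fun t =>
      image_eq_zero_of_notMem_tsupport fun h => hx ⟨_, h, hat_join x t⟩
    simp [ThinBingham.vint, this]
  have hK : IsCompact (hat '' tsupport ψ) := hψ.2.1.isCompact.image continuous_hat
  refine ⟨contDiff_vint hψ.1 hψ.2.1, HasCompactSupport.intro hK h0, ?_⟩
  have hsub : tsupport (ThinBingham.vint ψ) ⊆ hat '' tsupport ψ := by
    refine closure_minimal (fun x hx => ?_) hK.isClosed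
    by_contra hx'
    exact hx (h0 x hx')
  refine hsub.trans ?_
  rintro _ ⟨x, hx, rfl⟩
  exact hU x (hψ.2.2 hx)

theorem integral_mul_comp_hat (hψ : IsTest U ψ) {a : ℝ}
    (hU : ∀ x ∈ U, hat x ∈ A ∧ x 2 ∈ Set.Ioo 0 a) {h : E 2 → ℝ}
    (hh : MemLp h 2 (volume.restrict A)) :
    ∫ x in U, ψ x * h (hat x) = ∫ x in A, vint ψ x * h x := by
  have hi : IntegrableOn (fun x => ψ x * h (hat x)) U :=
    (hψ.memLp _ 2).integrable_mul (memLp_comp_hat hU hh)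
  have hi' : Integrable (fun x => ψ x * h (hat x)) := by
    rwa [← integrableOn_iff_integrable_of_support_subset (s := U)]
    intro x hx
    by_contra hxU
    simp [hψ.eq_zero hxU] at hx
  rw [setIntegral_eq_integral_of_forall_compl_eq_zero (fun x hx => by simp [hψ.eq_zero hx]),
    setIntegral_eq_integral_of_forall_compl_eq_zero
      (fun x hx => by simp [(hψ.vint (fun x hx => (hU x hx).1)).eq_zero hx])]
  have hmp := measurePreserving_split.symm split.toMeasurableEquiv
  have e1 := hmp.integral_comp' (g := fun x => ψ x * h (hat x))
  have i1 := (hmp.integrable_comp_emb split.toMeasurableEquiv.symm.measurableEmbedding).2 hi'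
  rw [← e1]
  have e2 := integral_prod _ i1
  refine e2.trans (integral_congr_ae (Eventually.of_forall fun x => ?_))
  change ∫ t, ψ (join x t) * h (hat (join x t)) = _
  simp only [hat_join, integral_mul_const, vint]

/-- A function of the horizontal variables in `H¹(A)` defines a function in `H¹(U)`. -/
theorem IsH1.comp_hat {a : ℝ} (hU : ∀ x ∈ U, hat x ∈ A ∧ x 2 ∈ Set.Ioo 0 a)
    {q : E 2 → ℝ} {Dq : Fin 2 → E 2 → ℝ} (hq : IsH1 A q Dq) :
    IsH1 U (fun x => q (hat x)) (Fin.snoc (fun i x => Dq i (hat x)) 0) := by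
  have hU' : ∀ x ∈ U, hat x ∈ A := fun x hx => (hU x hx).1
  refine ⟨memLp_comp_hat hU hq.1, fun j => ?_, fun j φ hφ => ?_⟩
  · refine Fin.lastCases ?_ (fun i => ?_) j
    · rw [Fin.snoc_last]
      exact MemLp.zero
    · rw [Fin.snoc_castSucc]
      exact memLp_comp_hat hU (hq.2.1 i)
  · simp only [smul_eq_mul]
    -- Fubini turns a test function φ on U into the test function `vint φ` on A. Horizontal
    -- derivatives commute with `vint`, and the vertical one integrates to zero, so the weak
    -- derivatives of q alone suffice.
    rw [integral_mul_comp_hat (hφ.pderiv j) hU hq.1]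
    refine Fin.lastCases ?_ (fun i => ?_) j
    · have e : ∀ x, vint (pderiv (Fin.last 2) φ) x = 0 := fun x => vint_pderiv_two hφ.1 hφ.2.1 x
      simp only [e, Fin.snoc_last, zero_mul, Pi.zero_apply, mul_zero, integral_zero, neg_zero]
    · simp only [Fin.snoc_castSucc]
      rw [integral_mul_comp_hat hφ hU (hq.2.1 i)]
      have := hq.2.2 i _ (hφ.vint hU')
      simpa only [smul_eq_mul, pderiv_vint hφ.1 hφ.2.1] using this

end Vertical

/-! ### Orthogonality of solenoidal fields and gradients -/

section Orthogonality

theorem IsTest.coord {d : ℕ} {U : Set (E d)} {φ : E d → E d} (hφ : IsTest U φ) (i : Fin d) :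
    IsTest U (fun x => φ x i) := by
  refine ⟨?_, hφ.2.1.comp_left (g := fun v : E d => v i) rfl, ?_⟩
  · exact contDiff_euclidean.1 hφ.1 i
  · exact (tsupport_comp_subset (g := fun v : E d => v i) rfl φ).trans hφ.2.2

theorem pderiv_coord {d : ℕ} {φ : E d → E d} (hφ : ContDiff ℝ ∞ φ) (i j : Fin d) (x : E d) :
    pderiv j (fun x => φ x i) x = pderiv j φ x i := by
  have h1 := (hφ.differentiable (by simp)).differentiableAt (x := x) |>.hasFDerivAt
  have h2 : HasFDerivAt (fun x => φ x i) _ x :=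
    (EuclideanSpace.proj i : E d →L[ℝ] ℝ).hasFDerivAt.comp x h1
  simp only [pderiv]
  rw [h2.fderiv]
  rfl

/-- The bilinear map `(v, c) ↦ vᵢ c`. -/
noncomputable def coordMul {d : ℕ} (i : Fin d) : E d →L[ℝ] ℝ →L[ℝ] ℝ :=
  (ContinuousLinearMap.mul ℝ ℝ).comp (EuclideanSpace.proj i)

@[simp] theorem coordMul_apply {d : ℕ} (i : Fin d) (v : E d) (c : ℝ) :
    coordMul i v c = v i * c := rfl

theorem norm_coordMul_le {d : ℕ} (i : Fin d) : ‖coordMul i‖ ≤ 1 := by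
  refine ContinuousLinearMap.opNorm_le_bound₂ _ zero_le_one fun v c => ?_
  rw [coordMul_apply, norm_mul, one_mul]
  gcongr
  exact PiLp.norm_apply_le v i

theorem integrable_coord_mul {α : Type*} {m : MeasurableSpace α} {ν : Measure α} {d : ℕ}
    {v : α → E d} {c : α → ℝ} (hv : MemLp v 2 ν) (hc : MemLp c 2 ν) (i : Fin d) :
    Integrable (fun x => v x i * c x) ν :=
  integrable_pairing (coordMul i) hv hc

/-- For the test fields approximating v, each coordinate is an admissible test function in the weak
derivative of q. The limit moves the derivatives onto v, where they sum to the divergence. As v is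
in H¹₀, q needs no boundary condition. -/
theorem integral_sum_mul_grad_eq_zero {d : ℕ} {U : Set (E d)} {v : E d → E d}
    {Dv : Fin d → E d → E d} (hv : IsH10 U v Dv)
    (hdiv : ∀ᵐ x ∂(volume.restrict U), divg Dv x = 0)
    {q : E d → ℝ} {Dq : Fin d → E d → ℝ} (hq : IsH1 U q Dq) :
    ∫ x in U, ∑ j, v x j * Dq j x = 0 := by
  obtain ⟨h1, φ, hφ, hlim⟩ := hv
  have t1 : Tendsto (fun n => ∑ j, ∫ x in U, φ n x j * Dq j x) atTop
      (𝓝 (∑ j, ∫ x in U, v x j * Dq j x)) :=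
    tendsto_finsetSum _ fun j _ => tendsto_integral_pairing (coordMul j)
      (fun n => (hφ n).memLp _ 2) h1.1 (hq.2.1 j) hlim.1
  have t2 : Tendsto (fun n => ∑ j, ∫ x in U, pderiv j (φ n) x j * q x) atTop
      (𝓝 (∑ j, ∫ x in U, Dv j x j * q x)) :=
    tendsto_finsetSum _ fun j _ => tendsto_integral_pairing (coordMul j)
      (fun n => ((hφ n).pderiv j).memLp _ 2) (h1.2.1 j) hq.1 (hlim.2 j)
  have e0 : ∑ j, ∫ x in U, Dv j x j * q x = 0 := by
    rw [← integral_finsetSum _ fun j _ => integrable_coord_mul (h1.2.1 j) hq.1 j]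
    refine integral_eq_zero_of_ae ?_
    filter_upwards [hdiv] with x hx
    simp only [divg] at hx
    simp only [Pi.zero_apply, ← Finset.sum_mul, hx, zero_mul]
  rw [e0] at t2
  rw [integral_finsetSum _ fun j _ => integrable_coord_mul h1.1 (hq.2.1 j) j]
  refine tendsto_nhds_unique t1 ?_
  have t3 := t2.neg
  rw [neg_zero] at t3
  refine t3.congr fun n => ?_
  rw [← Finset.sum_neg_distrib]
  refine Finset.sum_congr rfl fun j _ => ?_
  have := hq.2.2 j _ ((hφ n).coord j)
  simp only [smul_eq_mul, pderiv_coord (hφ n).1] at this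
  rw [this, neg_neg]

/-- The linear projection `x ↦ x̂`. -/
noncomputable def hatL : E 3 →L[ℝ] E 2 :=
  LinearMap.toContinuousLinearMap
    { toFun := hat
      map_add' := fun x y => by ext i; fin_cases i <;> simp
      map_smul' := fun c x => by ext i; fin_cases i <;> simp }

@[simp] theorem hatL_apply (x : E 3) : hatL x = hat x := rfl

theorem hasFDerivAt_hat (x : E 3) : HasFDerivAt hat hatL x := by
  have h : hat = fun y => hatL y := rfl
  rw [h]
  exact hatL.hasFDerivAt

variable {G : E 2 → ℝ} {G₁ ε : ℝ}

theorem thinDomain_subset_slab (hε : 0 < ε) (hG : ∀ y, G y ≤ G₁) :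
    ∀ x ∈ thinDomain G ε, hat x ∈ omega ∧ x 2 ∈ Set.Ioo 0 (ε * G₁) := by
  rintro x ⟨h0, h1, h2⟩
  exact ⟨h0, h1, h2.trans_le (mul_le_mul_of_nonneg_left (hG _) hε.le)⟩

theorem IsAdmissible.integral_horizontal_grad (hε : 0 < ε) (hG : ∀ y, G y ≤ G₁)
    {v : E 3 → E 3} {Dv : Fin 3 → E 3 → E 3} (hv : IsAdmissible G ε v Dv)
    {q : E 2 → ℝ} {Dq : Fin 2 → E 2 → ℝ} (hq : IsH1 omega q Dq) :
    ∑ i : Fin 2, ∫ x in thinDomain G ε, v x i.castSucc * Dq i (hat x) = 0 := by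
  have hs := thinDomain_subset_slab hε hG
  have h := integral_sum_mul_grad_eq_zero hv.1 hv.2 (hq.comp_hat hs)
  rw [← integral_finsetSum _ fun i _ => integrable_coord_mul hv.1.1.1
    (memLp_comp_hat hs (hq.2.1 i)) i.castSucc, ← h]
  refine integral_congr_ae (Eventually.of_forall fun x => ?_)
  simp only [Fin.sum_univ_castSucc (n := 2), Fin.snoc_castSucc, Fin.snoc_last]
  simp

theorem height_mul_ae_le (hGc : Continuous G) (hε : 0 < ε) (hG : ∀ y, G y ≤ G₁) (k : E 3 → ℝ) :
    ∀ᵐ x ∂(volume.restrict (thinDomain G ε)), ‖x 2 * k x‖ ≤ ε * G₁ * ‖k x‖ := by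
  filter_upwards [ae_restrict_mem (isOpen_thinDomain hGc ε).measurableSet] with x hx
  rw [norm_mul]
  exact mul_le_mul_of_nonneg_right (abs_le_of_mem_thinDomain hε hG x hx) (norm_nonneg _)

theorem memLp_height_mul (hGc : Continuous G) (hε : 0 < ε) (hG : ∀ y, G y ≤ G₁) {k : E 3 → ℝ}
    (hk : MemLp k 2 (volume.restrict (thinDomain G ε))) :
    MemLp (fun x => x 2 * k x) 2 (volume.restrict (thinDomain G ε)) := by
  have hc : Continuous fun x : E 3 => x 2 := by fun_prop
  exact MemLp.of_le_mul hk (hc.aestronglyMeasurable.mul hk.1) (height_mul_ae_le hGc hε hG k)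

theorem eLpNorm_height_mul_le (hGc : Continuous G) (hε : 0 < ε) (hG₁ : 0 ≤ G₁)
    (hG : ∀ y, G y ≤ G₁) {k : E 3 → ℝ} (hk : MemLp k 2 (volume.restrict (thinDomain G ε))) :
    (eLpNorm (fun x => x 2 * k x) 2 (volume.restrict (thinDomain G ε))).toReal ≤
      ε * G₁ * (eLpNorm k 2 (volume.restrict (thinDomain G ε))).toReal := by
  have h := eLpNorm_le_mul_eLpNorm_of_ae_le_mul (height_mul_ae_le hGc hε hG k) 2
  have h2 := ENNReal.toReal_mono (ENNReal.mul_ne_top ENNReal.ofReal_ne_top hk.2.ne) h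
  rwa [ENNReal.toReal_mul, ENNReal.toReal_ofReal (by positivity)] at h2

/-- Orthogonality to the gradient of x₃ q(x̂), whose vertical component is q and whose horizontal
components carry the small factor x₃. The right side is thus smaller by an order of ε. -/
theorem IsAdmissible.integral_vertical (hGc : Continuous G) (hε : 0 < ε) (hG : ∀ y, G y ≤ G₁)
    {v : E 3 → E 3} {Dv : Fin 3 → E 3 → E 3} (hv : IsAdmissible G ε v Dv)
    {q : E 2 → ℝ} (hq : IsTest omega q) :
    ∫ x in thinDomain G ε, v x 2 * q (hat x) =
      - ∑ i : Fin 2, ∫ x in thinDomain G ε, v x i.castSucc * (x 2 * pderiv i q (hat x)) := by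
  have hs := thinDomain_subset_slab hε hG
  set Ψ : E 3 → ℝ := fun x => x 2 * q (hat x) with hΨ
  have hc : ContDiff ℝ ∞ (fun x : E 3 => x 2) := by fun_prop
  have hΨs : ContDiff ℝ ∞ Ψ := hc.mul (hq.1.comp contDiff_hat)
  have hm : ∀ {h : E 2 → ℝ}, MemLp h 2 (volume.restrict omega) →
      MemLp (fun x => x 2 * h (hat x)) 2 (volume.restrict (thinDomain G ε)) := fun hm =>
    memLp_height_mul hGc hε hG (memLp_comp_hat hs hm)
  have hd : ∀ (j : Fin 3) x, pderiv j Ψ x =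
      (Fin.snoc (fun i x => x 2 * pderiv i q (hat x)) (fun x => q (hat x)) :
        Fin 3 → E 3 → ℝ) j x := by
    intro j x
    have h1 : HasFDerivAt (fun x : E 3 => x 2) (EuclideanSpace.proj 2 : E 3 →L[ℝ] ℝ) x :=
      (EuclideanSpace.proj 2 : E 3 →L[ℝ] ℝ).hasFDerivAt
    have h2 : HasFDerivAt (fun x => q (hat x)) _ x :=
      ((hq.1.differentiable (by simp)).differentiableAt.hasFDerivAt).comp x (hasFDerivAt_hat x)
    have h3 : HasFDerivAt Ψ _ x := h1.mul h2
    simp only [pderiv]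
    rw [h3.fderiv]
    refine Fin.lastCases ?_ (fun i => ?_) j
    · have e : hat (EuclideanSpace.single (Fin.last 2) (1 : ℝ)) = 0 := by
        ext i; fin_cases i <;> simp [hat, Fin.ext_iff]
      simp only [Fin.snoc_last, add_apply, smul_apply, ContinuousLinearMap.comp_apply, hatL_apply,
        e, map_zero, smul_zero, zero_add]
      simp
    · have e : hat (EuclideanSpace.single i.castSucc (1 : ℝ)) = EuclideanSpace.single i 1 := by
        ext k; fin_cases i <;> fin_cases k <;> simp [hat]
      have e2 : (2 : Fin 3) ≠ i.castSucc := by fin_cases i <;> decide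
      simp [e, e2]
  have hDm : ∀ j, IsL2 (thinDomain G ε) (pderiv j Ψ) := by
    intro j
    have e : pderiv j Ψ = _ := funext (hd j)
    rw [e]
    refine Fin.lastCases ?_ (fun i => ?_) j
    · simp only [Fin.snoc_last]
      exact memLp_comp_hat hs (hq.memLp _ 2)
    · simp only [Fin.snoc_castSucc]
      exact hm ((hq.pderiv i).memLp _ 2)
  have hΨ1 : IsH1 (thinDomain G ε) Ψ (fun j => pderiv j Ψ) :=
    isH1_of_tendstoH1 (φ := fun _ => Ψ) (fun _ => hΨs) (hm (hq.memLp _ 2)) hDm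
      ⟨by simp, by simp⟩
  have h := integral_sum_mul_grad_eq_zero hv.1 hv.2 hΨ1
  rw [integral_finsetSum _ fun i _ => integrable_coord_mul hv.1.1.1 (hDm i) i,
    Fin.sum_univ_castSucc (n := 2)] at h
  simp only [hd, Fin.snoc_castSucc, Fin.snoc_last] at h
  exact eq_neg_of_add_eq_zero_right h

end Orthogonality

/-! ### Averages of unfolded sequences -/

/-- A three-term estimate: functionals that are Lipschitz in L² uniformly in n converge everywhere
once they converge on the dense class of compactly supported continuous functions. -/
theorem tendsto_of_dense_of_lipschitz {ν : Measure (E 2)} [ν.Regular]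
    {I : ℕ → (E 2 → ℝ) → ℝ} {J : (E 2 → ℝ) → ℝ} {K : ℝ} (hK : 0 ≤ K)
    (hI : ∀ n h k, MemLp h 2 ν → MemLp k 2 ν →
      |I n h - I n k| ≤ K * (eLpNorm (h - k) 2 ν).toReal)
    (hJ : ∀ h k, MemLp h 2 ν → MemLp k 2 ν → |J h - J k| ≤ K * (eLpNorm (h - k) 2 ν).toReal)
    (hlim : ∀ k : E 2 → ℝ, Continuous k → HasCompactSupport k →
      Tendsto (fun n => I n k) atTop (𝓝 (J k)))
    {h : E 2 → ℝ} (hh : MemLp h 2 ν) : Tendsto (fun n => I n h) atTop (𝓝 (J h)) := by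
  rw [Metric.tendsto_atTop]
  intro η hη
  set θ := η / (3 * (K + 1)) with hθ
  have hθ0 : 0 < θ := by positivity
  obtain ⟨k, hkc, hkn, hkcont, hkm⟩ := hh.exists_hasCompactSupport_eLpNorm_sub_le (by simp)
    (ε := ENNReal.ofReal θ) (by simpa using hθ0)
  have hN : (eLpNorm (h - k) 2 ν).toReal ≤ θ := ENNReal.toReal_le_of_le_ofReal hθ0.le hkn
  have hKN : K * (eLpNorm (h - k) 2 ν).toReal < η / 3 := by
    calc K * (eLpNorm (h - k) 2 ν).toReal ≤ K * θ := by gcongr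
      _ < (K + 1) * θ := by nlinarith
      _ = η / 3 := by rw [hθ]; field_simp
  obtain ⟨N, hN'⟩ := Metric.tendsto_atTop.1 (hlim k hkcont hkc) (η / 3) (by positivity)
  refine ⟨N, fun n hn => ?_⟩
  have h1 := hI n h k hh hkm
  have h2 := hJ h k hh hkm
  have h3 := hN' n hn
  rw [Real.dist_eq] at h3 ⊢
  rw [abs_lt] at h3 ⊢
  rw [abs_le] at h1 h2
  constructor <;> linarith [h1.1, h1.2, h2.1, h2.2, h3.1, h3.2]

theorem dist_le_sum {x y : E 2} : dist x y ≤ |x 0 - y 0| + |x 1 - y 1| := by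
  rw [EuclideanSpace.dist_eq, Fin.sum_univ_two, Real.dist_eq, Real.dist_eq]
  refine Real.sqrt_le_iff.2 ⟨by positivity, ?_⟩
  nlinarith [abs_nonneg (x 0 - y 0), abs_nonneg (x 1 - y 1)]

section Average

variable {L : Fin 2 → ℝ} {G : E 2 → ℝ} {G₁ M : ℝ}

theorem dist_hat_unfoldPoint_le {ε : ℝ} (hL : ∀ i, 0 < L i) (hε : 0 < ε) {x : E 2} {y : E 3}
    (hx : x ∈ omegaEps L ε) (hy : y ∈ cellYstar L G) :
    dist (hat (cellMap L ε (cellIndex L ε x) y)) x ≤ ε * (L 0 + L 1) := by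
  rw [omegaEps_eq hL hε] at hx
  obtain ⟨-, h2⟩ := cellIndex_mem hL hε hx
  have hc := (hat_cellMap_mem_epsCell hε (cellIndex L ε x) y).2 hy.1
  have h : ∀ i, |hat (cellMap L ε (cellIndex L ε x) y) i - x i| ≤ ε * L i := by
    intro i
    have h3 := hc i
    have h4 := h2 i
    rw [abs_le]
    constructor <;> linarith [h3.1, h3.2, h4.1, h4.2]
  refine dist_le_sum.trans ?_
  linarith [h 0, h 1]

theorem volume_cellYstar_lt_top (hG : ∀ y, G y ≤ G₁) : volume (cellYstar L G) < ⊤ := by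
  have h := volume_le_of_hat (Ω := cellYstar L G) (A := cellY L) (a := G₁)
    (fun x hx => ⟨hx.1, hx.2.1, hx.2.2.trans_le (hG _)⟩)
  refine h.trans_lt ?_
  have : volume (cellY L) = _ := volume_setOf_forall_mem (fun i => Set.Ioo 0 (L i))
  rw [this]
  exact ENNReal.mul_lt_top ENNReal.ofReal_lt_top (ENNReal.prod_lt_top fun i _ => by simp)

theorem isFiniteMeasure_restrict_prod (hG : ∀ y, G y ≤ G₁) :
    IsFiniteMeasure ((volume : Measure (E 2 × E 3)).restrict (omega ×ˢ cellYstar L G)) := by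
  refine ⟨?_⟩
  rw [Measure.restrict_apply_univ, Measure.volume_eq_prod, Measure.prod_prod, volume_omega, one_mul]
  exact volume_cellYstar_lt_top hG

theorem memLp_comp_fst (hG : ∀ y, G y ≤ G₁) {h : E 2 → ℝ} (hh : MemLp h 2 (volume.restrict omega)) :
    MemLp (fun p : E 2 × E 3 => h p.1) 2 (volume.restrict (omega ×ˢ cellYstar L G)) := by
  rw [restrict_prod_eq]
  refine MemLp.comp_of_map (f := (Prod.fst : E 2 × E 3 → E 2)) ?_ measurable_fst.aemeasurable
  rw [Measure.map_fst_prod]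
  refine hh.smul_measure ?_
  rw [Measure.restrict_apply_univ]
  exact (volume_cellYstar_lt_top hG).ne

theorem eLpNorm_comp_fst {h : E 2 → ℝ}
    (hh : MemLp h 2 (volume.restrict omega)) :
    (eLpNorm (fun p : E 2 × E 3 => h p.1) 2 (volume.restrict (omega ×ˢ cellYstar L G))).toReal =
      (volume (cellYstar L G)).toReal ^ (1 / 2 : ℝ) *
        (eLpNorm h 2 (volume.restrict omega)).toReal := by
  have hm : AEStronglyMeasurable h (Measure.map Prod.fst
      ((volume.restrict omega).prod (volume.restrict (cellYstar L G)))) := by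
    rw [Measure.map_fst_prod]
    exact hh.1.smul_measure _
  have h1 := eLpNorm_map_measure (p := 2) hm measurable_fst.aemeasurable
  rw [Measure.map_fst_prod, eLpNorm_smul_measure_of_ne_top (by norm_num),
    Measure.restrict_apply_univ] at h1
  rw [restrict_prod_eq]
  change (eLpNorm (h ∘ Prod.fst) 2 _).toReal = _
  rw [← h1, smul_eq_mul, ENNReal.toReal_mul, ← ENNReal.toReal_rpow]
  norm_num

theorem abs_integral_coord_mul_le {α : Type*} {m : MeasurableSpace α} {ν : Measure α} {d : ℕ}
    {v : α → E d} {c : α → ℝ} (hv : MemLp v 2 ν) (hc : MemLp c 2 ν) (i : Fin d) :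
    |∫ x, v x i * c x ∂ν| ≤ (eLpNorm v 2 ν).toReal * (eLpNorm c 2 ν).toReal := by
  refine (norm_integral_pairing_le (coordMul i) hv hc).trans ?_
  rw [mul_assoc]
  exact mul_le_of_le_one_left (by positivity) (norm_coordMul_le i)

/-- The field and the test function each contribute ε^{1/2} on Ω_ε, which the normalisation ε⁻¹
cancels exactly. -/
theorem inv_mul_sqrt_mul_sqrt {ε M N : ℝ} (hε : 0 < ε) (hM : 0 ≤ M) :
    ε⁻¹ * (√(M * ε) * √(ε * N)) = √(M * N) := by
  rw [← Real.sqrt_mul (by positivity), show M * ε * (ε * N) = ε ^ 2 * (M * N) by ring,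
    Real.sqrt_mul (by positivity), Real.sqrt_sq hε.le]
  field_simp

/-- The integral splits into the uncovered layer, negligible because its base has vanishing area,
and the part over the cells, which unfolds exactly. There the unfolded product differs little from
the unfolded field times h, and weak convergence applies to the latter. -/
theorem tendsto_average_of_continuous (hL : ∀ i, 0 < L i) (hGc : Continuous G)
    (hper : YPeriodic L G) (hG : ∀ y, G y ≤ G₁) (hM : 0 ≤ M) {ε : ℕ → ℝ} (hε : ∀ n, 0 < ε n)
    (hlim : Tendsto ε atTop (𝓝 0)) {v : ℕ → E 3 → E 3}
    (hv : ∀ n, IsL2 (thinDomain G (ε n)) (v n))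
    (hvM : ∀ n, (eLpNorm (v n) 2 (volume.restrict (thinDomain G (ε n)))).toReal ^ 2 ≤ M * ε n)
    {u : E 2 → E 3 → E 3}
    (hu : WeakTendstoL2 omega (cellYstar L G) (fun n => unfoldOp L (ε n) (v n)) u) (j : Fin 3)
    {h : E 2 → ℝ} (hc : Continuous h) (hcs : HasCompactSupport h) :
    Tendsto (fun n => (ε n)⁻¹ * ∫ x in thinDomain G (ε n), v n x j * h (hat x)) atTop
      (𝓝 ((L 0 * L 1)⁻¹ * ∫ p in omega ×ˢ cellYstar L G, u p.1 p.2 j * h p.1)) := by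
  have hL0 := hL 0
  have hL1 := hL 1
  have hfin := isFiniteMeasure_restrict_prod (L := L) hG
  set ν := (volume : Measure (E 2 × E 3)).restrict (omega ×ˢ cellYstar L G) with hν
  obtain ⟨B, hB⟩ := hcs.exists_bound_of_continuous hc
  have hB0 : 0 ≤ B := (norm_nonneg _).trans (hB 0)
  have huc : UniformContinuous h := hcs.uniformContinuous_of_continuous hc
  have hhm : ∀ ρ : Measure (E 2), [IsFiniteMeasureOnCompacts ρ] → MemLp h 2 ρ := fun ρ _ =>
    hc.memLp_of_hasCompactSupport hcs
  have hvn : ∀ n, (eLpNorm (v n) 2 (volume.restrict (thinDomain G (ε n)))).toReal ≤ √(M * ε n) :=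
    fun n => Real.le_sqrt_of_sq_le (hvM n)
  have hs := fun n => thinDomain_subset_slab (hε n) hG
  have hfm : ∀ n, AEStronglyMeasurable (fun x => v n x j * h (hat x))
      (volume.restrict (thinDomain G (ε n))) := fun n =>
    (integrable_coord_mul (hv n) (memLp_comp_hat (hs n) (hhm _)) j).1
  have hTm := fun n => memLp_unfoldOp hL hGc hper (hε n) (hv n)
  have hTn : ∀ n, (eLpNorm (Function.uncurry (unfoldOp L (ε n) (v n))) 2 ν).toReal
      ≤ √(M * (L 0 * L 1)) := by
    intro n
    refine (toReal_eLpNorm_unfoldOp_le hL hGc hper (hε n) (hv n)).trans ?_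
    refine (mul_le_mul_of_nonneg_left (hvn n) (Real.sqrt_nonneg _)).trans (le_of_eq ?_)
    rw [← Real.sqrt_mul (by have := hε n; positivity)]
    congr 1
    have := (hε n).ne'
    field_simp
  -- the part of the domain not covered by cells
  set rest : ℕ → Set (E 3) := fun n => thinDomain G (ε n) \ innerDomain L G (ε n) with hrest
  have hrs : ∀ n, ∀ x ∈ rest n, hat x ∈ omega \ openCells L (ε n) ∧ x 2 ∈ Set.Ioo 0 (ε n * G₁) :=
    fun n x hx => ⟨⟨(hs n x hx.1).1, fun hh => hx.2 ⟨hx.1, hh⟩⟩, (hs n x hx.1).2⟩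
  have hin : ∀ n, MeasurableSet (innerDomain L G (ε n)) := fun n =>
    ((isOpen_thinDomain hGc (ε n)).inter (isOpen_openCells.preimage continuous_hat)).measurableSet
  have hrestlim : Tendsto (fun n => (ε n)⁻¹ * ∫ x in rest n, v n x j * h (hat x)) atTop (𝓝 0) := by
    have hvol := tendsto_volume_omega_diff hL hε hlim
    have h1 : Tendsto (fun n => √(M * G₁) *
        ((volume (omega \ openCells L (ε n))).toReal ^ (1 / 2 : ℝ) * B)) atTop (𝓝 0) := by
      have h2 := (ENNReal.tendsto_toReal (by simp)).comp hvol
      have h3 := (Real.continuousAt_rpow_const 0 (1 / 2 : ℝ) (Or.inr (by norm_num))).tendsto.comp h2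
      rw [Real.zero_rpow (by norm_num)] at h3
      simpa using (h3.mul_const B).const_mul √(M * G₁)
    refine squeeze_zero_norm (fun n => ?_) h1
    have hvr : MemLp (v n) 2 (volume.restrict (rest n)) :=
      (hv n).mono_measure (Measure.restrict_mono Set.sdiff_subset le_rfl)
    have hhr := hhm (volume.restrict (omega \ openCells L (ε n)))
    have h2 := abs_integral_coord_mul_le hvr (memLp_comp_hat (hrs n) hhr) j
    have h3 := eLpNorm_comp_hat_le (hrs n) hhr
    have h4 : (eLpNorm (v n) 2 (volume.restrict (rest n))).toReal ≤ √(M * ε n) :=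
      (ENNReal.toReal_mono (hv n).2.ne
        (eLpNorm_mono_measure _ (Measure.restrict_mono Set.sdiff_subset le_rfl))).trans (hvn n)
    have h5 : (eLpNorm h 2 (volume.restrict (omega \ openCells L (ε n)))).toReal ≤
        (volume (omega \ openCells L (ε n))).toReal ^ (1 / 2 : ℝ) * B := by
      have hne : volume (omega \ openCells L (ε n)) ≠ ⊤ :=
        measure_ne_top_of_subset Set.sdiff_subset (by simp [volume_omega])
      have := eLpNorm_le_of_ae_bound (p := 2) (μ := volume.restrict (omega \ openCells L (ε n)))
        (Eventually.of_forall hB)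
      rw [Measure.restrict_apply_univ] at this
      have := ENNReal.toReal_mono (ENNReal.mul_ne_top
        (ENNReal.rpow_ne_top_of_nonneg (by simp) hne) ENNReal.ofReal_ne_top) this
      rw [ENNReal.toReal_mul, ← ENNReal.toReal_rpow, ENNReal.toReal_ofReal hB0] at this
      simpa using this
    have hεn := hε n
    rw [norm_mul, Real.norm_of_nonneg (by positivity : 0 ≤ (ε n)⁻¹), Real.norm_eq_abs]
    calc (ε n)⁻¹ * |∫ x in rest n, v n x j * h (hat x)|
        ≤ (ε n)⁻¹ * (√(M * ε n) * (√(ε n * G₁) *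
          ((volume (omega \ openCells L (ε n))).toReal ^ (1 / 2 : ℝ) * B))) := by
          gcongr
          refine h2.trans (mul_le_mul h4 (h3.trans ?_) (by positivity) (by positivity))
          gcongr
      _ = ((ε n)⁻¹ * (√(M * ε n) * √(ε n * G₁))) *
          ((volume (omega \ openCells L (ε n))).toReal ^ (1 / 2 : ℝ) * B) := by ring
      _ = _ := by rw [inv_mul_sqrt_mul_sqrt hεn hM]
  -- the part covered by cells
  have hweak : Tendsto (fun n => ∫ p, unfoldOp L (ε n) (v n) p.1 p.2 j * h p.1 ∂ν) atTop
      (𝓝 (∫ p, u p.1 p.2 j * h p.1 ∂ν)) := by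
    have hw : IsL2Prod omega (cellYstar L G)
        (fun x _ => (EuclideanSpace.single j (h x) : E 3)) := by
      refine (memLp_comp_fst hG (hhm _)).congr_norm ?_ (Eventually.of_forall fun p => by simp [Function.uncurry])
      have : Continuous fun p : E 2 × E 3 => (EuclideanSpace.single j (h p.1) : E 3) := by
        have e : (fun p : E 2 × E 3 => (EuclideanSpace.single j (h p.1) : E 3)) =
          fun p => h p.1 • EuclideanSpace.single j (1 : ℝ) := by
          ext p k; simp
        rw [e]; fun_prop
      exact this.aestronglyMeasurable
    have := hu.2.2 _ hw
    simpa only [innerL2, EuclideanSpace.inner_single_right, conj_trivial, mul_comm (h _)] using this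
  -- Unfolding evaluates h at a point within ε(L₁ + L₂) of x̂, so uniform continuity bounds the
  -- error by δ times the L¹ norm of the unfolded field, which is at most S.
  have hdiff : Tendsto (fun n => (∫ p, unfoldOp L (ε n) (fun x => v n x j * h (hat x)) p.1 p.2 ∂ν)
      - ∫ p, unfoldOp L (ε n) (v n) p.1 p.2 j * h p.1 ∂ν) atTop (𝓝 0) := by
    set N1 := (eLpNorm (fun _ : E 2 × E 3 => (1 : ℝ)) 2 ν).toReal
    set S := √(M * (L 0 * L 1)) * N1 with hS
    have hS0 : 0 ≤ S := by positivity
    rw [Metric.tendsto_atTop]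
    intro η hη
    set δ := η / (S + 1) with hδ
    have hδ0 : 0 < δ := by positivity
    obtain ⟨r, hr, hrh⟩ := Metric.uniformContinuous_iff.1 huc δ hδ0
    have hev : ∀ᶠ n in atTop, ε n * (L 0 + L 1) < r := by
      have := hlim.mul_const (L 0 + L 1)
      rw [zero_mul] at this
      exact this.eventually (gt_mem_nhds hr)
    obtain ⟨N, hN⟩ := eventually_atTop.1 hev
    refine ⟨N, fun n hn => ?_⟩
    have hi1 : Integrable (fun p : E 2 × E 3 =>
        unfoldOp L (ε n) (fun x => v n x j * h (hat x)) p.1 p.2) ν := by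
      have hm2 : MemLp (fun x => v n x j * h (hat x)) 2 (volume.restrict (thinDomain G (ε n))) := by
        refine MemLp.of_le_mul (c := B) (hv n) (hfm n) (Eventually.of_forall fun x => ?_)
        rw [norm_mul, mul_comm]
        exact mul_le_mul (hB _) (PiLp.norm_apply_le _ _) (norm_nonneg _) hB0
      exact (memLp_unfoldOp hL hGc hper (hε n) hm2).integrable (by norm_num)
    have hi2 : Integrable (fun p : E 2 × E 3 => unfoldOp L (ε n) (v n) p.1 p.2 j * h p.1) ν :=
      integrable_coord_mul (hTm n) (memLp_comp_fst hG (hhm _)) j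
    have hi3 : Integrable (fun p : E 2 × E 3 => δ * ‖unfoldOp L (ε n) (v n) p.1 p.2‖) ν :=
      ((hTm n).integrable (by norm_num)).norm.const_mul δ
    rw [Real.dist_eq, sub_zero, ← integral_sub hi1 hi2]
    have hb : ∀ᵐ p ∂ν, ‖unfoldOp L (ε n) (fun x => v n x j * h (hat x)) p.1 p.2
        - unfoldOp L (ε n) (v n) p.1 p.2 j * h p.1‖ ≤
        δ * ‖unfoldOp L (ε n) (v n) p.1 p.2‖ := by
      filter_upwards [ae_restrict_mem (measurableSet_omega.prod
        (isOpen_cellYstar hGc L).measurableSet)] with p hp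
      rw [unfoldOp_eq, unfoldOp_eq]
      split_ifs with hx
      · rw [← mul_sub, norm_mul, mul_comm]
        have hd := hrh ((dist_hat_unfoldPoint_le hL (hε n) hx hp.2).trans_lt (hN n hn))
        exact mul_le_mul hd.le (PiLp.norm_apply_le _ _) (norm_nonneg _) hδ0.le
      · simp
    have h1 := norm_integral_le_of_norm_le hi3 hb
    rw [integral_const_mul] at h1
    have h2 : ∫ p, ‖unfoldOp L (ε n) (v n) p.1 p.2‖ ∂ν ≤ S := by
      have h3 := norm_integral_pairing_le (ContinuousLinearMap.mul ℝ ℝ) (hTm n).norm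
        (memLp_const (1 : ℝ) (μ := ν) (p := 2))
      simp only [ContinuousLinearMap.mul_apply', mul_one, eLpNorm_norm] at h3
      refine (le_abs_self _).trans (h3.trans ?_)
      rw [hS]
      have h4 : ‖ContinuousLinearMap.mul ℝ ℝ‖ ≤ 1 := ContinuousLinearMap.opNorm_mul_le ℝ ℝ
      calc _ ≤ 1 * √(M * (L 0 * L 1)) * N1 := by gcongr; exact hTn n
        _ = _ := by ring
    calc _ ≤ δ * ∫ p, ‖unfoldOp L (ε n) (v n) p.1 p.2‖ ∂ν := h1
      _ ≤ δ * S := by gcongr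
      _ < δ * (S + 1) := by nlinarith
      _ = η := by rw [hδ]; field_simp
  have hmain := ((hdiff.add hweak).const_mul (L 0 * L 1)⁻¹).add hrestlim
  simp only [zero_add, add_zero, sub_add_cancel] at hmain
  refine hmain.congr fun n => ?_
  have hi : IntegrableOn (fun x => v n x j * h (hat x)) (thinDomain G (ε n)) :=
    integrable_coord_mul (hv n) (memLp_comp_hat (hs n) (hhm _)) j
  rw [hν, integral_unfoldOp hL hGc hper (hε n) (hfm n), smul_eq_mul,
    ← integral_inter_add_sdiff (hin n) hi, Set.inter_eq_right.2 innerDomain_subset]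
  have := (hε n).ne'
  simp only [hrest]
  field_simp

theorem tendsto_average (hL : ∀ i, 0 < L i) (hGc : Continuous G)
    (hper : YPeriodic L G) (hG : ∀ y, G y ≤ G₁) (hM : 0 ≤ M) {ε : ℕ → ℝ} (hε : ∀ n, 0 < ε n)
    (hlim : Tendsto ε atTop (𝓝 0)) {v : ℕ → E 3 → E 3}
    (hv : ∀ n, IsL2 (thinDomain G (ε n)) (v n))
    (hvM : ∀ n, (eLpNorm (v n) 2 (volume.restrict (thinDomain G (ε n)))).toReal ^ 2 ≤ M * ε n)
    {u : E 2 → E 3 → E 3}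
    (hu : WeakTendstoL2 omega (cellYstar L G) (fun n => unfoldOp L (ε n) (v n)) u) (j : Fin 3)
    {h : E 2 → ℝ} (hh : IsL2 omega h) :
    Tendsto (fun n => (ε n)⁻¹ * ∫ x in thinDomain G (ε n), v n x j * h (hat x)) atTop
      (𝓝 ((L 0 * L 1)⁻¹ * ∫ p in omega ×ˢ cellYstar L G, u p.1 p.2 j * h p.1)) := by
  have hL0 := hL 0
  have hL1 := hL 1
  have hs := fun n => thinDomain_subset_slab (hε n) hG
  set ν := (volume : Measure (E 2 × E 3)).restrict (omega ×ˢ cellYstar L G) with hν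
  set K2 := (L 0 * L 1)⁻¹ * ((eLpNorm (Function.uncurry u) 2 ν).toReal *
    (volume (cellYstar L G)).toReal ^ (1 / 2 : ℝ)) with hK2
  have hK20 : 0 ≤ K2 := by positivity
  have hreg : ((volume : Measure (E 2)).restrict omega).Regular :=
    Measure.Regular.restrict_of_measure_ne_top (by simp [volume_omega])
  refine tendsto_of_dense_of_lipschitz (ν := volume.restrict omega)
    (I := fun n h => (ε n)⁻¹ * ∫ x in thinDomain G (ε n), v n x j * h (hat x))
    (J := fun h => (L 0 * L 1)⁻¹ * ∫ p, u p.1 p.2 j * h p.1 ∂ν)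
    -- The first summand is the Lipschitz constant of the averages over Ω_ε, uniform in n; the
    -- second is that of the limit functional.
    (K := √(M * G₁) + K2) (by positivity) ?_ ?_
    (fun k hk hkc => tendsto_average_of_continuous hL hGc hper hG hM hε hlim hv hvM hu j hk hkc) hh
  · intro n h k hh hk
    have hεn := hε n
    simp only []
    rw [← mul_sub, ← integral_sub (integrable_coord_mul (hv n) (memLp_comp_hat (hs n) hh) j)
      (integrable_coord_mul (hv n) (memLp_comp_hat (hs n) hk) j)]
    simp only [← mul_sub]
    have hhk : MemLp (h - k) 2 (volume.restrict omega) := hh.sub hk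
    have h1 := abs_integral_coord_mul_le (hv n) (memLp_comp_hat (hs n) hhk) j
    have h2 := eLpNorm_comp_hat_le (hs n) hhk
    have h3 : (eLpNorm (v n) 2 (volume.restrict (thinDomain G (ε n)))).toReal ≤ √(M * ε n) :=
      Real.le_sqrt_of_sq_le (hvM n)
    rw [abs_mul, abs_of_nonneg (by positivity : 0 ≤ (ε n)⁻¹)]
    calc (ε n)⁻¹ * |∫ x in thinDomain G (ε n), v n x j * (h (hat x) - k (hat x))|
        ≤ (ε n)⁻¹ * (√(M * ε n) *
          (√(ε n * G₁) * (eLpNorm (h - k) 2 (volume.restrict omega)).toReal)) := by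
          gcongr
          exact h1.trans (mul_le_mul h3 h2 (by positivity) (by positivity))
      _ = ((ε n)⁻¹ * (√(M * ε n) * √(ε n * G₁))) *
          (eLpNorm (h - k) 2 (volume.restrict omega)).toReal := by ring
      _ ≤ _ := by
          rw [inv_mul_sqrt_mul_sqrt hεn hM]
          gcongr
          linarith
  · intro h k hh hk
    simp only []
    have hi : ∀ {k : E 2 → ℝ}, MemLp k 2 (volume.restrict omega) →
        Integrable (fun p : E 2 × E 3 => u p.1 p.2 j * k p.1) ν := fun hk =>
      integrable_coord_mul hu.2.1 (memLp_comp_fst hG hk) j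
    rw [← mul_sub, ← integral_sub (hi hh) (hi hk)]
    simp only [← mul_sub]
    have hhk : MemLp (h - k) 2 (volume.restrict omega) := hh.sub hk
    have h1 := abs_integral_coord_mul_le hu.2.1 (memLp_comp_fst (L := L) hG hhk) j
    rw [eLpNorm_comp_fst hhk] at h1
    rw [abs_mul, abs_of_nonneg (by positivity : 0 ≤ (L 0 * L 1)⁻¹)]
    calc _ ≤ (L 0 * L 1)⁻¹ * _ := mul_le_mul_of_nonneg_left h1 (by positivity)
      _ = K2 * (eLpNorm (h - k) 2 (volume.restrict omega)).toReal := by rw [hK2]; ring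
      _ ≤ _ := by
        gcongr
        linarith [Real.sqrt_nonneg (M * G₁)]

end Average

/-! ### Properties of the limit -/

section Limit

variable {L : Fin 2 → ℝ} {G : E 2 → ℝ} {G₁ : ℝ}

theorem integral_prod_eq_integral_mean (hG : ∀ y, G y ≤ G₁) {u : E 2 → E 3 → E 3}
    (hu : IsL2Prod omega (cellYstar L G) u) {h : E 2 → ℝ} (hh : IsL2 omega h) (j : Fin 3) :
    ∫ p in omega ×ˢ cellYstar L G, u p.1 p.2 j * h p.1 =
      ∫ x in omega, (∫ y in cellYstar L G, u x y j) * h x := by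
  have hi : Integrable (fun p : E 2 × E 3 => u p.1 p.2 j * h p.1)
      (volume.restrict (omega ×ˢ cellYstar L G)) :=
    integrable_coord_mul hu (memLp_comp_fst hG hh) j
  rw [restrict_prod_eq] at hi ⊢
  rw [integral_prod _ hi]
  simp only [integral_mul_const]

/-- Cauchy–Schwarz in y on the finite-measure cell, then Tonelli in x̂. -/
theorem isL2_mean (hG : ∀ y, G y ≤ G₁) {u : E 2 → E 3 → E 3}
    (hu : IsL2Prod omega (cellYstar L G) u) (j : Fin 3) :
    IsL2 omega (fun x => ∫ y in cellYstar L G, u x y j) := by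
  have huj : MemLp (fun p : E 2 × E 3 => u p.1 p.2 j) 2
      ((volume.restrict omega).prod (volume.restrict (cellYstar L G))) := by
    rw [← restrict_prod_eq]
    exact memLp_piLp_iff.1 hu j
  refine ⟨huj.1.integral_prod_right', ?_⟩
  set c : ℝ≥0∞ := volume (cellYstar L G) ^ (1 / 2 : ℝ)
  have hc : c ≠ ⊤ := ENNReal.rpow_ne_top_of_nonneg (by norm_num) (volume_cellYstar_lt_top hG).ne
  have hle : ∀ᵐ x ∂(volume.restrict omega), ‖∫ y in cellYstar L G, u x y j‖ₑ ≤
      eLpNorm (fun y => u x y j) 2 (volume.restrict (cellYstar L G)) * c := by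
    filter_upwards [huj.1.prodMk_left] with x hx
    refine (enorm_integral_le_lintegral_enorm _).trans ?_
    rw [← eLpNorm_one_eq_lintegral_enorm]
    refine (eLpNorm_le_eLpNorm_mul_rpow_measure_univ (p := 1) (q := 2) (by norm_num) hx).trans
      (le_of_eq ?_)
    rw [Measure.restrict_apply_univ]
    norm_num [c]
  have hsq : eLpNorm (fun x => ∫ y in cellYstar L G, u x y j) 2 (volume.restrict omega) ^ 2 < ⊤ := by
    rw [eLpNorm_two_sq]
    calc _ ≤ ∫⁻ x in omega,
          eLpNorm (fun y => u x y j) 2 (volume.restrict (cellYstar L G)) ^ 2 * c ^ 2 := by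
          refine lintegral_mono_ae ?_
          filter_upwards [hle] with x hx
          rw [← mul_pow]
          gcongr
      _ = eLpNorm (fun p : E 2 × E 3 => u p.1 p.2 j) 2
          ((volume.restrict omega).prod (volume.restrict (cellYstar L G))) ^ 2 * c ^ 2 := by
          rw [lintegral_mul_const' _ _ (by finiteness), ← lintegral_eLpNorm_slice_sq huj.1]
      _ < ⊤ := by finiteness [huj.2.ne]
  by_contra hcon
  rw [not_lt, top_le_iff] at hcon
  simp [hcon] at hsq

theorem isL2_meanFlux (hG : ∀ y, G y ≤ G₁) {u : E 2 → E 3 → E 3}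
    (hu : IsL2Prod omega (cellYstar L G) u) : IsL2 omega (meanFlux (cellYstar L G) u) := by
  refine memLp_piLp_iff.2 fun i => ?_
  fin_cases i
  · exact isL2_mean hG hu 0
  · exact isL2_mean hG hu 1

theorem meanFlux_apply (Z : Set (E 3)) (u : E 2 → E 3 → E 3) (x : E 2) (i : Fin 2) :
    meanFlux Z u x i = ∫ y in Z, u x y i.castSucc := by
  fin_cases i <;> rfl

theorem unfoldOp_divg {ε : ℝ} (Dv : Fin 3 → E 3 → E 3) (x : E 2) (y : E 3) :
    unfoldOp L ε (divg Dv) x y = ∑ i, unfoldOp L ε (Dv i) x y i := by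
  simp only [unfoldOp]
  split_ifs <;> simp [divg]

/-- The divergence D of the limit is itself an L² function and may be used as test function; the
limit of zeros is then ∫ D². -/
theorem ae_divg_eq_zero_of_weak {A : Set (E 2)} {Z : Set (E 3)}
    {DU : ℕ → Fin 3 → E 2 → E 3 → E 3} {Du : Fin 3 → E 2 → E 3 → E 3}
    (h : ∀ i, WeakTendstoL2 A Z (fun n => DU n i) (Du i))
    (h0 : ∀ n, ∀ᵐ p ∂((volume : Measure (E 2 × E 3)).restrict (A ×ˢ Z)),
      ∑ i, DU n i p.1 p.2 i = 0) :
    ∀ᵐ p ∂((volume : Measure (E 2 × E 3)).restrict (A ×ˢ Z)),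
      divg (fun i => Du i p.1) p.2 = 0 := by
  set D : E 2 × E 3 → ℝ := fun p => ∑ i, Du i p.1 p.2 i with hD
  have hDm : MemLp D 2 (volume.restrict (A ×ˢ Z)) :=
    memLp_finsetSum _ fun i _ => memLp_piLp_iff.1 (h i).2.1 i
  have hw : ∀ i : Fin 3, IsL2Prod A Z (fun x y => (EuclideanSpace.single i (D (x, y)) : E 3)) := by
    intro i
    refine memLp_piLp_iff.2 fun k => ?_
    by_cases hk : k = i
    · subst hk
      simpa [Function.uncurry] using hDm
    · simp [Function.uncurry, hk]
  have hi : ∀ {w : E 2 → E 3 → E 3}, IsL2Prod A Z w → ∀ i : Fin 3,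
      Integrable (fun p : E 2 × E 3 => w p.1 p.2 i * D p) (volume.restrict (A ×ˢ Z)) :=
    fun hw i => integrable_coord_mul hw hDm i
  have ht : Tendsto (fun n => ∑ i, ∫ p in A ×ˢ Z, DU n i p.1 p.2 i * D p) atTop
      (𝓝 (∑ i, ∫ p in A ×ˢ Z, Du i p.1 p.2 i * D p)) := by
    refine tendsto_finsetSum _ fun i _ => ?_
    have := (h i).2.2 _ (hw i)
    simpa only [innerL2, EuclideanSpace.inner_single_right, conj_trivial, mul_comm (D _)] using this
  have hz : ∀ n, ∑ i, ∫ p in A ×ˢ Z, DU n i p.1 p.2 i * D p = 0 := by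
    intro n
    rw [← integral_finsetSum _ fun i _ => hi ((h i).1 n) i]
    refine integral_eq_zero_of_ae ?_
    filter_upwards [h0 n] with p hp
    rw [← Finset.sum_mul, hp, zero_mul, Pi.zero_apply]
  simp only [hz] at ht
  have hfin := tendsto_nhds_unique ht tendsto_const_nhds
  rw [← integral_finsetSum _ fun i _ => hi (h i).2.1 i] at hfin
  have hsq : ∫ p in A ×ˢ Z, D p ^ 2 = 0 := by
    rw [← hfin]
    refine integral_congr_ae (Eventually.of_forall fun p => ?_)
    simp only [← Finset.sum_mul, sq, hD]
  rw [integral_eq_zero_iff_of_nonneg (fun p => sq_nonneg _) hDm.integrable_sq] at hsq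
  filter_upwards [hsq] with p hp
  simpa [hD, divg] using hp

variable {M : ℝ} {ε : ℕ → ℝ} {v : ℕ → E 3 → E 3} {Dv : ℕ → Fin 3 → E 3 → E 3}
  {u : E 2 → E 3 → E 3}

/-- Pass to the limit in the orthogonality to ∇q(x̂). Admitting every q in H¹(ω), not only test
functions, encodes the normal condition along with the divergence. -/
theorem sum_integral_meanFlux_eq_zero (hL : ∀ i, 0 < L i) (hGc : Continuous G)
    (hper : YPeriodic L G) (hG : ∀ y, G y ≤ G₁) (hM : 0 ≤ M) (hε : ∀ n, 0 < ε n)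
    (hlim : Tendsto ε atTop (𝓝 0)) (hv : ∀ n, IsAdmissible G (ε n) (v n) (Dv n))
    (hvM : ∀ n, (eLpNorm (v n) 2 (volume.restrict (thinDomain G (ε n)))).toReal ^ 2 ≤ M * ε n)
    (hu : WeakTendstoL2 omega (cellYstar L G) (fun n => unfoldOp L (ε n) (v n)) u)
    {q : E 2 → ℝ} {Dq : Fin 2 → E 2 → ℝ} (hq : IsH1 omega q Dq) :
    ∫ x in omega, ∑ i, meanFlux (cellYstar L G) u x i * Dq i x = 0 := by
  have hLpos : 0 < L 0 * L 1 := mul_pos (hL 0) (hL 1)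
  have ht : Tendsto (fun n => ∑ i : Fin 2, (ε n)⁻¹ *
      ∫ x in thinDomain G (ε n), v n x i.castSucc * Dq i (hat x)) atTop
      (𝓝 (∑ i : Fin 2, (L 0 * L 1)⁻¹ *
        ∫ p in omega ×ˢ cellYstar L G, u p.1 p.2 i.castSucc * Dq i p.1)) :=
    tendsto_finsetSum _ fun i _ => tendsto_average hL hGc hper hG hM hε hlim
      (fun n => (hv n).1.1.1) hvM hu i.castSucc (hq.2.1 i)
  simp only [← Finset.mul_sum] at ht
  simp only [(hv _).integral_horizontal_grad (hε _) hG hq, mul_zero] at ht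
  have h0 := tendsto_nhds_unique ht tendsto_const_nhds
  have h1 := (mul_eq_zero.1 h0).resolve_left (by positivity)
  simp only [integral_prod_eq_integral_mean hG hu.2.1 (hq.2.1 _)] at h1
  rw [integral_finsetSum _ fun i _ =>
    integrable_coord_mul (isL2_meanFlux hG hu.2.1) (hq.2.1 i) i, ← h1]
  simp only [meanFlux_apply]

theorem ae_integral_vertical_eq_zero (hL : ∀ i, 0 < L i) (hGc : Continuous G)
    (hper : YPeriodic L G) (hG₁ : 0 ≤ G₁) (hG : ∀ y, G y ≤ G₁) (hM : 0 ≤ M) (hε : ∀ n, 0 < ε n)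
    (hlim : Tendsto ε atTop (𝓝 0)) (hv : ∀ n, IsAdmissible G (ε n) (v n) (Dv n))
    (hvM : ∀ n, (eLpNorm (v n) 2 (volume.restrict (thinDomain G (ε n)))).toReal ^ 2 ≤ M * ε n)
    (hu : WeakTendstoL2 omega (cellYstar L G) (fun n => unfoldOp L (ε n) (v n)) u) :
    ∀ᵐ x ∂((volume : Measure (E 2)).restrict omega), ∫ y in cellYstar L G, u x y 2 = 0 := by
  have hLpos : 0 < L 0 * L 1 := mul_pos (hL 0) (hL 1)
  have hs := fun n => thinDomain_subset_slab (hε n) hG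
  have hz : ∀ q : E 2 → ℝ, IsTest omega q →
      ∫ x in omega, (∫ y in cellYstar L G, u x y 2) * q x = 0 := by
    intro q hq
    have ht := tendsto_average hL hGc hper hG hM hε hlim
      (fun n => (hv n).1.1.1) hvM hu 2 (hq.memLp (volume.restrict omega) 2)
    have hD : ∀ i, MemLp (pderiv i q) 2 (volume.restrict omega) := fun i =>
      (hq.pderiv i).memLp _ 2
    have hb : Tendsto (fun n => ∑ i : Fin 2, √(M * G₁) * (ε n * G₁) *
        (eLpNorm (pderiv i q) 2 (volume.restrict omega)).toReal) atTop (𝓝 0) := by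
      have hi : ∀ i : Fin 2, Tendsto (fun n => √(M * G₁) * (ε n * G₁) *
          (eLpNorm (pderiv i q) 2 (volume.restrict omega)).toReal) atTop (𝓝 0) := fun i => by
        simpa using ((hlim.mul_const G₁).const_mul √(M * G₁)).mul_const
          (eLpNorm (pderiv i q) 2 (volume.restrict omega)).toReal
      simpa using tendsto_finsetSum Finset.univ fun i _ => hi i
    have h0 : Tendsto (fun n => (ε n)⁻¹ * ∫ x in thinDomain G (ε n), v n x 2 * q (hat x)) atTop
        (𝓝 0) := by
      refine squeeze_zero_norm (fun n => ?_) hb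
      have hεn := hε n
      rw [(hv n).integral_vertical hGc hεn hG hq, norm_mul, norm_neg,
        Real.norm_of_nonneg (by positivity : 0 ≤ (ε n)⁻¹)]
      refine (mul_le_mul_of_nonneg_left (norm_sum_le _ _) (by positivity)).trans ?_
      rw [Finset.mul_sum]
      refine Finset.sum_le_sum fun i _ => ?_
      have hk := memLp_comp_hat (hs n) (hD i)
      have h1 := abs_integral_coord_mul_le (hv n).1.1.1 (memLp_height_mul hGc hεn hG hk) i.castSucc
      have h2 := (eLpNorm_height_mul_le hGc hεn hG₁ hG hk).trans
        (mul_le_mul_of_nonneg_left (eLpNorm_comp_hat_le (hs n) (hD i)) (by positivity))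
      have h3 : (eLpNorm (v n) 2 (volume.restrict (thinDomain G (ε n)))).toReal ≤ √(M * ε n) :=
        Real.le_sqrt_of_sq_le (hvM n)
      calc _ ≤ (ε n)⁻¹ * (√(M * ε n) * (ε n * G₁ *
            (√(ε n * G₁) * (eLpNorm (pderiv i q) 2 (volume.restrict omega)).toReal))) := by
            rw [Real.norm_eq_abs]
            gcongr
            exact h1.trans (mul_le_mul h3 h2 (by positivity) (by positivity))
        _ = ((ε n)⁻¹ * (√(M * ε n) * √(ε n * G₁))) * (ε n * G₁) *
            (eLpNorm (pderiv i q) 2 (volume.restrict omega)).toReal := by ring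
        _ = _ := by rw [inv_mul_sqrt_mul_sqrt hεn hM]
    have h1 := (mul_eq_zero.1 (tendsto_nhds_unique ht h0)).resolve_left (by positivity)
    rwa [integral_prod_eq_integral_mean hG hu.2.1 (hq.memLp _ 2)] at h1
  have hm := isL2_mean hG hu.2.1 2
  have hfin : IsFiniteMeasure ((volume : Measure (E 2)).restrict omega) :=
    ⟨by simp [volume_omega]⟩
  have hi : IntegrableOn (fun x => ∫ y in cellYstar L G, u x y 2) omega :=
    MemLp.integrable (by norm_num) hm
  rw [ae_restrict_iff' measurableSet_omega]
  -- Fundamental lemma of the calculus of variations on the open set ω.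
  refine isOpen_omega.ae_eq_zero_of_integral_contDiff_smul_eq_zero hi.locallyIntegrableOn ?_
  intro q hq hqc hqs
  have hqt : IsTest omega q := ⟨hq, hqc, hqs⟩
  rw [← hz q hqt, setIntegral_eq_integral_of_forall_compl_eq_zero
    (fun x hx => by rw [hqt.eq_zero hx, mul_zero])]
  simp only [smul_eq_mul, mul_comm]

end Limit

end ThinBingham

/-! ### The convergence theorem -/

open ThinBingham
theorem proposition5p2
    (L : Fin 2 → ℝ) (hL : ∀ i, 0 < L i)
    (G : E 2 → ℝ) (hGsmooth : ContDiff ℝ ∞ G) (hGper : YPeriodic L G)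
    (G₀ G₁ : ℝ) (hG₀ : 0 < G₀) (hG : ∀ y, G₀ ≤ G y ∧ G y ≤ G₁)
    (μ g : ℝ) (hμ : 0 < μ) (hg : 0 < g)
    (ε : ℕ → ℝ) (hεpos : ∀ n, 0 < ε n) (hεlim : Tendsto ε atTop (𝓝 0))
    (f : ℕ → E 3 → E 3) (hf : ∀ n, IsL2 (thinDomain G (ε n)) (f n))
    (C : ℝ) (hfC : ∀ n, rescaledL2Norm G (ε n) (f n) ≤ C)
    (uε : ℕ → E 3 → E 3) (Duε : ℕ → Fin 3 → E 3 → E 3)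
    (hu : ∀ n, IsBinghamSolution G μ g (ε n) (f n) (uε n) (Duε n)) :
    ∃ σ : ℕ → ℕ, StrictMono σ ∧
      ∃ (u : E 2 → E 3 → E 3) (Du : Fin 3 → E 2 → E 3 → E 3),
        IsL2H1 omega (cellYstar L G) u Du ∧
        (∃ DT : ℕ → Fin 3 → E 2 → E 3 → E 3,
          WeakTendstoL2H1 omega (cellYstar L G)
            (fun n => unfoldOp L (ε (σ n)) (uε (σ n))) DT u Du) ∧
        (∀ i, WeakTendstoL2 omega (cellYstar L G)
          (fun n x y => ε (σ n) • unfoldOp L (ε (σ n)) (Duε (σ n) i) x y) (Du i)) ∧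
        (∀ᵐ p ∂((volume : Measure (E 2 × E 3)).restrict (omega ×ˢ cellYstar L G)),
          divg (fun i => Du i p.1) p.2 = 0) ∧
        (∀ᵐ x ∂((volume : Measure (E 2)).restrict omega),
          HasTrace (cellYstar L G) (bottomYstar L ∪ topYstar L G) (u x) (fun i => Du i x)
            (fun _ => 0)) ∧
        (∀ᵐ x ∂((volume : Measure (E 2)).restrict omega),
          ∫ y in cellYstar L G, u x y 2 = 0) ∧
        HasWeakDiv omega (meanFlux (cellYstar L G) u) (fun _ => 0) ∧
        HasZeroNormalTrace omega (meanFlux (cellYstar L G) u) (fun _ => 0) := by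
  have hGc := hGsmooth.continuous
  have hG1 : ∀ y, G y ≤ G₁ := fun y => (hG y).2
  have hG₁ : 0 ≤ G₁ := hG₀.le.trans ((hG 0).1.trans (hG 0).2)
  have hLpos : 0 < L 0 * L 1 := mul_pos (hL 0) (hL 1)
  have hC : 0 ≤ C := by
    refine le_trans ?_ (hfC 0)
    have := hεpos 0
    unfold rescaledL2Norm
    positivity
  obtain ⟨M, hM, hbound⟩ := exists_energy_bound hG₁ hG1 hμ hg.le hC
  have hb := fun n => hbound (ε n) (f n) (uε n) (Duε n) (hεpos n) (hf n) (hfC n) (hu n)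
  have hsl := fun n => (hu n).1.1.isSmoothLimit_unfoldOp hL hGc hGper (hεpos n)
  have hΓ : MeasurableSet (bottomYstar L ∪ topYstar L G) := measurableSet_bottom_union_top hGc
  -- The unfolding factor of order ε^{-1/2} cancels the a priori bound of order ε^{1/2}, leaving a
  -- bound independent of n.
  have hsq : ∀ n, √(L 0 * L 1 / ε n) * √(M * ε n) = √(L 0 * L 1 * M) := fun n => by
    have := hεpos n
    rw [← Real.sqrt_mul (by positivity)]
    congr 1
    field_simp
  obtain ⟨σ, hσ, u, Du, hu1, htr, hw, hwD⟩ := exists_weak_limit hΓ hsl (M := √(L 0 * L 1 * M))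
    (fun n => by
      refine (toReal_eLpNorm_unfoldOp_le hL hGc hGper (hεpos n) (hu n).1.1.1.1).trans ?_
      rw [← hsq n]
      exact mul_le_mul_of_nonneg_left (Real.le_sqrt_of_sq_le (hb n).1) (Real.sqrt_nonneg _))
    (fun n i => by
      have h1 := toReal_eLpNorm_unfoldOp_le hL hGc hGper (hεpos n) ((hu n).1.1.1.2.1 i)
      have h2 : (eLpNorm (Function.uncurry fun x y => ε n • unfoldOp L (ε n) (Duε n i) x y) 2
          (volume.restrict (omega ×ˢ cellYstar L G))).toReal = ε n *
          (eLpNorm (Function.uncurry (unfoldOp L (ε n) (Duε n i))) 2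
          (volume.restrict (omega ×ˢ cellYstar L G))).toReal := by
        have h3 := eLpNorm_const_smul (ε n) (Function.uncurry (unfoldOp L (ε n) (Duε n i))) 2
          (volume.restrict (omega ×ˢ cellYstar L G))
        have h4 := congrArg ENNReal.toReal h3
        rw [ENNReal.toReal_mul, toReal_enorm, Real.norm_of_nonneg (hεpos n).le] at h4
        exact h4
      have h5 : ε n * (eLpNorm (Duε n i) 2 (volume.restrict (thinDomain G (ε n)))).toReal ≤
          √(M * ε n) := Real.le_sqrt_of_sq_le (by rw [mul_pow]; exact (hb n).2 i)
      rw [h2, ← hsq n]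
      calc _ ≤ ε n * (√(L 0 * L 1 / ε n) *
            (eLpNorm (Duε n i) 2 (volume.restrict (thinDomain G (ε n)))).toReal) :=
            mul_le_mul_of_nonneg_left h1 (hεpos n).le
        _ = √(L 0 * L 1 / ε n) *
            (ε n * (eLpNorm (Duε n i) 2 (volume.restrict (thinDomain G (ε n)))).toReal) := by ring
        _ ≤ _ := mul_le_mul_of_nonneg_left h5 (Real.sqrt_nonneg _))
  have hlimσ : Tendsto (fun n => ε (σ n)) atTop (𝓝 0) := hεlim.comp hσ.tendsto_atTop
  have hflux : ∀ {q : E 2 → ℝ} {Dq : Fin 2 → E 2 → ℝ}, IsH1 omega q Dq →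
      ∫ x in omega, ∑ i, meanFlux (cellYstar L G) u x i * Dq i x = 0 := fun hq =>
    sum_integral_meanFlux_eq_zero hL hGc hGper hG1 hM (fun n => hεpos (σ n)) hlimσ
      (fun n => (hu (σ n)).1) (fun n => (hb (σ n)).1) hw hq
  have hdivflux : HasWeakDiv omega (meanFlux (cellYstar L G) u) (fun _ => 0) := by
    intro φ hφ
    rw [hflux hφ.isH1]
    simp
  -- The y-derivatives of the unfolded fields are the unfolded derivatives times ε. Weak convergence
  -- in L²(ω; H¹) is then the sum of the four weak L² convergences.
  refine ⟨σ, hσ, u, Du, hu1, ⟨fun n i x y => ε (σ n) • unfoldOp L (ε (σ n)) (Duε (σ n) i) x y,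
    fun n => (hsl (σ n)).isL2H1 hΓ, hu1, fun w Dw hwt => ?_⟩, hwD, ?_, htr, ?_, hdivflux,
    isL2_meanFlux hG1 hw.2.1, MemLp.zero, hdivflux, fun q Dq hq => ?_⟩
  · exact (hw.2.2 w hwt.1).add (tendsto_finsetSum _ fun i _ => (hwD i).2.2 _ (hwt.2.1 i))
  · refine ae_divg_eq_zero_of_weak hwD fun n => ?_
    filter_upwards [unfoldOp_congr_ae hL hGc hGper (hεpos (σ n)) (P := fun c : ℝ => c = 0) rfl
      (hu (σ n)).1.2] with p hp
    rw [unfoldOp_divg] at hp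
    simp only [PiLp.smul_apply, smul_eq_mul, ← Finset.mul_sum, hp, mul_zero]
  · exact ae_integral_vertical_eq_zero hL hGc hGper hG₁ hG1 hM (fun n => hεpos (σ n)) hlimσ
      (fun n => (hu (σ n)).1) (fun n => (hb (σ n)).1) hw
  · simpa using hflux hq
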